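/- Let $\mathbb K$ be a field of characteristic $0$; operads are symmetric operads in $\mathbb K$-vector spaces. Let $\mathsf{Nov}$ be the operad of Novikov algebras, i.e. the operad generated by one binary operation $\circ$ (without symmetry) with the defining relations $$(x\circ y)\circ z-(y\circ x)\circ z=x\circ(y\circ z)-y\circ(x\circ z),\qquad (x\circ y)\circ z=(x\circ z)\circ y .$$ Let $\mathsf I$ be the operadic ideal of $\mathsf{Nov}$ generated by the commutator $[x_1,x_2]=x_1\circ x_2-x_2\circ x_1$, let $F^k_{\mathsf I}\mathsf{Nov}$ ($k\ge 0$) be spanned by the operadic compositions in which elements of $\mathsf I$ are used at least $k$ times (so that $F^0_{\mathsf I}\mathsf{Nov}=\mathsf{Nov}$ and $F^1_{\mathsf I}\mathsf{Nov}=\mathsf I$), and let $$\mathsf{grNov}=\bigoplus_{k\ge 0}F_{\mathsf I}^k\mathsf{Nov}/F_{\mathsf I}^{k+1}\mathsf{Nov}$$ be the associated graded operad. Let $\mathcal T$ be the free operad generated by two binary operations $\cdot$ and $[\,,]$ (without symmetry), and let $\mathsf R\subseteq\mathcal T$ be the operadic ideal generated by the defining relations of transposed Poisson algebras $$x\cdot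 y=y\cdot x,\quad (x\cdot y)\cdot z=x\cdot(y\cdot z),\quad [x,y]=-[y,x],\quad [[x,y],z]+[[y,z],x]+[[z,x],y]=0,$$ $$2[x,y]\cdot z=[x,y\cdot z]+[x\cdot z,y],$$ so that $\mathcal T/\mathsf R=\mathsf{TPois}$ is the operad of transposed Poisson algebras. There is a unique morphism of operads $\Phi:\mathcal T\to\mathsf{grNov}$ that sends $x_1\cdot x_2$ to the class of $x_1\circ x_2$ in $\mathsf{Nov}/\mathsf I$ and $[x_1,x_2]$ to the class of $x_1\circ x_2-x_2\circ x_1$ in $\mathsf I/F^2_{\mathsf I}\mathsf{Nov}$. It is surjective in every arity, and up to arity $4$ the space of relations of $\mathsf{grNov}$ is generated by the defining relations of $\mathsf{TPois}$, that is, $$\ker\Phi(n)=\mathsf R(n)\qquad\text{for all } n\le 4 .$$ -/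

import Mathlib

open scoped DirectSum

universe u

/-! ### Symmetric operads, indexed by finite sets, with partial compositions -/

namespace SymOperad

/-- The inputs that remain after an operation with set of inputs `κ` has been
inserted into the input `i` of an operation with set of inputs `ι`. -/
abbrev Ins {ι : Type} (i : ι) (κ : Type) : Type := {j : ι // j ≠ i} ⊕ κ

/-- Relabelling of `Ins i κ` induced by relabellings of `ι` and `κ`. -/
def insCongr {ι ι' κ κ' : Type} (i : ι) (e : ι ≃ ι') (f : κ ≃ κ') :
    Ins i κ ≃ Ins (e i) κ' :=
  Equiv.sumCongr (e.subtypeEquiv fun j => by simp) f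

/-- Inserting into `i` an operation, and then something into an input `j` of that operation. -/
def seqEquiv {ι κ τ : Type} (i : ι) (j : κ) :
    Ins (Sum.inr j : Ins i κ) τ ≃ Ins i (Ins j τ) where
  toFun
    | Sum.inl ⟨Sum.inl a, _⟩ => Sum.inl a
    | Sum.inl ⟨Sum.inr b, h⟩ => Sum.inr (Sum.inl ⟨b, fun hb => h (congrArg Sum.inr hb)⟩)
    | Sum.inr c => Sum.inr (Sum.inr c)
  invFun
    | Sum.inl a => Sum.inl ⟨Sum.inl a, by simp⟩
    | Sum.inr (Sum.inl b) => Sum.inl ⟨Sum.inr b.1, by simpa using b.2⟩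
    | Sum.inr (Sum.inr c) => Sum.inr c
  left_inv := by rintro (⟨a | b, h⟩ | c) <;> rfl
  right_inv := by rintro (a | b | c) <;> rfl

/-- Inserting into two different inputs `i` and `k`, in either order. -/
def parEquiv {ι κ τ : Type} (i k : ι) (hik : i ≠ k) :
    Ins (Sum.inl ⟨k, hik.symm⟩ : Ins i κ) τ ≃ Ins (Sum.inl ⟨i, hik⟩ : Ins k τ) κ where
  toFun
    | Sum.inl ⟨Sum.inl a, h⟩ =>
        Sum.inl ⟨Sum.inl ⟨a.1, fun ha => h (congrArg Sum.inl (Subtype.ext ha))⟩,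
          fun ha => a.2 (congrArg Subtype.val (Sum.inl.inj ha))⟩
    | Sum.inl ⟨Sum.inr b, _⟩ => Sum.inr b
    | Sum.inr c => Sum.inl ⟨Sum.inr c, by simp⟩
  invFun
    | Sum.inl ⟨Sum.inl a, h⟩ =>
        Sum.inl ⟨Sum.inl ⟨a.1, fun ha => h (congrArg Sum.inl (Subtype.ext ha))⟩,
          fun ha => a.2 (congrArg Subtype.val (Sum.inl.inj ha))⟩
    | Sum.inl ⟨Sum.inr c, _⟩ => Sum.inr c
    | Sum.inr b => Sum.inl ⟨Sum.inr b, by simp⟩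
  left_inv := by rintro (⟨a | b, h⟩ | c) <;> rfl
  right_inv := by rintro (⟨a | b, h⟩ | c) <;> rfl

/-- Inserting an operation into the only input of the identity. -/
def oneInsEquiv (κ : Type) : κ ≃ Ins () κ where
  toFun := Sum.inr
  invFun
    | Sum.inl a => (a.2 rfl).elim
    | Sum.inr b => b
  left_inv _ := rfl
  right_inv := by
    rintro (a | b)
    · exact (a.2 rfl).elim
    · rfl

open Classical in
/-- Inserting the identity into the input `i`. -/
noncomputable def insOneEquiv {ι : Type} (i : ι) : ι ≃ Ins i Unit where
  toFun j := if h : j = i then Sum.inr () else Sum.inl ⟨j, h⟩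
  invFun
    | Sum.inl a => a.1
    | Sum.inr _ => i
  left_inv j := by by_cases h : j = i <;> simp [h]
  right_inv := by
    rintro (a | b)
    · simp [a.2]
    · simp

end SymOperad

open SymOperad in
/-- A symmetric operad in `K`-vector spaces: a functor from finite sets and bijections to
vector spaces, with partial compositions `x ∘_i y` and an identity operation, satisfying the
equivariance, sequential and parallel associativity and unit axioms.
The space of operations of arity `n` is `obj (Fin n)`. -/
structure SymOperad (K : Type u) [Field K] where
  obj : (ι : Type) → [Finite ι] → Type u
  [addCommGroup : (ι : Type) → [Finite ι] → AddCommGroup (obj ι)]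
  [module : (ι : Type) → [Finite ι] → Module K (obj ι)]
  map : {ι κ : Type} → [Finite ι] → [Finite κ] → (ι ≃ κ) → obj ι →ₗ[K] obj κ
  one : obj Unit
  comp : {ι κ : Type} → [Finite ι] → [Finite κ] → (i : ι) →
    obj ι →ₗ[K] obj κ →ₗ[K] obj (Ins i κ)
  map_refl : ∀ {ι : Type} [Finite ι] (x : obj ι), map (Equiv.refl ι) x = x
  map_trans : ∀ {ι κ τ : Type} [Finite ι] [Finite κ] [Finite τ] (e : ι ≃ κ) (f : κ ≃ τ)
    (x : obj ι), map (e.trans f) x = map f (map e x)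
  comp_map : ∀ {ι ι' κ κ' : Type} [Finite ι] [Finite ι'] [Finite κ] [Finite κ']
    (i : ι) (e : ι ≃ ι') (f : κ ≃ κ') (x : obj ι) (y : obj κ),
    comp (e i) (map e x) (map f y) = map (insCongr i e f) (comp i x y)
  comp_seq : ∀ {ι κ τ : Type} [Finite ι] [Finite κ] [Finite τ] (i : ι) (j : κ)
    (x : obj ι) (y : obj κ) (z : obj τ),
    map (seqEquiv i j) (comp (Sum.inr j) (comp i x y) z) = comp i x (comp j y z)
  comp_par : ∀ {ι κ τ : Type} [Finite ι] [Finite κ] [Finite τ] (i k : ι) (hik : i ≠ k)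
    (x : obj ι) (y : obj κ) (z : obj τ),
    map (parEquiv i k hik) (comp (Sum.inl ⟨k, hik.symm⟩) (comp i x y) z) =
      comp (Sum.inl ⟨i, hik⟩) (comp k x z) y
  one_comp : ∀ {κ : Type} [Finite κ] (y : obj κ), comp () one y = map (oneInsEquiv κ) y
  comp_one : ∀ {ι : Type} [Finite ι] (i : ι) (x : obj ι),
    comp i x one = map (insOneEquiv i) x

namespace SymOperad

attribute [instance] SymOperad.addCommGroup SymOperad.module

section General

variable {K : Type u} [Field K]

/-- Morphisms of operads. -/
@[ext]
structure Hom (P Q : SymOperad K) where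
  app : (ι : Type) → [Finite ι] → P.obj ι →ₗ[K] Q.obj ι
  app_map : ∀ {ι κ : Type} [Finite ι] [Finite κ] (e : ι ≃ κ) (x : P.obj ι),
    app κ (P.map e x) = Q.map e (app ι x)
  app_one : app Unit P.one = Q.one
  app_comp : ∀ {ι κ : Type} [Finite ι] [Finite κ] (i : ι) (x : P.obj ι) (y : P.obj κ),
    app (Ins i κ) (P.comp i x y) = Q.comp i (app ι x) (app κ y)

/-! ### Operadic ideals and quotients -/

/-- Operadic ideals. -/
structure Ideal (P : SymOperad K) where
  carrier : (ι : Type) → [Finite ι] → Submodule K (P.obj ι)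
  map_mem : ∀ {ι κ : Type} [Finite ι] [Finite κ] (e : ι ≃ κ) {x : P.obj ι},
    x ∈ carrier ι → P.map e x ∈ carrier κ
  comp_mem_left : ∀ {ι κ : Type} [Finite ι] [Finite κ] (i : ι) {x : P.obj ι} (y : P.obj κ),
    x ∈ carrier ι → P.comp i x y ∈ carrier (Ins i κ)
  comp_mem_right : ∀ {ι κ : Type} [Finite ι] [Finite κ] (i : ι) (x : P.obj ι) {y : P.obj κ},
    y ∈ carrier κ → P.comp i x y ∈ carrier (Ins i κ)

/-- The operadic ideal generated by a family of sets of operations: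
the intersection of all operadic ideals that contain them. -/
def Ideal.span {P : SymOperad K} (R : (n : ℕ) → Set (P.obj (Fin n))) : P.Ideal where
  carrier ι _ :=
    { carrier := {x | ∀ J : P.Ideal, (∀ n, R n ⊆ J.carrier (Fin n)) → x ∈ J.carrier ι}
      add_mem' := fun hx hy J hJ => add_mem (hx J hJ) (hy J hJ)
      zero_mem' := fun _ _ => zero_mem _
      smul_mem' := fun c _ hx J hJ => Submodule.smul_mem _ c (hx J hJ) }
  map_mem e _ hx J hJ := J.map_mem e (hx J hJ)
  comp_mem_left i _ y hx J hJ := J.comp_mem_left i y (hx J hJ)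
  comp_mem_right i x _ hy J hJ := J.comp_mem_right i x (hy J hJ)

theorem Ideal.subset_span {P : SymOperad K} (R : (n : ℕ) → Set (P.obj (Fin n))) (n : ℕ) :
    R n ⊆ (Ideal.span R).carrier (Fin n) := fun _ hx _ hJ => hJ n hx

/-- The bilinear map induced on quotient spaces. -/
def quotBilin {M N L : Type u} [AddCommGroup M] [Module K M] [AddCommGroup N] [Module K N]
    [AddCommGroup L] [Module K L] (p : Submodule K M) (q : Submodule K N) (r : Submodule K L)
    (B : M →ₗ[K] N →ₗ[K] L) (hl : ∀ x ∈ p, ∀ y, B x y ∈ r) (hr : ∀ x, ∀ y ∈ q, B x y ∈ r) :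
    (M ⧸ p) →ₗ[K] (N ⧸ q) →ₗ[K] (L ⧸ r) :=
  p.liftQ (q.liftQ (B.compr₂ r.mkQ).flip fun y hy => LinearMap.mem_ker.2 <|
      LinearMap.ext fun x => (Submodule.Quotient.mk_eq_zero r).2 (hr x y hy)).flip
    fun x hx => LinearMap.mem_ker.2 <| LinearMap.ext fun y => by
      induction y using Submodule.Quotient.induction_on with
      | H y => exact (Submodule.Quotient.mk_eq_zero r).2 (hl x hx y)

@[simp]
theorem quotBilin_mk {M N L : Type u} [AddCommGroup M] [Module K M] [AddCommGroup N]
    [Module K N] [AddCommGroup L] [Module K L] (p : Submodule K M) (q : Submodule K N)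
    (r : Submodule K L) (B : M →ₗ[K] N →ₗ[K] L) (hl : ∀ x ∈ p, ∀ y, B x y ∈ r)
    (hr : ∀ x, ∀ y ∈ q, B x y ∈ r) (x : M) (y : N) :
    quotBilin p q r B hl hr (Submodule.Quotient.mk x) (Submodule.Quotient.mk y) =
      Submodule.Quotient.mk (B x y) := rfl

/-- The quotient of an operad by an operadic ideal. -/
def quotient (P : SymOperad K) (I : P.Ideal) : SymOperad K where
  obj ι _ := P.obj ι ⧸ I.carrier ι
  map e := Submodule.mapQ _ _ (P.map e) fun _ hx => I.map_mem e hx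
  one := Submodule.Quotient.mk P.one
  comp {ι κ} _ _ i := quotBilin (I.carrier ι) (I.carrier κ) (I.carrier (Ins i κ)) (P.comp i)
    (fun _ hx y => I.comp_mem_left i y hx) (fun x _ hy => I.comp_mem_right i x hy)
  map_refl x := by
    induction x using Submodule.Quotient.induction_on with
    | H x => simp [P.map_refl]
  map_trans e f x := by
    induction x using Submodule.Quotient.induction_on with
    | H x => simp [P.map_trans]
  comp_map i e f x y := by
    induction x using Submodule.Quotient.induction_on with
    | H x =>
      induction y using Submodule.Quotient.induction_on with
      | H y => simp [P.comp_map]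
  comp_seq i j x y z := by
    induction x using Submodule.Quotient.induction_on with
    | H x =>
      induction y using Submodule.Quotient.induction_on with
      | H y =>
        induction z using Submodule.Quotient.induction_on with
        | H z => simp [P.comp_seq]
  comp_par i k h x y z := by
    induction x using Submodule.Quotient.induction_on with
    | H x =>
      induction y using Submodule.Quotient.induction_on with
      | H y =>
        induction z using Submodule.Quotient.induction_on with
        | H z => simp [P.comp_par]
  one_comp y := by
    induction y using Submodule.Quotient.induction_on with
    | H y => simp [P.one_comp]
  comp_one i x := by
    induction x using Submodule.Quotient.induction_on with
    | H x => simp [P.comp_one]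

/-! ### Filtrations and the associated graded operad -/

/-- Decreasing filtrations of an operad that are compatible with the compositions. -/
structure Filtration (P : SymOperad K) where
  F : ℕ → (ι : Type) → [Finite ι] → Submodule K (P.obj ι)
  anti : ∀ (k : ℕ) (ι : Type) [Finite ι], F (k + 1) ι ≤ F k ι
  map_mem : ∀ (k : ℕ) {ι κ : Type} [Finite ι] [Finite κ] (e : ι ≃ κ) {x : P.obj ι},
    x ∈ F k ι → P.map e x ∈ F k κ
  one_mem : P.one ∈ F 0 Unit
  comp_mem : ∀ (a b : ℕ) {ι κ : Type} [Finite ι] [Finite κ] (i : ι) {x : P.obj ι}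
    {y : P.obj κ}, x ∈ F a ι → y ∈ F b κ → P.comp i x y ∈ F (a + b) (Ins i κ)

namespace Filtration

variable {P : SymOperad K} (f : P.Filtration)

/-- The homogeneous component `F k / F (k + 1)` of the associated graded operad. -/
abbrev piece (k : ℕ) (ι : Type) [Finite ι] : Type u :=
  f.F k ι ⧸ (f.F (k + 1) ι).comap (f.F k ι).subtype

/-- The class of an element of `F k` in the associated graded operad. -/
def toGr (k : ℕ) (ι : Type) [Finite ι] : f.F k ι →ₗ[K] ⨁ k, f.piece k ι :=
  DirectSum.lof K ℕ (fun k => f.piece k ι) k ∘ₗ Submodule.mkQ _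

theorem toGr_congr {k l : ℕ} (h : k = l) {ι : Type} [Finite ι] {x y : P.obj ι}
    (hx : x ∈ f.F k ι) (hy : y ∈ f.F l ι) (hxy : x = y) :
    f.toGr k ι ⟨x, hx⟩ = f.toGr l ι ⟨y, hy⟩ := by
  subst h; subst hxy; rfl

@[elab_as_elim]
theorem gr_induction {ι : Type} [Finite ι] {p : (⨁ k, f.piece k ι) → Prop}
    (x : ⨁ k, f.piece k ι) (zero : p 0) (add : ∀ x y, p x → p y → p (x + y))
    (cls : ∀ k x hx, p (f.toGr k ι ⟨x, hx⟩)) : p x := by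
  induction x using DirectSum.induction_on with
  | zero => exact zero
  | of k x =>
    induction x using Submodule.Quotient.induction_on with
    | H x => exact cls k x.1 x.2
  | add x y hx hy => exact add x y hx hy

/-- Relabelling on the homogeneous components. -/
def pieceMap (k : ℕ) {ι κ : Type} [Finite ι] [Finite κ] (e : ι ≃ κ) :
    f.piece k ι →ₗ[K] f.piece k κ :=
  Submodule.mapQ _ _ ((P.map e).restrict fun _ hx => f.map_mem k e hx)
    fun _ hx => f.map_mem (k + 1) e hx

/-- Partial composition on the filtration. -/
def compF (a b : ℕ) {ι κ : Type} [Finite ι] [Finite κ] (i : ι) :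
    f.F a ι →ₗ[K] f.F b κ →ₗ[K] f.F (a + b) (Ins i κ) :=
  LinearMap.mk₂ K (fun x y => ⟨P.comp i x.1 y.1, f.comp_mem a b i x.2 y.2⟩)
    (fun _ _ _ => Subtype.ext (by simp)) (fun _ _ _ => Subtype.ext (by simp))
    (fun _ _ _ => Subtype.ext (by simp)) (fun _ _ _ => Subtype.ext (by simp))

/-- Partial composition of homogeneous components. -/
def pieceComp (a b : ℕ) {ι κ : Type} [Finite ι] [Finite κ] (i : ι) :
    f.piece a ι →ₗ[K] f.piece b κ →ₗ[K] f.piece (a + b) (Ins i κ) :=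
  quotBilin _ _ _ (f.compF a b i)
    (fun _ hx y => by
      have := f.comp_mem (a + 1) b i hx y.2
      rwa [Nat.add_right_comm] at this)
    (fun x _ hy => f.comp_mem a (b + 1) i x.2 hy)

/-- Relabelling on the associated graded operad. -/
def grMap {ι κ : Type} [Finite ι] [Finite κ] (e : ι ≃ κ) :
    (⨁ k, f.piece k ι) →ₗ[K] ⨁ k, f.piece k κ :=
  DirectSum.toModule K ℕ _ fun k =>
    DirectSum.lof K ℕ (fun k => f.piece k κ) k ∘ₗ f.pieceMap k e

/-- Partial composition on the associated graded operad. -/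
def grComp {ι κ : Type} [Finite ι] [Finite κ] (i : ι) :
    (⨁ k, f.piece k ι) →ₗ[K] (⨁ k, f.piece k κ) →ₗ[K] ⨁ k, f.piece k (Ins i κ) :=
  DirectSum.toModule K ℕ _ fun a => LinearMap.flip <|
    DirectSum.toModule K ℕ _ fun b => LinearMap.flip <|
      (f.pieceComp a b i).compr₂
        (DirectSum.lof K ℕ (fun k => f.piece k (Ins i κ)) (a + b))

theorem grMap_toGr (k : ℕ) {ι κ : Type} [Finite ι] [Finite κ] (e : ι ≃ κ) (x : P.obj ι)
    (hx : x ∈ f.F k ι) :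
    f.grMap e (f.toGr k ι ⟨x, hx⟩) = f.toGr k κ ⟨P.map e x, f.map_mem k e hx⟩ := by
  simp only [grMap, toGr, LinearMap.comp_apply, DirectSum.toModule_lof]
  rfl

theorem grComp_toGr (a b : ℕ) {ι κ : Type} [Finite ι] [Finite κ] (i : ι) (x : P.obj ι)
    (y : P.obj κ) (hx : x ∈ f.F a ι) (hy : y ∈ f.F b κ) :
    f.grComp i (f.toGr a ι ⟨x, hx⟩) (f.toGr b κ ⟨y, hy⟩) =
      f.toGr (a + b) (Ins i κ) ⟨P.comp i x y, f.comp_mem a b i hx hy⟩ := by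
  simp only [grComp, toGr, LinearMap.comp_apply, DirectSum.toModule_lof, LinearMap.flip_apply]
  rfl

/-- The associated graded operad of a filtration, with underlying vector spaces
`⨁ k, F k / F (k + 1)`. -/
def gr : SymOperad K where
  obj ι _ := ⨁ k, f.piece k ι
  map e := f.grMap e
  one := f.toGr 0 Unit ⟨P.one, f.one_mem⟩
  comp i := f.grComp i
  map_refl x := by
    induction x using f.gr_induction with
    | zero => simp
    | add x y hx hy => simp [hx, hy]
    | cls k x hx =>
      rw [grMap_toGr]
      exact f.toGr_congr rfl _ _ (P.map_refl x)
  map_trans e e' x := by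
    induction x using f.gr_induction with
    | zero => simp
    | add x y hx hy => simp [hx, hy]
    | cls k x hx =>
      simp only [grMap_toGr]
      exact f.toGr_congr rfl _ _ (P.map_trans e e' x)
  comp_map i e e' x y := by
    induction x using f.gr_induction with
    | zero => simp
    | add x x' hx hx' => simp [hx, hx']
    | cls k x hx =>
      induction y using f.gr_induction with
      | zero => simp
      | add y y' hy hy' => simp [hy, hy']
      | cls l y hy =>
        simp only [grMap_toGr, grComp_toGr]
        exact f.toGr_congr rfl _ _ (P.comp_map i e e' x y)
  comp_seq i j x y z := by
    induction x using f.gr_induction with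
    | zero => simp
    | add x x' hx hx' => simp [hx, hx']
    | cls k x hx =>
      induction y using f.gr_induction with
      | zero => simp
      | add y y' hy hy' => simp [hy, hy']
      | cls l y hy =>
        induction z using f.gr_induction with
        | zero => simp
        | add z z' hz hz' => simp [hz, hz']
        | cls m z hz =>
          simp only [grMap_toGr, grComp_toGr]
          exact f.toGr_congr (Nat.add_assoc _ _ _) _ _ (P.comp_seq i j x y z)
  comp_par i j h x y z := by
    induction x using f.gr_induction with
    | zero => simp
    | add x x' hx hx' => simp [hx, hx']
    | cls k x hx =>
      induction y using f.gr_induction with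
      | zero => simp
      | add y y' hy hy' => simp [hy, hy']
      | cls l y hy =>
        induction z using f.gr_induction with
        | zero => simp
        | add z z' hz hz' => simp [hz, hz']
        | cls m z hz =>
          simp only [grMap_toGr, grComp_toGr]
          exact f.toGr_congr (Nat.add_right_comm _ _ _) _ _ (P.comp_par i j h x y z)
  one_comp y := by
    induction y using f.gr_induction with
    | zero => simp
    | add y y' hy hy' => simp [hy, hy']
    | cls l y hy =>
      simp only [grMap_toGr, grComp_toGr]
      exact f.toGr_congr (Nat.zero_add _) _ _ (P.one_comp y)
  comp_one i x := by
    induction x using f.gr_induction with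
    | zero => simp
    | add x x' hx hx' => simp [hx, hx']
    | cls k x hx =>
      simp only [grMap_toGr, grComp_toGr]
      exact f.toGr_congr rfl _ _ (P.comp_one i x)

end Filtration

/-- `I.IsProduct k x`: the operation `x` is an operadic composition of operations
in which elements of `I` are used `k` times (the others being arbitrary). -/
inductive Ideal.IsProduct {P : SymOperad K} (I : P.Ideal) :
    ℕ → (ι : Type) → [Finite ι] → P.obj ι → Prop
  | arbitrary {ι : Type} [Finite ι] (x : P.obj ι) : I.IsProduct 0 ι x
  | mem {ι : Type} [Finite ι] {x : P.obj ι} (hx : x ∈ I.carrier ι) : I.IsProduct 1 ι x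
  | map {k : ℕ} {ι κ : Type} [Finite ι] [Finite κ] (e : ι ≃ κ) {x : P.obj ι}
      (hx : I.IsProduct k ι x) : I.IsProduct k κ (P.map e x)
  | comp {a b : ℕ} {ι κ : Type} [Finite ι] [Finite κ] (i : ι) {x : P.obj ι} {y : P.obj κ}
      (hx : I.IsProduct a ι x) (hy : I.IsProduct b κ y) :
      I.IsProduct (a + b) (Ins i κ) (P.comp i x y)

/-- The `k`-th power of an operadic ideal: the span of the operadic compositions in which
elements of the ideal are used at least `k` times. -/
def Ideal.pow {P : SymOperad K} (I : P.Ideal) (k : ℕ) (ι : Type) [Finite ι] :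
    Submodule K (P.obj ι) :=
  Submodule.span K {x | ∃ m, k ≤ m ∧ I.IsProduct m ι x}

theorem Ideal.mem_pow_zero {P : SymOperad K} (I : P.Ideal) {ι : Type} [Finite ι]
    (x : P.obj ι) : x ∈ I.pow 0 ι :=
  Submodule.subset_span ⟨0, le_rfl, .arbitrary x⟩

theorem Ideal.mem_pow_one {P : SymOperad K} (I : P.Ideal) {ι : Type} [Finite ι]
    {x : P.obj ι} (hx : x ∈ I.carrier ι) : x ∈ I.pow 1 ι :=
  Submodule.subset_span ⟨1, le_rfl, .mem hx⟩

/-- The filtration of an operad by the powers of an operadic ideal. -/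
def Ideal.powFiltration {P : SymOperad K} (I : P.Ideal) : P.Filtration where
  F k ι _ := I.pow k ι
  anti k ι _ := Submodule.span_mono fun _ ⟨m, hm, h⟩ => ⟨m, by omega, h⟩
  map_mem k ι κ _ _ e x hx := by
    have : I.pow k ι ≤ (I.pow k κ).comap (P.map e) :=
      Submodule.span_le.2 fun x ⟨m, hm, h⟩ => Submodule.subset_span ⟨m, hm, h.map e⟩
    exact this hx
  one_mem := I.mem_pow_zero _
  comp_mem a b ι κ _ _ i x y hx hy := by
    induction hx, hy using Submodule.span_induction₂ with
    | mem_mem x y hx hy =>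
      obtain ⟨m, hm, hx⟩ := hx
      obtain ⟨n, hn, hy⟩ := hy
      exact Submodule.subset_span ⟨m + n, by omega, .comp i hx hy⟩
    | zero_left y hy => simp
    | zero_right x hx => simp
    | add_left x x' y _ _ _ h h' => simpa using add_mem h h'
    | add_right x y y' _ _ _ h h' => simpa using add_mem h h'
    | smul_left c x y _ _ h => simpa using Submodule.smul_mem _ c h
    | smul_right c x y _ _ h => simpa using Submodule.smul_mem _ c h

end General

/-! ### Free operads generated by binary operations -/

/-- Formal expressions in the variables `ι` and the binary operation symbols `Ω`. -/
inductive Term (Ω ι : Type) : Type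
  | var : ι → Term Ω ι
  | op : Ω → Term Ω ι → Term Ω ι → Term Ω ι

namespace Term

variable {Ω ι κ τ : Type}

/-- Substitution of expressions for the variables. -/
def bind : Term Ω ι → (ι → Term Ω κ) → Term Ω κ
  | var i, f => f i
  | op o s t, f => op o (s.bind f) (t.bind f)

/-- Renaming of variables. -/
def rename (f : ι → κ) (t : Term Ω ι) : Term Ω κ := t.bind fun i => var (f i)

/-- The list of the occurrences of variables, from left to right. -/
def vars : Term Ω ι → List ι
  | var i => [i]
  | op _ s t => s.vars ++ t.vars

/-- Every variable occurs exactly once. -/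
def IsMultilinear (t : Term Ω ι) : Prop := t.vars.Nodup ∧ ∀ i, i ∈ t.vars

instance [DecidableEq ι] [Fintype ι] (t : Term Ω ι) : Decidable t.IsMultilinear :=
  inferInstanceAs (Decidable (_ ∧ _))

theorem bind_bind (t : Term Ω ι) (f : ι → Term Ω κ) (g : κ → Term Ω τ) :
    (t.bind f).bind g = t.bind fun i => (f i).bind g := by
  induction t with
  | var i => rfl
  | op o s t hs ht => simp [bind, hs, ht]

theorem bind_var (t : Term Ω ι) : t.bind var = t := by
  induction t with
  | var i => rfl
  | op o s t hs ht => simp [bind, hs, ht]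

theorem vars_bind (t : Term Ω ι) (f : ι → Term Ω κ) :
    (t.bind f).vars = t.vars.flatMap fun i => (f i).vars := by
  induction t with
  | var i => simp [bind, vars]
  | op o s t hs ht => simp [bind, vars, hs, ht]

theorem vars_rename (t : Term Ω ι) (f : ι → κ) : (t.rename f).vars = t.vars.map f := by
  rw [rename, vars_bind]
  simp only [vars]
  induction t.vars <;> simp_all

open Classical in
/-- Substitution of `s` for the variable `i` in `t`. -/
noncomputable def insert (i : ι) (t : Term Ω ι) (s : Term Ω κ) : Term Ω (Ins i κ) :=
  t.bind fun j => if h : j = i then s.rename Sum.inr else var (Sum.inl ⟨j, h⟩)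

end Term

/-- Multilinear expressions, in which every variable occurs exactly once: binary trees with
vertices labelled by `Ω` and leaves labelled bijectively by `ι`. -/
abbrev MTerm (Ω ι : Type) : Type := {t : Term Ω ι // t.IsMultilinear}

namespace MTerm

variable {Ω ι κ : Type}

/-- Relabelling of the leaves. -/
def rename (e : ι ≃ κ) (t : MTerm Ω ι) : MTerm Ω κ :=
  ⟨t.1.rename e, by
    rw [Term.IsMultilinear, Term.vars_rename]
    refine ⟨t.2.1.map e.injective, fun i => List.mem_map.2 ⟨e.symm i, t.2.2 _, by simp⟩⟩⟩

/-- Grafting of the tree `s` onto the leaf `i` of the tree `t`. -/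
noncomputable def insert (i : ι) (t : MTerm Ω ι) (s : MTerm Ω κ) : MTerm Ω (Ins i κ) :=
  ⟨t.1.insert i s.1, by
    classical
    rw [Term.IsMultilinear, Term.insert, Term.vars_bind]
    constructor
    · rw [List.nodup_flatMap]
      constructor
      · intro j _
        by_cases h : j = i
        · simpa [h, Term.vars_rename] using s.2.1.map Sum.inr_injective
        · simp [h, Term.vars]
      · refine List.Pairwise.imp ?_ t.2.1
        intro j k hjk
        by_cases hj : j = i <;> by_cases hk : k = i <;>
          simp_all [Function.onFun, Term.vars, Term.vars_rename, Ne.symm hjk]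
    · rintro (j | k)
      · exact List.mem_flatMap.2 ⟨j.1, t.2.2 _, by simp [j.2, Term.vars]⟩
      · exact List.mem_flatMap.2 ⟨i, t.2.2 _, by simp [Term.vars_rename, s.2.2]⟩⟩

variable {ι' κ' τ : Type}

theorem rename_refl (t : MTerm Ω ι) : t.rename (Equiv.refl ι) = t :=
  Subtype.ext t.1.bind_var

theorem rename_trans (e : ι ≃ κ) (f : κ ≃ τ) (t : MTerm Ω ι) :
    t.rename (e.trans f) = (t.rename e).rename f := by
  apply Subtype.ext
  simp [rename, Term.rename, Term.bind_bind, Term.bind]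

theorem insert_rename (i : ι) (e : ι ≃ ι') (f : κ ≃ κ') (t : MTerm Ω ι) (s : MTerm Ω κ) :
    insert (e i) (t.rename e) (s.rename f) = (insert i t s).rename (insCongr i e f) := by
  apply Subtype.ext
  simp only [rename, insert, Term.insert, Term.rename, Term.bind_bind, Term.bind]
  congr 1
  funext j
  by_cases h : j = i
  · simp [h, Term.bind_bind, Term.bind, insCongr]
  · simp [h, Term.bind, insCongr]

theorem insert_seq (i : ι) (j : κ) (t : MTerm Ω ι) (s : MTerm Ω κ) (r : MTerm Ω τ) :
    (insert (Sum.inr j) (insert i t s) r).rename (seqEquiv i j) =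
      insert i t (insert j s r) := by
  apply Subtype.ext
  simp only [rename, insert, Term.insert, Term.rename, Term.bind_bind]
  congr 1
  funext k
  by_cases h : k = i
  · simp only [h, dite_true, Term.bind_bind]
    congr 1
    funext l
    by_cases hl : l = j
    · simp [hl, Term.bind_bind, Term.bind, seqEquiv]
    · simp [hl, Term.bind, seqEquiv]
  · simp [h, Term.bind, seqEquiv]

theorem insert_par (i k : ι) (hik : i ≠ k) (t : MTerm Ω ι) (s : MTerm Ω κ) (r : MTerm Ω τ) :
    (insert (Sum.inl ⟨k, hik.symm⟩) (insert i t s) r).rename (parEquiv i k hik) =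
      insert (Sum.inl ⟨i, hik⟩) (insert k t r) s := by
  apply Subtype.ext
  simp only [rename, insert, Term.insert, Term.rename, Term.bind_bind]
  congr 1
  funext j
  by_cases h : j = i
  · subst h
    simp [hik, Term.bind_bind, Term.bind, parEquiv]
  · by_cases h' : j = k
    · subst h'
      simp [h, Term.bind_bind, Term.bind, parEquiv]
    · simp [h, h', Term.bind, parEquiv]

/-- The trivial tree. -/
def one : MTerm Ω Unit := ⟨Term.var (), by simp [Term.IsMultilinear, Term.vars]⟩

theorem one_insert (s : MTerm Ω κ) : insert () one s = s.rename (oneInsEquiv κ) := by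
  apply Subtype.ext
  simp [insert, Term.insert, one, Term.bind, rename, oneInsEquiv]

theorem insert_one (i : ι) (t : MTerm Ω ι) : insert i t one = t.rename (insOneEquiv i) := by
  apply Subtype.ext
  simp only [insert, Term.insert, one, rename, Term.rename, Term.bind]
  congr 1
  funext j
  by_cases h : j = i <;> simp [h, insOneEquiv]

end MTerm

/-- The bilinear extension of grafting. -/
noncomputable def freeComp (K : Type u) [Field K] (Ω : Type) {ι κ : Type} (i : ι) :
    (MTerm Ω ι →₀ K) →ₗ[K] (MTerm Ω κ →₀ K) →ₗ[K] (MTerm Ω (Ins i κ) →₀ K) :=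
  Finsupp.lift _ K _ fun t => Finsupp.lmapDomain K K (MTerm.insert i t)

theorem freeComp_single (K : Type u) [Field K] (Ω : Type) {ι κ : Type} (i : ι)
    (t : MTerm Ω ι) (s : MTerm Ω κ) (a b : K) :
    freeComp K Ω i (Finsupp.single t a) (Finsupp.single s b) =
      Finsupp.single (MTerm.insert i t s) (a * b) := by
  simp [freeComp, Finsupp.mapDomain_single]

/-- The free symmetric operad generated by the set `Ω` of binary operations (without any
symmetry): the operations with inputs `ι` are the linear combinations of binary trees with
vertices labelled by `Ω` and leaves labelled bijectively by `ι`, composition being grafting. -/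
noncomputable def free (K : Type u) [Field K] (Ω : Type) : SymOperad K where
  obj ι _ := MTerm Ω ι →₀ K
  map e := Finsupp.lmapDomain K K (MTerm.rename e)
  one := Finsupp.single MTerm.one 1
  comp i := freeComp K Ω i
  map_refl x := by
    induction x using Finsupp.induction_linear with
    | zero => simp
    | add x y hx hy => simp only [map_add, hx, hy]
    | single t a => simp [Finsupp.mapDomain_single, MTerm.rename_refl]
  map_trans e f x := by
    induction x using Finsupp.induction_linear with
    | zero => simp
    | add x y hx hy => simp only [map_add, hx, hy]
    | single t a => simp [Finsupp.mapDomain_single, MTerm.rename_trans]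
  comp_map i e f x y := by
    induction x using Finsupp.induction_linear with
    | zero => simp
    | add x x' hx hx' => simp only [map_add, LinearMap.add_apply, hx, hx']
    | single t a =>
      induction y using Finsupp.induction_linear with
      | zero => simp
      | add y y' hy hy' => simp only [map_add, hy, hy']
      | single s b =>
        simp only [Finsupp.lmapDomain_apply, Finsupp.mapDomain_single, freeComp_single,
          MTerm.insert_rename]
  comp_seq i j x y z := by
    induction x using Finsupp.induction_linear with
    | zero => simp
    | add x x' hx hx' => simp only [map_add, LinearMap.add_apply, hx, hx']
    | single t a =>
      induction y using Finsupp.induction_linear with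
      | zero => simp
      | add y y' hy hy' => simp only [map_add, LinearMap.add_apply, hy, hy']
      | single s b =>
        induction z using Finsupp.induction_linear with
        | zero => simp
        | add z z' hz hz' => simp only [map_add, hz, hz']
        | single r c =>
          simp only [Finsupp.lmapDomain_apply, Finsupp.mapDomain_single, freeComp_single,
            MTerm.insert_seq, mul_assoc]
  comp_par i k h x y z := by
    induction x using Finsupp.induction_linear with
    | zero => simp
    | add x x' hx hx' => simp only [map_add, LinearMap.add_apply, hx, hx']
    | single t a =>
      induction y using Finsupp.induction_linear with
      | zero => simp
      | add y y' hy hy' => simp only [map_add, LinearMap.add_apply, hy, hy']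
      | single s b =>
        induction z using Finsupp.induction_linear with
        | zero => simp
        | add z z' hz hz' => simp only [map_add, LinearMap.add_apply, hz, hz']
        | single r c =>
          simp only [Finsupp.lmapDomain_apply, Finsupp.mapDomain_single, freeComp_single,
            MTerm.insert_par, mul_right_comm]
  one_comp y := by
    induction y using Finsupp.induction_linear with
    | zero => simp
    | add y y' hy hy' => simp only [map_add, hy, hy']
    | single s b =>
      simp [Finsupp.mapDomain_single, freeComp_single, MTerm.one_insert]
  comp_one i x := by
    induction x using Finsupp.induction_linear with
    | zero => simp
    | add x x' hx hx' => simp only [map_add, LinearMap.add_apply, hx, hx']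
    | single t a =>
      simp [Finsupp.mapDomain_single, freeComp_single, MTerm.insert_one]

/-- The operation of the free operad given by a multilinear expression. -/
noncomputable def monomial (K : Type u) [Field K] {Ω ι : Type} [Finite ι] (t : Term Ω ι)
    (ht : t.IsMultilinear) : (free K Ω).obj ι :=
  Finsupp.single (⟨t, ht⟩ : MTerm Ω ι) (1 : K)

/-! ### The Novikov operad and its associated graded operad -/

/-- The expression `x ∘ y`. -/
abbrev nv {ι : Type} (x y : Term Unit ι) : Term Unit ι := Term.op () x y

/-- The defining relations of Novikov algebras:
`(x ∘ y) ∘ z - (y ∘ x) ∘ z = x ∘ (y ∘ z) - y ∘ (x ∘ z)` and `(x ∘ y) ∘ z = (x ∘ z) ∘ y`. -/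
noncomputable def novRelations (K : Type u) [Field K] :
    (n : ℕ) → Set ((free K Unit).obj (Fin n))
  | 3 =>
    let x : Term Unit (Fin 3) := .var 0
    let y : Term Unit (Fin 3) := .var 1
    let z : Term Unit (Fin 3) := .var 2
    { (monomial K (nv (nv x y) z) (by decide) - monomial K (nv (nv y x) z) (by decide)) -
        (monomial K (nv x (nv y z)) (by decide) - monomial K (nv y (nv x z)) (by decide)),
      monomial K (nv (nv x y) z) (by decide) - monomial K (nv (nv x z) y) (by decide) }
  | _ => ∅

/-- The operad `Nov` of Novikov algebras. -/
noncomputable def Nov (K : Type u) [Field K] : SymOperad K :=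
  (free K Unit).quotient (Ideal.span (novRelations K))

/-- The Novikov product `x₁ ∘ x₂`. -/
noncomputable def novMul (K : Type u) [Field K] : (Nov K).obj (Fin 2) :=
  Submodule.Quotient.mk (monomial K (nv (.var 0) (.var 1)) (by decide))

/-- The commutator `[x₁, x₂] = x₁ ∘ x₂ - x₂ ∘ x₁` in the Novikov operad. -/
noncomputable def novCommutator (K : Type u) [Field K] : (Nov K).obj (Fin 2) :=
  novMul K - (Nov K).map (Equiv.swap 0 1) (novMul K)

/-- The operadic ideal `I` of `Nov` generated by the commutator. -/
noncomputable def commutatorIdeal (K : Type u) [Field K] : (Nov K).Ideal :=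
  Ideal.span fun
    | 2 => {novCommutator K}
    | _ => ∅

theorem novCommutator_mem (K : Type u) [Field K] :
    novCommutator K ∈ (commutatorIdeal K).carrier (Fin 2) :=
  Ideal.subset_span _ 2 (Set.mem_singleton _)

/-- The associated graded operad `grNov` of `Nov` for the filtration by the powers of the
ideal generated by the commutator. -/
noncomputable def grNov (K : Type u) [Field K] : SymOperad K :=
  (commutatorIdeal K).powFiltration.gr

/-- The class of the Novikov product in the component `Nov / I` of `grNov`. -/
noncomputable def grMul (K : Type u) [Field K] : (grNov K).obj (Fin 2) :=
  (commutatorIdeal K).powFiltration.toGr 0 (Fin 2)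
    ⟨novMul K, (commutatorIdeal K).mem_pow_zero _⟩

/-- The class of the commutator in the component `I / I²` of `grNov`. -/
noncomputable def grBracket (K : Type u) [Field K] : (grNov K).obj (Fin 2) :=
  (commutatorIdeal K).powFiltration.toGr 1 (Fin 2)
    ⟨novCommutator K, (commutatorIdeal K).mem_pow_one (novCommutator_mem K)⟩

/-! ### Transposed Poisson algebras -/

/-- The symbols of the two operations of a transposed Poisson algebra. -/
inductive TPOp : Type
  | mul
  | bracket

/-- The expression `x · y`. -/
abbrev mu {ι : Type} (x y : Term TPOp ι) : Term TPOp ι := Term.op .mul x y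

/-- The expression `[x, y]`. -/
abbrev br {ι : Type} (x y : Term TPOp ι) : Term TPOp ι := Term.op .bracket x y

/-- The defining relations of transposed Poisson algebras: commutativity `x · y = y · x` and
associativity `(x · y) · z = x · (y · z)` of the product, antisymmetry `[x, y] = -[y, x]` and
Jacobi identity `[[x, y], z] + [[y, z], x] + [[z, x], y] = 0` of the bracket, and the
compatibility `2 [x, y] · z = [x, y · z] + [x · z, y]`. -/
noncomputable def tpoisRelations (K : Type u) [Field K] :
    (n : ℕ) → Set ((free K TPOp).obj (Fin n))
  | 2 =>
    let x : Term TPOp (Fin 2) := .var 0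
    let y : Term TPOp (Fin 2) := .var 1
    { monomial K (mu x y) (by decide) - monomial K (mu y x) (by decide),
      monomial K (br x y) (by decide) + monomial K (br y x) (by decide) }
  | 3 =>
    let x : Term TPOp (Fin 3) := .var 0
    let y : Term TPOp (Fin 3) := .var 1
    let z : Term TPOp (Fin 3) := .var 2
    { monomial K (mu (mu x y) z) (by decide) - monomial K (mu x (mu y z)) (by decide),
      monomial K (br (br x y) z) (by decide) + monomial K (br (br y z) x) (by decide) +
        monomial K (br (br z x) y) (by decide),
      (2 : K) • monomial K (mu (br x y) z) (by decide) -
        (monomial K (br x (mu y z)) (by decide) + monomial K (br (mu x z) y) (by decide)) }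
  | _ => ∅

/-- The operadic ideal generated by the defining relations of transposed Poisson algebras, in
the free operad on a product and a bracket. The operad `TPois` is the quotient by it. -/
noncomputable def tpoisIdeal (K : Type u) [Field K] : (free K TPOp).Ideal :=
  Ideal.span (tpoisRelations K)

/-- A morphism from the free operad on a product and a bracket to `grNov` is the canonical
presentation if it sends the product `x₁ · x₂` to the class of `x₁ ∘ x₂` in `Nov / I` and the
bracket `[x₁, x₂]` to the class of `x₁ ∘ x₂ - x₂ ∘ x₁` in `I / I²`. -/
def IsCanonical {K : Type u} [Field K] (Φ : Hom (free K TPOp) (grNov K)) : Prop :=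
  Φ.app (Fin 2) (monomial K (mu (.var 0) (.var 1)) (by decide)) = grMul K ∧
    Φ.app (Fin 2) (monomial K (br (.var 0) (.var 1)) (by decide)) = grBracket K

end SymOperad

/-! The canonical morphism comes from the universal property of the free operad of binary trees
(`lift`, `Hom.ext_of_gen`). For surjectivity, `Nov` is generated by its product, so every class of
degree 0 is hit. Consequently the operations whose class of degree 1 is hit form an operadic ideal;
it contains the commutator, hence all of `I`, and composing gives all products of `k` elements of
`I` (`surjective_of_isCanonical`).

The relations of transposed Poisson algebras lie in the kernel (`tpoisIdeal_le_ker`): antisymmetry,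
the Jacobi identity and the compatibility hold in `Nov` itself for the product and its commutator,
while commutativity and associativity hold modulo `I`, which suffices because they have degree 0.

The reverse inclusion plays an upper bound against a lower bound. Upper bound: over a field where 2
is invertible, the transposed Poisson identities rewrite any multilinear expression with `k`
brackets in at most four letters as a combination of words `[a₁, [a₂, … [aₖ, aₖ₊₁ ⋯ aₙ]]]`
(`mk_mem_wordSpan`). Further identities among the words leave spanning sets of sizes 1, 3, 2 for `k
= 0, 1, 2` in arity 3, and 1, 4, 9, 6 for `k = 0, 1, 2, 3` in arity 4.

Lower bound: `f ∘ g = f (1 + X D) g` is a Novikov product on functions, with a parameter `X`. On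
exponential functions an operation acts by a scalar that is polynomial in `X`, and composition of
operations becomes multiplication of scalars (`Character`). The commutator of exponentials with
exponents `a`, `b` gives `X (b - a)`, so the `k`-th power of `I` gives multiples of `X ^ k`, and
leading coefficients define a character of `grNov` (`grNovCharacter`). On a word with `k` brackets
it is `X ^ k` times an explicit product of `k` linear forms in the exponents (`wordWeight`). For the
spanning sets above these polynomials are linearly independent, so the characters detect every
nonzero combination of words (`IsTransposedPoisson.eq_zero_of_mem_wordSpan`). An element of the
kernel, split by the number of brackets, is killed by all of them and therefore vanishes modulo the
relations (`ker_le_tpoisIdeal`). -/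

namespace SymOperad

/-! ### Grafting two operations onto a binary operation. -/

section Grafting

variable {K : Type u} [Field K]

theorem subtype_ne_zero_eq_one (a : {j : Fin 2 // j ≠ 0}) : a = ⟨1, by decide⟩ := by
  revert a; decide

/-- The leaves of a binary operation with two operations grafted onto its inputs. -/
def graftEquiv (ι κ : Type) :
    Ins (Sum.inl ⟨1, by decide⟩ : Ins (0 : Fin 2) ι) κ ≃ ι ⊕ κ where
  toFun
    | Sum.inl ⟨Sum.inl a, h⟩ => (h (congrArg Sum.inl (subtype_ne_zero_eq_one a))).elim
    | Sum.inl ⟨Sum.inr b, _⟩ => Sum.inl b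
    | Sum.inr c => Sum.inr c
  invFun
    | Sum.inl b => Sum.inl ⟨Sum.inr b, by simp⟩
    | Sum.inr c => Sum.inr c
  left_inv := by
    rintro (⟨a | b, h⟩ | c)
    · exact (h (congrArg Sum.inl (subtype_ne_zero_eq_one a))).elim
    · rfl
    · rfl
  right_inv := by rintro (b | c) <;> rfl

/-- The operation `g(x, y)`. -/
def graft (P : SymOperad K) {ι κ : Type} [Finite ι] [Finite κ] (g : P.obj (Fin 2)) :
    P.obj ι →ₗ[K] P.obj κ →ₗ[K] P.obj (ι ⊕ κ) :=
  ((P.comp (Sum.inl ⟨1, by decide⟩ : Ins (0 : Fin 2) ι)).compr₂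
    (P.map (graftEquiv ι κ))).comp (P.comp 0 g)

variable (P : SymOperad K) {ι κ τ ι' κ' : Type} [Finite ι] [Finite κ] [Finite τ] [Finite ι']
  [Finite κ']

theorem graft_apply (g : P.obj (Fin 2)) (x : P.obj ι) (y : P.obj κ) :
    P.graft g x y = P.map (graftEquiv ι κ)
      (P.comp (Sum.inl ⟨1, by decide⟩ : Ins (0 : Fin 2) ι) (P.comp 0 g x) y) := rfl

theorem map_map (e : ι ≃ κ) (f : κ ≃ τ) (x : P.obj ι) :
    P.map f (P.map e x) = P.map (e.trans f) x := (P.map_trans e f x).symm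

/-- The axiom `comp_map` only speaks of the input `e i` itself. Allowing an input that is equal to
it avoids transports between the types `Ins`. -/
theorem comp_map_map_of_eq {i : ι} {i' : ι'} (e : ι ≃ ι') (f : κ ≃ κ') (h : e i = i')
    (x : P.obj ι) (y : P.obj κ) :
    P.comp i' (P.map e x) (P.map f y) =
      P.map ((Equiv.sumCongr (e.subtypeEquiv fun j => by simp [← h]) f) :
        Ins i κ ≃ Ins i' κ') (P.comp i x y) := by
  subst h
  exact P.comp_map i e f x y

theorem comp_map_of_eq {i : ι} {i' : ι'} (e : ι ≃ ι') (h : e i = i') (x : P.obj ι)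
    (y : P.obj κ) :
    P.comp i' (P.map e x) y =
      P.map ((Equiv.sumCongr (e.subtypeEquiv fun j => by simp [← h]) (Equiv.refl κ)) :
        Ins i κ ≃ Ins i' κ) (P.comp i x y) := by
  rw [← P.comp_map_map_of_eq e (Equiv.refl κ) h, P.map_refl]

theorem comp_seq_symm (i : ι) (j : κ) (x : P.obj ι) (y : P.obj κ) (z : P.obj τ) :
    P.comp (Sum.inr j) (P.comp i x y) z =
      P.map (seqEquiv i j).symm (P.comp i x (P.comp j y z)) := by
  rw [← P.comp_seq, P.map_map, Equiv.self_trans_symm, P.map_refl]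

theorem comp_par_symm (i k : ι) (hik : i ≠ k) (x : P.obj ι) (y : P.obj κ) (z : P.obj τ) :
    P.comp (Sum.inl ⟨k, hik.symm⟩) (P.comp i x y) z =
      P.map (parEquiv i k hik).symm (P.comp (Sum.inl ⟨i, hik⟩) (P.comp k x z) y) := by
  rw [← P.comp_par i k hik, P.map_map, Equiv.self_trans_symm, P.map_refl]

theorem graft_map (g : P.obj (Fin 2)) (e : ι ≃ ι') (f : κ ≃ κ') (x : P.obj ι) (y : P.obj κ) :
    P.graft g (P.map e x) (P.map f y) = P.map (Equiv.sumCongr e f) (P.graft g x y) := by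
  let ε : Ins (0 : Fin 2) ι ≃ Ins (0 : Fin 2) ι' := insCongr 0 (Equiv.refl _) e
  have h1 : P.comp (0 : Fin 2) g (P.map e x) = P.map ε (P.comp 0 g x) := by
    rw [← P.map_refl g]
    exact (P.comp_map 0 (Equiv.refl _) e g x).trans (by rw [P.map_refl]; rfl)
  rw [graft_apply, graft_apply, h1,
    P.comp_map_map_of_eq (i := Sum.inl ⟨1, by decide⟩) (i' := Sum.inl ⟨1, by decide⟩) ε f rfl,
    P.map_map, P.map_map]
  congr 1
  congr 1
  ext z
  obtain (⟨a | b, h⟩ | c) := z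
  · exact (h (congrArg Sum.inl (subtype_ne_zero_eq_one a))).elim
  · rfl
  · rfl

/-- Inserting into the left summand. -/
def insInlEquiv (i : ι) (κ τ : Type) : Ins i τ ⊕ κ ≃ Ins (Sum.inl i : ι ⊕ κ) τ where
  toFun
    | Sum.inl (Sum.inl a) => Sum.inl ⟨Sum.inl a.1, fun h => a.2 (Sum.inl.inj h)⟩
    | Sum.inl (Sum.inr c) => Sum.inr c
    | Sum.inr b => Sum.inl ⟨Sum.inr b, by simp⟩
  invFun
    | Sum.inl ⟨Sum.inl a, h⟩ => Sum.inl (Sum.inl ⟨a, fun ha => h (congrArg _ ha)⟩)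
    | Sum.inl ⟨Sum.inr b, _⟩ => Sum.inr b
    | Sum.inr c => Sum.inl (Sum.inr c)
  left_inv := by rintro ((a | c) | b) <;> rfl
  right_inv := by rintro (⟨a | b, h⟩ | c) <;> rfl

/-- Inserting into the right summand. -/
def insInrEquiv (ι : Type) (k : κ) (τ : Type) : ι ⊕ Ins k τ ≃ Ins (Sum.inr k : ι ⊕ κ) τ where
  toFun
    | Sum.inl a => Sum.inl ⟨Sum.inl a, by simp⟩
    | Sum.inr (Sum.inl b) => Sum.inl ⟨Sum.inr b.1, fun h => b.2 (Sum.inr.inj h)⟩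
    | Sum.inr (Sum.inr c) => Sum.inr c
  invFun
    | Sum.inl ⟨Sum.inl a, _⟩ => Sum.inl a
    | Sum.inl ⟨Sum.inr b, h⟩ => Sum.inr (Sum.inl ⟨b, fun hb => h (congrArg _ hb)⟩)
    | Sum.inr c => Sum.inr (Sum.inr c)
  left_inv := by rintro (a | b | c) <;> rfl
  right_inv := by rintro (⟨a | b, h⟩ | c) <;> rfl

/-- The operation `y` is inserted last in `graft`, so sequential associativity applies at once. -/
theorem comp_inr_graft (g : P.obj (Fin 2)) (x : P.obj ι) (y : P.obj κ) (z : P.obj τ) (k : κ) :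
    P.comp (Sum.inr k) (P.graft g x y) z =
      P.map (insInrEquiv ι k τ) (P.graft g x (P.comp k y z)) := by
  rw [graft_apply, graft_apply,
    P.comp_map_of_eq (i := Sum.inr k) (i' := Sum.inr k) (graftEquiv ι κ) rfl, comp_seq_symm,
    map_map, map_map]
  congr 1
  congr 1
  ext w
  obtain (⟨a | b, h⟩ | b | c) := w
  · exact (h (congrArg Sum.inl (subtype_ne_zero_eq_one a))).elim
  all_goals rfl

/-- Here `z` goes into `x`, which was inserted before `y`: parallel associativity first exchanges
`y` and `z`, then sequential associativity applies. -/
theorem comp_inl_graft (g : P.obj (Fin 2)) (x : P.obj ι) (y : P.obj κ) (z : P.obj τ) (i : ι) :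
    P.comp (Sum.inl i) (P.graft g x y) z =
      P.map (insInlEquiv i κ τ) (P.graft g (P.comp i x z) y) := by
  rw [graft_apply, graft_apply,
    P.comp_map_of_eq (i := Sum.inl ⟨Sum.inr i, by simp⟩) (i' := Sum.inl i) (graftEquiv ι κ) rfl,
    P.comp_par_symm _ _ (by simp), comp_seq_symm,
    P.comp_map_of_eq (i := Sum.inl ⟨1, by decide⟩)
      (i' := Sum.inl ⟨Sum.inl ⟨1, by decide⟩, by simp⟩) (seqEquiv 0 i).symm rfl,
    map_map, map_map, map_map]
  congr 1
  congr 1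
  ext w
  obtain (⟨a | b | c, h⟩ | b) := w
  · exact (h (congrArg Sum.inl (subtype_ne_zero_eq_one a))).elim
  all_goals rfl

theorem Hom.app_graft {P Q : SymOperad K} (F : Hom P Q) (g : P.obj (Fin 2)) (x : P.obj ι)
    (y : P.obj κ) :
    F.app (ι ⊕ κ) (P.graft g x y) = Q.graft (F.app _ g) (F.app ι x) (F.app κ y) := by
  rw [graft_apply, graft_apply, F.app_map, F.app_comp, F.app_comp]

end Grafting

end SymOperad

namespace SymOperad

/-! ### Multilinear expressions as trees with labelled leaves. -/

namespace Term

variable {Ω ι κ τ : Type}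

theorem rename_rename (t : Term Ω ι) (f : ι → κ) (g : κ → τ) :
    (t.rename f).rename g = t.rename (g ∘ f) := by
  simp only [rename, bind_bind]
  rfl

theorem rename_bind (t : Term Ω ι) (f : ι → κ) (σ : κ → Term Ω τ) :
    (t.rename f).bind σ = t.bind (σ ∘ f) := by
  simp only [rename, bind_bind]
  rfl

theorem bind_rename (t : Term Ω ι) (σ : ι → Term Ω κ) (f : κ → τ) :
    (t.bind σ).rename f = t.bind fun i => (σ i).rename f := by
  simp only [rename, bind_bind]

end Term

namespace MTerm

variable {Ω ι κ : Type}

/-- The tree with root labelled by `o` and the given subtrees. -/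
def node (o : Ω) (s : MTerm Ω ι) (t : MTerm Ω κ) : MTerm Ω (ι ⊕ κ) :=
  ⟨.op o (s.1.rename Sum.inl) (t.1.rename Sum.inr), by
    simp only [Term.IsMultilinear, Term.vars, Term.vars_rename, List.nodup_append, List.mem_append,
      List.mem_map]
    refine ⟨⟨s.2.1.map Sum.inl_injective, t.2.1.map Sum.inr_injective, ?_⟩, ?_⟩
    · rintro _ ⟨a, _, rfl⟩ _ ⟨b, _, rfl⟩
      simp
    · rintro (a | b)
      · exact Or.inl ⟨a, s.2.2 a, rfl⟩
      · exact Or.inr ⟨b, t.2.2 b, rfl⟩⟩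

theorem node_rename {ι' κ' : Type} (o : Ω) (e : ι ≃ ι') (f : κ ≃ κ') (s : MTerm Ω ι)
    (t : MTerm Ω κ) :
    node o (s.rename e) (t.rename f) = (node o s t).rename (Equiv.sumCongr e f) := by
  apply Subtype.ext
  change Term.op o ((s.1.rename e).rename _) ((t.1.rename f).rename _) =
    Term.op o ((s.1.rename _).rename _) ((t.1.rename _).rename _)
  simp only [Term.rename_rename]
  rfl

theorem insert_inl_node {τ : Type} (o : Ω) (i : ι) (s : MTerm Ω ι) (t : MTerm Ω κ)
    (r : MTerm Ω τ) : insert (Sum.inl i) (node o s t) r =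
      (node o (insert i s r) t).rename (insInlEquiv i κ τ) := by
  apply Subtype.ext
  change Term.op o ((s.1.rename _).bind _) ((t.1.rename _).bind _) =
    Term.op o (((s.1.bind _).rename _).rename _) ((t.1.rename _).rename _)
  simp only [Term.rename_bind, Term.rename_rename, Term.bind_rename]
  congr 2
  · funext j
    by_cases hj : j = i
    · simp [hj, Term.rename_rename]
      rfl
    · simp [hj]
      rfl
  · funext j
    simp
    rfl

theorem insert_inr_node {τ : Type} (o : Ω) (k : κ) (s : MTerm Ω ι) (t : MTerm Ω κ)
    (r : MTerm Ω τ) : insert (Sum.inr k) (node o s t) r =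
      (node o s (insert k t r)).rename (insInrEquiv ι k τ) := by
  apply Subtype.ext
  change Term.op o ((s.1.rename _).bind _) ((t.1.rename _).bind _) =
    Term.op o ((s.1.rename _).rename _) (((t.1.bind _).rename _).rename _)
  simp only [Term.rename_bind, Term.rename_rename, Term.bind_rename]
  congr 2
  · funext j
    simp
    rfl
  · funext j
    by_cases hj : j = k
    · simp [hj, Term.rename_rename]
      rfl
    · simp [hj]
      rfl

end MTerm

/-- Binary trees with vertices labelled by `Ω`. -/
inductive Tree (Ω : Type) : Type
  | leaf : Tree Ω
  | node : Ω → Tree Ω → Tree Ω → Tree Ω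

namespace Tree

variable {Ω ι : Type}

/-- The leaves of a tree. -/
def Leaf : Tree Ω → Type
  | leaf => Unit
  | node _ l r => l.Leaf ⊕ r.Leaf

instance finite_leaf (t : Tree Ω) : Finite t.Leaf := by
  induction t with
  | leaf => exact inferInstanceAs (Finite Unit)
  | node o l r hl hr => exact inferInstanceAs (Finite (l.Leaf ⊕ r.Leaf))

/-- The expression given by a tree, in which the variables are the leaves. -/
def mterm : (t : Tree Ω) → MTerm Ω t.Leaf
  | leaf => MTerm.one
  | node o l r => MTerm.node o l.mterm r.mterm

/-- Branches of a multilinear expression miss some variables, so the induction runs over all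
expressions and arbitrary labellings of the leaves. Multilinearity makes the labelling bijective
afterwards. -/
theorem exists_eq_rename (t : Term Ω ι) :
    ∃ (s : Tree Ω) (f : s.Leaf → ι), t = s.mterm.1.rename f := by
  induction t with
  | var i => exact ⟨leaf, fun _ => i, rfl⟩
  | op o a b ha hb =>
    obtain ⟨s, f, rfl⟩ := ha
    obtain ⟨s', f', rfl⟩ := hb
    refine ⟨node o s s', Sum.elim f f', ?_⟩
    change _ = Term.op o ((s.mterm.1.rename Sum.inl).rename _)
      ((s'.mterm.1.rename Sum.inr).rename _)
    rw [Term.rename_rename, Term.rename_rename]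
    rfl

theorem injective_of_nodup (s : Tree Ω) (f : s.Leaf → ι)
    (h : (s.mterm.1.rename f).vars.Nodup) : Function.Injective f := fun a b hab => by
  rw [Term.vars_rename] at h
  exact List.inj_on_of_nodup_map h (s.mterm.2.2 a) (s.mterm.2.2 b) hab

theorem exists_eq_mterm_rename (t : MTerm Ω ι) :
    ∃ (s : Tree Ω) (e : s.Leaf ≃ ι), t = s.mterm.rename e := by
  obtain ⟨s, f, hf⟩ := exists_eq_rename t.1
  have ht := t.2
  rw [hf] at ht
  refine ⟨s, Equiv.ofBijective f ⟨s.injective_of_nodup f ht.1, fun i => ?_⟩, Subtype.ext hf⟩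
  have := ht.2 i
  rw [Term.vars_rename] at this
  obtain ⟨a, _, ha⟩ := List.mem_map.1 this
  exact ⟨a, ha⟩

/-- Uniqueness of the tree and of the labelling, which makes the choices in `MTerm.eval` irrelevant.
Pairs are compared because the type of a labelling depends on the tree. -/
theorem eq_of_rename_eq (s s' : Tree Ω) (f : s.Leaf → ι) (f' : s'.Leaf → ι)
    (h : s.mterm.1.rename f = s'.mterm.1.rename f') :
    (⟨s, f⟩ : Σ s : Tree Ω, s.Leaf → ι) = ⟨s', f'⟩ := by
  induction s generalizing s' with
  | leaf =>
    cases s' with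
    | leaf =>
      have : f () = f' () := Term.var.inj h
      have : f = f' := funext fun _ => this
      rw [this]
    | node o l r => cases h
  | node o l r hl hr =>
    cases s' with
    | leaf => cases h
    | node o' l' r' =>
      obtain ⟨h1, h2, h3⟩ := Term.op.inj h
      have h2' : (l.mterm.1.rename Sum.inl).rename f = (l'.mterm.1.rename Sum.inl).rename f' := h2
      have h3' : (r.mterm.1.rename Sum.inr).rename f = (r'.mterm.1.rename Sum.inr).rename f' := h3
      have h4 := hl l' _ _ (((Term.rename_rename _ _ _).symm.trans h2').trans
        (Term.rename_rename _ _ _))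
      have h5 := hr r' _ _ (((Term.rename_rename _ _ _).symm.trans h3').trans
        (Term.rename_rename _ _ _))
      obtain ⟨rfl, h4⟩ := Sigma.mk.inj_iff.1 h4
      obtain ⟨rfl, h5⟩ := Sigma.mk.inj_iff.1 h5
      subst h1
      have : f = f' := by
        funext p
        rcases p with p | p
        · exact congrFun (eq_of_heq h4) p
        · exact congrFun (eq_of_heq h5) p
      rw [this]

end Tree

/-! ### The universal property of the free operad. -/

section Lift

variable {K : Type u} [Field K] {Ω : Type}

/-- The value of a tree in an operad. -/
def Tree.eval (P : SymOperad K) (g : Ω → P.obj (Fin 2)) : (t : Tree Ω) → P.obj t.Leaf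
  | .leaf => P.one
  | .node o l r => P.graft (g o) (l.eval P g) (r.eval P g)

/-- Grafting a tree onto a leaf gives a tree up to relabelling. The same `t` and `e` must serve for
expressions and for values in `P`; this is what makes evaluation compatible with composition. -/
theorem Tree.exists_insert (P : SymOperad K) (g : Ω → P.obj (Fin 2)) (s : Tree Ω) (p : s.Leaf)
    (s' : Tree Ω) : ∃ (t : Tree Ω) (e : t.Leaf ≃ Ins p s'.Leaf),
      MTerm.insert p s.mterm s'.mterm = t.mterm.rename e ∧
      P.comp p (s.eval P g) (s'.eval P g) = P.map e (t.eval P g) := by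
  induction s with
  | leaf => exact ⟨s', oneInsEquiv _, MTerm.one_insert _, P.one_comp _⟩
  | node o l r hl hr =>
    rcases p with p | p
    · obtain ⟨t, e, h1, h2⟩ := hl p
      refine ⟨node o t r, (Equiv.sumCongr e (Equiv.refl _)).trans (insInlEquiv p _ _),
        (MTerm.insert_inl_node _ _ _ _ _).trans ?_, (P.comp_inl_graft _ _ _ _ _).trans ?_⟩
      · have := MTerm.node_rename o e (Equiv.refl _) t.mterm r.mterm
        rw [MTerm.rename_refl] at this
        rw [h1, this]
        exact (MTerm.rename_trans _ _ _).symm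
      · have := P.graft_map (g o) e (Equiv.refl _) (t.eval P g) (r.eval P g)
        rw [P.map_refl] at this
        rw [h2, this]
        exact P.map_map _ _ _
    · obtain ⟨t, e, h1, h2⟩ := hr p
      refine ⟨node o l t, (Equiv.sumCongr (Equiv.refl _) e).trans (insInrEquiv _ p _),
        (MTerm.insert_inr_node _ _ _ _ _).trans ?_, (P.comp_inr_graft _ _ _ _ _).trans ?_⟩
      · have := MTerm.node_rename o (Equiv.refl _) e l.mterm t.mterm
        rw [MTerm.rename_refl] at this
        rw [h1, this]
        exact (MTerm.rename_trans _ _ _).symm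
      · have := P.graft_map (g o) (Equiv.refl _) e (l.eval P g) (t.eval P g)
        rw [P.map_refl] at this
        rw [h2, this]
        exact P.map_map _ _ _

/-- The value of a multilinear expression in an operad. -/
noncomputable def MTerm.eval (P : SymOperad K) (g : Ω → P.obj (Fin 2)) {ι : Type} [Finite ι]
    (t : MTerm Ω ι) : P.obj ι :=
  P.map (Tree.exists_eq_mterm_rename t).choose_spec.choose
    ((Tree.exists_eq_mterm_rename t).choose.eval P g)

theorem MTerm.eval_mterm_rename (P : SymOperad K) (g : Ω → P.obj (Fin 2)) {ι : Type} [Finite ι]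
    (s : Tree Ω) (e : s.Leaf ≃ ι) : (s.mterm.rename e).eval P g = P.map e (s.eval P g) := by
  have key : ∀ (s' : Tree Ω) (e' : s'.Leaf ≃ ι), s.mterm.rename e = s'.mterm.rename e' →
      P.map e' (s'.eval P g) = P.map e (s.eval P g) := by
    intro s' e' h
    have := Tree.eq_of_rename_eq s s' e e' (congrArg Subtype.val h)
    obtain ⟨rfl, h2⟩ := Sigma.mk.inj_iff.1 this
    rw [DFunLike.coe_injective (eq_of_heq h2)]
  exact key _ _ (Tree.exists_eq_mterm_rename (s.mterm.rename e)).choose_spec.choose_spec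

theorem MTerm.eval_rename (P : SymOperad K) (g : Ω → P.obj (Fin 2)) {ι κ : Type} [Finite ι]
    [Finite κ] (t : MTerm Ω ι) (e : ι ≃ κ) : (t.rename e).eval P g = P.map e (t.eval P g) := by
  obtain ⟨s, f, rfl⟩ := Tree.exists_eq_mterm_rename t
  rw [← MTerm.rename_trans, MTerm.eval_mterm_rename, MTerm.eval_mterm_rename, P.map_map]

theorem MTerm.eval_insert (P : SymOperad K) (g : Ω → P.obj (Fin 2)) {ι κ : Type} [Finite ι]
    [Finite κ] (i : ι) (t : MTerm Ω ι) (s : MTerm Ω κ) :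
    (MTerm.insert i t s).eval P g = P.comp i (t.eval P g) (s.eval P g) := by
  obtain ⟨t, e, rfl⟩ := Tree.exists_eq_mterm_rename t
  obtain ⟨s, f, rfl⟩ := Tree.exists_eq_mterm_rename s
  obtain ⟨i, rfl⟩ := e.surjective i
  obtain ⟨r, e', h1, h2⟩ := t.exists_insert P g i s
  rw [MTerm.insert_rename, MTerm.eval_rename, h1, MTerm.eval_mterm_rename,
    MTerm.eval_mterm_rename, MTerm.eval_mterm_rename, P.comp_map, h2]

theorem MTerm.eval_one (P : SymOperad K) (g : Ω → P.obj (Fin 2)) :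
    (MTerm.one : MTerm Ω Unit).eval P g = P.one := by
  rw [← P.map_refl P.one, ← MTerm.rename_refl MTerm.one]
  exact MTerm.eval_mterm_rename P g (Tree.leaf : Tree Ω) (Equiv.refl Unit)

/-- The basis of the free operad consisting of the multilinear expressions. -/
noncomputable def mono (K : Type u) [Field K] {Ω ι : Type} [Finite ι] (t : MTerm Ω ι) :
    (free K Ω).obj ι :=
  Finsupp.single t (1 : K)

theorem monomial_eq_mono {ι : Type} [Finite ι] (t : Term Ω ι) (ht : t.IsMultilinear) :
    monomial K t ht = mono K ⟨t, ht⟩ := rfl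

theorem free_hom_ext {ι : Type} [Finite ι] {M : Type*} [AddCommGroup M] [Module K M]
    {f g : (free K Ω).obj ι →ₗ[K] M} (h : ∀ t, f (mono K t) = g (mono K t)) : f = g :=
  Finsupp.lhom_ext' fun t => LinearMap.ext_ring (h t)

theorem span_range_mono {ι : Type} [Finite ι] :
    Submodule.span K (Set.range (mono K : MTerm Ω ι → (free K Ω).obj ι)) = ⊤ := by
  rw [eq_top_iff]
  intro x _
  induction x using Finsupp.induction_linear with
  | zero => exact zero_mem _
  | add x y hx hy => exact add_mem (hx trivial) (hy trivial)
  | single t a =>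
    have h : Finsupp.single t a = a • mono K t := (Finsupp.smul_single_one t a).symm
    rw [h]
    exact Submodule.smul_mem _ a (Submodule.subset_span ⟨t, rfl⟩)

theorem free_map_mono {ι κ : Type} [Finite ι] [Finite κ] (e : ι ≃ κ) (t : MTerm Ω ι) :
    (free K Ω).map e (mono K t) = mono K (t.rename e) :=
  Finsupp.mapDomain_single

theorem free_comp_mono {ι κ : Type} [Finite ι] [Finite κ] (i : ι) (t : MTerm Ω ι)
    (s : MTerm Ω κ) : (free K Ω).comp i (mono K t) (mono K s) = mono K (MTerm.insert i t s) := by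
  refine (freeComp_single K Ω i t s 1 1).trans ?_
  rw [mul_one]
  rfl

/-- The linear map on the free operad given by the images of the basis elements. -/
noncomputable def freeLift {ι : Type} [Finite ι] {M : Type*} [AddCommGroup M] [Module K M]
    (f : MTerm Ω ι → M) : (free K Ω).obj ι →ₗ[K] M :=
  Finsupp.linearCombination K f

@[simp]
theorem freeLift_mono {ι : Type} [Finite ι] {M : Type*} [AddCommGroup M] [Module K M]
    (f : MTerm Ω ι → M) (t : MTerm Ω ι) : freeLift f (mono K t) = f t := by
  refine (Finsupp.linearCombination_single _ _ _).trans (one_smul _ _)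

/-- The morphism from the free operad given by the images of the generators. -/
noncomputable def lift (P : SymOperad K) (g : Ω → P.obj (Fin 2)) : Hom (free K Ω) P where
  app ι _ := freeLift fun t : MTerm Ω ι => t.eval P g
  app_map {ι κ} _ _ e x := by
    have : freeLift (fun t : MTerm Ω κ => t.eval P g) ∘ₗ (free K Ω).map e =
        P.map e ∘ₗ freeLift (fun t : MTerm Ω ι => t.eval P g) := free_hom_ext fun t => by
      simp [free_map_mono, MTerm.eval_rename]
    exact LinearMap.congr_fun this x
  app_one := (freeLift_mono _ _).trans (MTerm.eval_one P g)
  app_comp {ι κ} _ _ i x y := by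
    have : ((free K Ω).comp i).compr₂ (freeLift fun t : MTerm Ω (Ins i κ) => t.eval P g) =
        (P.comp i).compl₁₂ (freeLift fun t : MTerm Ω ι => t.eval P g)
          (freeLift fun t : MTerm Ω κ => t.eval P g) :=
      free_hom_ext fun t => free_hom_ext fun s => by
        simp [free_comp_mono, MTerm.eval_insert]
    exact LinearMap.congr_fun (LinearMap.congr_fun this x) y

theorem lift_mono (P : SymOperad K) (g : Ω → P.obj (Fin 2)) {ι : Type} [Finite ι]
    (t : MTerm Ω ι) : (lift P g).app ι (mono K t) = t.eval P g :=
  freeLift_mono _ _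

theorem isMultilinear_op (o : Ω) :
    (Term.op o (.var 0) (.var 1) : Term Ω (Fin 2)).IsMultilinear := by
  constructor
  · simp [Term.vars]
  · intro i
    fin_cases i <;> simp [Term.vars]

/-- The generators of the free operad. -/
noncomputable def gen (K : Type u) [Field K] {Ω : Type} (o : Ω) : (free K Ω).obj (Fin 2) :=
  mono K ⟨.op o (.var 0) (.var 1), isMultilinear_op o⟩

theorem graft_gen_mono (o : Ω) {ι κ : Type} [Finite ι] [Finite κ] (s : MTerm Ω ι)
    (t : MTerm Ω κ) :
    (free K Ω).graft (gen K o) (mono K s) (mono K t) = mono K (MTerm.node o s t) := by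
  rw [graft_apply, gen, free_comp_mono, free_comp_mono, free_map_mono]
  congr 1
  apply Subtype.ext
  simp only [MTerm.rename, MTerm.insert, Term.insert, Term.bind, dite_true, MTerm.node]
  rw [dif_neg (by decide)]
  simp only [Term.bind, dite_true]
  change Term.op o (((s.1.rename _).bind _).bind _) ((t.1.rename _).bind _) =
    Term.op o (s.1.bind _) (t.1.bind _)
  rw [Term.rename_bind, Term.rename_bind, Term.bind_bind]
  congr 2
  funext i
  simp [Term.bind]
  rfl

theorem map_graft_one_one (P : SymOperad K) (g : P.obj (Fin 2)) (e : Unit ⊕ Unit ≃ Fin 2)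
    (he : e (Sum.inl ()) = 0) : P.map e (P.graft g P.one P.one) = g := by
  rw [graft_apply, P.comp_one, P.comp_one, map_map, map_map, map_map]
  have he' : e (Sum.inr ()) = 1 := by
    have : e (Sum.inr ()) ≠ e (Sum.inl ()) := by simp
    rw [he] at this
    revert this
    generalize e (Sum.inr ()) = x
    revert x
    decide
  convert P.map_refl g
  ext i
  fin_cases i
  · simp [insOneEquiv, graftEquiv, he]
  · simp [insOneEquiv, graftEquiv, he']

theorem lift_gen (P : SymOperad K) (g : Ω → P.obj (Fin 2)) (o : Ω) :
    (lift P g).app (Fin 2) (gen K o) = g o := by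
  let e : Unit ⊕ Unit ≃ Fin 2 :=
    ⟨Sum.elim (fun _ => 0) (fun _ => 1), ![Sum.inl (), Sum.inr ()], by rintro (_ | _) <;> rfl,
      by intro i; fin_cases i <;> rfl⟩
  exact (lift_mono _ _ _).trans <| (MTerm.eval_mterm_rename P g (.node o .leaf .leaf) e).trans
    (map_graft_one_one P (g o) e rfl)

/-- Trees arise from the identity by grafting onto generators, multilinear expressions from trees by
relabelling, and these span the free operad. -/
theorem free_induction {S : (ι : Type) → [Finite ι] → Submodule K ((free K Ω).obj ι)}
    (one : (free K Ω).one ∈ S Unit)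
    (map : ∀ {ι κ : Type} [Finite ι] [Finite κ] (e : ι ≃ κ) (x : (free K Ω).obj ι),
      x ∈ S ι → (free K Ω).map e x ∈ S κ)
    (graft : ∀ {ι κ : Type} [Finite ι] [Finite κ] (o : Ω) (x : (free K Ω).obj ι)
      (y : (free K Ω).obj κ), x ∈ S ι → y ∈ S κ → (free K Ω).graft (gen K o) x y ∈ S (ι ⊕ κ))
    {ι : Type} [Finite ι] (x : (free K Ω).obj ι) : x ∈ S ι := by
  have tree : ∀ s : Tree Ω, mono K s.mterm ∈ S s.Leaf := by
    intro s
    induction s with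
    | leaf => exact one
    | node o l r hl hr =>
      have := graft o _ _ hl hr
      rw [graft_gen_mono] at this
      exact this
  have hx : x ∈ Submodule.span K (Set.range (mono K : MTerm Ω ι → (free K Ω).obj ι)) := by
    rw [span_range_mono]
    trivial
  refine Submodule.span_le.2 ?_ hx
  rintro _ ⟨t, rfl⟩
  obtain ⟨s, e, rfl⟩ := Tree.exists_eq_mterm_rename t
  rw [← free_map_mono]
  exact map e _ (tree s)

theorem Hom.ext_of_gen {P : SymOperad K} {F G : Hom (free K Ω) P}
    (h : ∀ o, F.app (Fin 2) (gen K o) = G.app (Fin 2) (gen K o)) : F = G := by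
  ext ι _ x
  refine free_induction (S := fun ι _ => LinearMap.eqLocus (F.app ι) (G.app ι)) ?_ ?_ ?_ x
  · exact F.app_one.trans G.app_one.symm
  · intro ι κ _ _ e x hx
    rw [LinearMap.mem_eqLocus] at hx ⊢
    rw [F.app_map, G.app_map, hx]
  · intro ι κ _ _ o x y hx hy
    rw [LinearMap.mem_eqLocus] at hx hy ⊢
    rw [F.app_graft, G.app_graft, hx, hy, h]

end Lift

end SymOperad

namespace SymOperad

/-! ### Lifting classes of the associated graded operad. -/

section Surjective

variable {K : Type u} [Field K]

theorem Filtration.toGr_eq_zero {P : SymOperad K} (f : P.Filtration) {k : ℕ} {ι : Type}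
    [Finite ι] {x : P.obj ι} (hx : x ∈ f.F k ι) (hx' : x ∈ f.F (k + 1) ι) :
    f.toGr k ι ⟨x, hx⟩ = 0 := by
  have : (Submodule.mkQ ((f.F (k + 1) ι).comap (f.F k ι).subtype)) ⟨x, hx⟩ = 0 :=
    (Submodule.Quotient.mk_eq_zero _).2 hx'
  rw [Filtration.toGr, LinearMap.comp_apply, this, map_zero]

/-- The elements of the `k`-th step of a filtration whose class is in the image of `Φ`. -/
def liftable {P Q : SymOperad K} {f : P.Filtration} (Φ : Hom Q f.gr) (k : ℕ) (ι : Type)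
    [Finite ι] : Submodule K (P.obj ι) :=
  ((LinearMap.range (Φ.app ι)).comap (f.toGr k ι)).map (f.F k ι).subtype

variable {P Q : SymOperad K} {f : P.Filtration} {Φ : Hom Q f.gr}

theorem mem_liftable {k : ℕ} {ι : Type} [Finite ι] {x : P.obj ι} :
    x ∈ liftable Φ k ι ↔ ∃ (hx : x ∈ f.F k ι) (y : Q.obj ι), Φ.app ι y = f.toGr k ι ⟨x, hx⟩ := by
  constructor
  · rintro ⟨⟨x, hx⟩, ⟨y, hy⟩, rfl⟩
    exact ⟨hx, y, hy⟩
  · rintro ⟨hx, y, hy⟩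
    exact ⟨⟨x, hx⟩, ⟨y, hy⟩, rfl⟩

theorem map_mem_liftable {k : ℕ} {ι κ : Type} [Finite ι] [Finite κ] (e : ι ≃ κ) {x : P.obj ι}
    (hx : x ∈ liftable Φ k ι) : P.map e x ∈ liftable Φ k κ := by
  obtain ⟨hx, y, hy⟩ := mem_liftable.1 hx
  refine mem_liftable.2 ⟨f.map_mem k e hx, Q.map e y, ?_⟩
  rw [Φ.app_map, hy]
  exact f.grMap_toGr k e x hx

theorem comp_mem_liftable {a b : ℕ} {ι κ : Type} [Finite ι] [Finite κ] (i : ι) {x : P.obj ι}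
    {y : P.obj κ} (hx : x ∈ liftable Φ a ι) (hy : y ∈ liftable Φ b κ) :
    P.comp i x y ∈ liftable Φ (a + b) (Ins i κ) := by
  obtain ⟨hx, x', hx'⟩ := mem_liftable.1 hx
  obtain ⟨hy, y', hy'⟩ := mem_liftable.1 hy
  refine mem_liftable.2 ⟨f.comp_mem a b i hx hy, Q.comp i x' y', ?_⟩
  rw [Φ.app_comp, hx', hy']
  exact f.grComp_toGr a b i x y hx hy

theorem graft_mem_liftable {a b c : ℕ} {ι κ : Type} [Finite ι] [Finite κ] {g : P.obj (Fin 2)}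
    {x : P.obj ι} {y : P.obj κ} (hg : g ∈ liftable Φ a (Fin 2)) (hx : x ∈ liftable Φ b ι)
    (hy : y ∈ liftable Φ c κ) : P.graft g x y ∈ liftable Φ (a + b + c) (ι ⊕ κ) := by
  rw [graft_apply]
  exact map_mem_liftable _ (comp_mem_liftable _ (comp_mem_liftable _ hg hx) hy)

theorem one_mem_liftable : P.one ∈ liftable Φ 0 Unit :=
  mem_liftable.2 ⟨f.one_mem, Q.one, Φ.app_one⟩

theorem surjective_of_isProduct_mem_liftable {I : P.Ideal} {Φ : Hom Q I.powFiltration.gr}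
    (h : ∀ (k : ℕ) (ι : Type) [Finite ι] (x : P.obj ι), I.IsProduct k ι x → x ∈ liftable Φ k ι)
    (ι : Type) [Finite ι] : Function.Surjective (Φ.app ι) := by
  intro x
  change x ∈ LinearMap.range (Φ.app ι)
  induction x using I.powFiltration.gr_induction with
  | zero => exact zero_mem _
  | add x y hx hy => exact add_mem hx hy
  | cls k x hx =>
    have key : I.pow k ι ≤ liftable Φ k ι := by
      refine Submodule.span_le.2 ?_
      rintro x ⟨m, hm, hx⟩
      rcases hm.eq_or_lt with rfl | hm
      · exact h _ _ _ hx
      -- A product of more than `k` elements of `I` lies in the next step of the filtration, so its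
      -- class in degree `k` is zero.
      · refine mem_liftable.2 ⟨Submodule.subset_span ⟨m, by omega, hx⟩, 0, ?_⟩
        rw [map_zero]
        exact (I.powFiltration.toGr_eq_zero _ (Submodule.subset_span ⟨m, hm, hx⟩)).symm
    obtain ⟨_, y, hy⟩ := mem_liftable.1 (key hx)
    exact ⟨y, hy⟩

theorem isProduct_mem_liftable {I : P.Ideal} {Φ : Hom Q I.powFiltration.gr}
    (h0 : ∀ (ι : Type) [Finite ι] (x : P.obj ι), x ∈ liftable Φ 0 ι)
    (h1 : ∀ (ι : Type) [Finite ι] (x : P.obj ι), x ∈ I.carrier ι → x ∈ liftable Φ 1 ι)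
    (k : ℕ) (ι : Type) [Finite ι] (x : P.obj ι) (hx : I.IsProduct k ι x) :
    x ∈ liftable Φ k ι := by
  induction hx with
  | arbitrary x => exact h0 _ x
  | mem hx => exact h1 _ _ hx
  | map e _ h => exact map_mem_liftable e h
  | comp i _ _ h h' => exact comp_mem_liftable i h h'

theorem app_mem_liftable_zero {Ω : Type} (π : Hom (free K Ω) P)
    (hπ : ∀ o, π.app (Fin 2) (gen K o) ∈ liftable Φ 0 (Fin 2)) (ι : Type) [Finite ι]
    (x : (free K Ω).obj ι) : π.app ι x ∈ liftable Φ 0 ι := by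
  refine free_induction (S := fun ι _ => (liftable Φ 0 ι).comap (π.app ι)) ?_ ?_ ?_ x
  · rw [Submodule.mem_comap, π.app_one]
    exact one_mem_liftable
  · intro ι κ _ _ e x hx
    rw [Submodule.mem_comap, π.app_map]
    exact map_mem_liftable e hx
  · intro ι κ _ _ o x y hx hy
    rw [Submodule.mem_comap, π.app_graft]
    exact graft_mem_liftable (hπ o) hx hy

/-- Degrees add under composition. As everything lifts in degree 0, what lifts in degree 1 is closed
under composition with arbitrary operations: it is an operadic ideal containing `R`. -/
theorem mem_liftable_one_of_mem_span {R : (n : ℕ) → Set (P.obj (Fin n))}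
    (h0 : ∀ (ι : Type) [Finite ι] (x : P.obj ι), x ∈ liftable Φ 0 ι)
    (hR : ∀ n, R n ⊆ liftable Φ 1 (Fin n)) (ι : Type) [Finite ι] (x : P.obj ι)
    (hx : x ∈ (Ideal.span R).carrier ι) : x ∈ liftable Φ 1 ι :=
  hx
    { carrier := fun ι _ => liftable Φ 1 ι
      map_mem := fun e _ hx => map_mem_liftable e hx
      comp_mem_left := fun i _ y hx => by
        have := comp_mem_liftable i hx (h0 _ y)
        rwa [add_zero] at this
      comp_mem_right := fun i x _ hy => by
        have := comp_mem_liftable i (h0 _ x) hy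
        rwa [zero_add] at this } hR

end Surjective

/-- The projection to a quotient operad. -/
def mkHom {K : Type u} [Field K] (P : SymOperad K) (I : P.Ideal) : Hom P (P.quotient I) where
  app ι _ := (I.carrier ι).mkQ
  app_map _ _ := rfl
  app_one := rfl
  app_comp _ _ _ := rfl

/-! ### Existence, uniqueness and surjectivity of the canonical presentation. -/

section Novikov

variable {K : Type u} [Field K] {Φ : Hom (free K TPOp) (grNov K)}

/-- The projection from the free operad to the Novikov operad. -/
noncomputable def novProj (K : Type u) [Field K] : Hom (free K Unit) (Nov K) :=
  mkHom _ _

theorem novProj_gen (o : Unit) : (novProj K).app (Fin 2) (gen K o) = novMul K := rfl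

theorem novProj_surjective (ι : Type) [Finite ι] : Function.Surjective ((novProj K).app ι) :=
  Submodule.mkQ_surjective _

/-- The filtration of the Novikov operad by the powers of the commutator ideal. -/
noncomputable abbrev novFiltration (K : Type u) [Field K] : (Nov K).Filtration :=
  (commutatorIdeal K).powFiltration

theorem mem_liftable_zero_of_isCanonical (hΦ : IsCanonical Φ) (ι : Type) [Finite ι]
    (x : (Nov K).obj ι) : x ∈ liftable (f := novFiltration K) Φ 0 ι := by
  obtain ⟨x, rfl⟩ := novProj_surjective ι x
  refine app_mem_liftable_zero (novProj K) (fun o => ?_) ι x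
  rw [novProj_gen]
  exact mem_liftable.2 ⟨(commutatorIdeal K).mem_pow_zero _, gen K .mul, hΦ.1⟩

theorem mem_liftable_one_of_isCanonical (hΦ : IsCanonical Φ) (ι : Type) [Finite ι]
    (x : (Nov K).obj ι) (hx : x ∈ (commutatorIdeal K).carrier ι) :
    x ∈ liftable (f := novFiltration K) Φ 1 ι := by
  refine mem_liftable_one_of_mem_span (mem_liftable_zero_of_isCanonical hΦ) (fun n => ?_) ι x hx
  match n with
  | 2 =>
    intro x hx
    have hx : x = novCommutator K := hx
    subst hx
    exact mem_liftable.2 ⟨(commutatorIdeal K).mem_pow_one (novCommutator_mem K),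
      gen K .bracket, hΦ.2⟩
  | 0 | 1 | n + 3 => exact Set.empty_subset _

theorem surjective_of_isCanonical (hΦ : IsCanonical Φ) (ι : Type) [Finite ι] :
    Function.Surjective (Φ.app ι) :=
  surjective_of_isProduct_mem_liftable (isProduct_mem_liftable
    (mem_liftable_zero_of_isCanonical hΦ) (mem_liftable_one_of_isCanonical hΦ)) ι

theorem isCanonical_iff : IsCanonical Φ ↔
    Φ.app (Fin 2) (gen K .mul) = grMul K ∧ Φ.app (Fin 2) (gen K .bracket) = grBracket K :=
  Iff.rfl

/-- The classes of the Novikov product and of the commutator. -/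
noncomputable def grGen (K : Type u) [Field K] : TPOp → (grNov K).obj (Fin 2)
  | .mul => grMul K
  | .bracket => grBracket K

theorem existsUnique_isCanonical (K : Type u) [Field K] :
    ∃! Φ : Hom (free K TPOp) (grNov K), IsCanonical Φ := by
  refine ⟨lift (grNov K) (grGen K), ?_, fun Ψ hΨ => ?_⟩
  · refine isCanonical_iff.2 ⟨?_, ?_⟩
    · rw [lift_gen, grGen]
    · rw [lift_gen, grGen]
  · refine Hom.ext_of_gen fun o => ?_
    obtain ⟨h1, h2⟩ := isCanonical_iff.1 hΨ
    rw [lift_gen]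
    cases o with
    | mul => rw [h1, grGen]
    | bracket => rw [h2, grGen]

end Novikov

end SymOperad

namespace SymOperad

/-! ### Characters of operads. -/

section PolynomialNotation

open Polynomial

section Character

variable {K : Type u} [Field K]

open Classical in
/-- The weights of the inputs of `x` in `x ∘_i y`, given the weights of the inputs of `x ∘_i y`:
the input `i` has the total weight of the inputs of `y`. -/
noncomputable def collapse {ι κ : Type} (i : ι) (w : Ins i κ → K) (j : ι) : K :=
  if h : j = i then ∑ᶠ k, w (Sum.inr k) else w (Sum.inl ⟨j, h⟩)

/-- A character of an operad with values in a commutative algebra `R`: a morphism to the operad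
of `R`-valued functions of the weights of the inputs, where composition is multiplication of the
functions, the output of an operation having the sum of the weights of its inputs as weight. -/
structure Character (P : SymOperad K) (R : Type u) [CommRing R] [Algebra K R] where
  ev : (ι : Type) → [Finite ι] → (ι → K) → P.obj ι →ₗ[K] R
  ev_map : ∀ {ι κ : Type} [Finite ι] [Finite κ] (e : ι ≃ κ) (w : κ → K) (x : P.obj ι),
    ev κ w (P.map e x) = ev ι (w ∘ e) x
  ev_one : ∀ w, ev Unit w P.one = 1
  ev_comp : ∀ {ι κ : Type} [Finite ι] [Finite κ] (i : ι) (w : Ins i κ → K) (x : P.obj ι)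
    (y : P.obj κ), ev (Ins i κ) w (P.comp i x y) = ev ι (collapse i w) x * ev κ (w ∘ Sum.inr) y

namespace Character

variable {R : Type u} [CommRing R] [Algebra K R] {P Q : SymOperad K}

/-- The operations all of whose values are in a given ideal. -/
def comap (χ : Character P R) (a : _root_.Ideal R) : P.Ideal where
  carrier ι _ := ⨅ w, (a.restrictScalars K).comap (χ.ev ι w)
  map_mem e x hx := by
    simp only [Submodule.mem_iInf] at hx ⊢
    intro w
    rw [Submodule.mem_comap, χ.ev_map]
    exact hx _
  comp_mem_left i x y hx := by
    simp only [Submodule.mem_iInf] at hx ⊢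
    intro w
    rw [Submodule.mem_comap, χ.ev_comp]
    exact a.mul_mem_right _ (hx _)
  comp_mem_right i x y hy := by
    simp only [Submodule.mem_iInf] at hy ⊢
    intro w
    rw [Submodule.mem_comap, χ.ev_comp]
    exact a.mul_mem_left _ (hy _)

theorem mem_comap {χ : Character P R} {a : _root_.Ideal R} {ι : Type} [Finite ι] {x : P.obj ι} :
    x ∈ (χ.comap a).carrier ι ↔ ∀ w, χ.ev ι w x ∈ a := by
  simp only [comap, Submodule.mem_iInf]
  rfl

/-- The pullback of a character. -/
def pullback (χ : Character Q R) (F : Hom P Q) : Character P R where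
  ev ι _ w := χ.ev ι w ∘ₗ F.app ι
  ev_map e w x := by simp [F.app_map, χ.ev_map]
  ev_one w := by simp [F.app_one, χ.ev_one]
  ev_comp i w x y := by simp [F.app_comp, χ.ev_comp]

/-- The character induced on a quotient. -/
def quotient (χ : Character P R) (I : P.Ideal)
    (h : ∀ (ι : Type) [Finite ι] (x : P.obj ι), x ∈ I.carrier ι → ∀ w, χ.ev ι w x = 0) :
    Character (P.quotient I) R where
  ev ι _ w := (I.carrier ι).liftQ (χ.ev ι w) fun x hx => h ι x hx w
  ev_map e w x := by
    induction x using Submodule.Quotient.induction_on with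
    | H x => exact χ.ev_map e w x
  ev_one w := χ.ev_one w
  ev_comp i w x y := by
    induction x using Submodule.Quotient.induction_on with
    | H x =>
      induction y using Submodule.Quotient.induction_on with
      | H y => exact χ.ev_comp i w x y

theorem ev_graft_congr {χ ψ : Character P R} {g : P.obj (Fin 2)}
    (hg : ∀ w, χ.ev _ w g = ψ.ev _ w g) {ι κ : Type} [Finite ι] [Finite κ] {x : P.obj ι}
    {y : P.obj κ} (hx : ∀ w, χ.ev _ w x = ψ.ev _ w x) (hy : ∀ w, χ.ev _ w y = ψ.ev _ w y)
    (w : ι ⊕ κ → K) : χ.ev _ w (P.graft g x y) = ψ.ev _ w (P.graft g x y) := by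
  simp only [graft_apply, ev_map, ev_comp, hg, hx, hy]

theorem ext_of_gen {Ω : Type} {χ ψ : Character (free K Ω) R}
    (h : ∀ o w, χ.ev (Fin 2) w (gen K o) = ψ.ev (Fin 2) w (gen K o)) {ι : Type} [Finite ι]
    (w : ι → K) (x : (free K Ω).obj ι) : χ.ev ι w x = ψ.ev ι w x := by
  have key : x ∈ ⨅ w, LinearMap.eqLocus (χ.ev ι w) (ψ.ev ι w) := by
    refine free_induction (S := fun ι _ => ⨅ w, LinearMap.eqLocus (χ.ev ι w) (ψ.ev ι w))
      ?_ ?_ ?_ x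
    · simp [ev_one]
    · intro ι κ _ _ e x hx
      simp only [Submodule.mem_iInf, LinearMap.mem_eqLocus, ev_map] at hx ⊢
      exact fun w => hx _
    · intro ι κ _ _ o x y hx hy
      simp only [Submodule.mem_iInf, LinearMap.mem_eqLocus] at hx hy ⊢
      exact ev_graft_congr (h o) hx hy
  simp only [Submodule.mem_iInf, LinearMap.mem_eqLocus] at key
  exact key w

end Character

/-! ### Characters of free operads -/

namespace Term

variable {Ω ι κ : Type} {R : Type u} [CommRing R]

/-- The sum of the weights of the variables of an expression. -/
def varSum (w : ι → K) (t : Term Ω ι) : K := (t.vars.map w).sum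

/-- The product over the vertices of an expression of a function of the total weights of
the left and of the right branch. -/
def weight (g : Ω → K → K → R) (w : ι → K) : Term Ω ι → R
  | var _ => 1
  | op o s t => g o (s.varSum w) (t.varSum w) * (s.weight g w * t.weight g w)

@[simp]
theorem varSum_var (w : ι → K) (i : ι) : (var i : Term Ω ι).varSum w = w i := by
  simp [varSum, vars]

@[simp]
theorem varSum_op (w : ι → K) (o : Ω) (s t : Term Ω ι) :
    (op o s t).varSum w = s.varSum w + t.varSum w := by
  simp [varSum, vars]

theorem varSum_bind (w : κ → K) (t : Term Ω ι) (σ : ι → Term Ω κ) :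
    (t.bind σ).varSum w = t.varSum fun i => (σ i).varSum w := by
  induction t with
  | var i => simp [bind]
  | op o s t hs ht => simp [bind, hs, ht]

theorem weight_bind (g : Ω → K → K → R) (w : κ → K) (t : Term Ω ι) (σ : ι → Term Ω κ) :
    (t.bind σ).weight g w =
      t.weight g (fun i => (σ i).varSum w) * (t.vars.map fun i => (σ i).weight g w).prod := by
  induction t with
  | var i => simp [bind, weight, vars]
  | op o s t hs ht =>
    simp only [bind, weight, hs, ht, varSum_bind, vars, List.map_append, List.prod_append]
    ring

theorem weight_rename (g : Ω → K → K → R) (w : κ → K) (t : Term Ω ι) (f : ι → κ) :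
    (t.rename f).weight g w = t.weight g (w ∘ f) := by
  simp only [rename, weight_bind, varSum_var, weight, List.map_const', List.prod_replicate,
    one_pow, mul_one]
  rfl

theorem varSum_rename (w : κ → K) (t : Term Ω ι) (f : ι → κ) :
    (t.rename f).varSum w = t.varSum (w ∘ f) := by
  simp only [rename, varSum_bind, varSum_var]
  rfl

theorem varSum_eq_finsum [Finite ι] (w : ι → K) {t : Term Ω ι} (ht : t.IsMultilinear) :
    t.varSum w = ∑ᶠ i, w i := by
  classical
  have := Fintype.ofFinite ι
  rw [finsum_eq_sum_of_fintype, varSum, ← List.sum_toFinset w ht.1]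
  congr 1
  ext i
  simp [ht.2 i]

/-- The vertices of `t` see the grafted `s` only through its total weight, which is the sum of all
weights of its inputs because `s` is multilinear. -/
theorem weight_insert [Finite κ] (g : Ω → K → K → R) {i : ι} (w : Ins i κ → K) (t : MTerm Ω ι)
    (s : MTerm Ω κ) : (MTerm.insert i t s).1.weight g w =
      t.1.weight g (collapse i w) * s.1.weight g (w ∘ Sum.inr) := by
  classical
  change (t.1.bind _).weight g w = _
  rw [weight_bind]
  congr 1
  · congr 1
    funext j
    by_cases h : j = i
    · simp [h, collapse, varSum_rename, varSum_eq_finsum _ s.2]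
    · simp [h, collapse]
  -- Every variable other than `i` is replaced by a variable, which has weight 1.
  · rw [← List.prod_toFinset _ t.2.1, Finset.prod_eq_single i]
    · simp [weight_rename]
    · intro j _ h
      simp [h, weight]
    · intro h
      exact (h (List.mem_toFinset.2 (t.2.2 i))).elim

end Term

/-- The character of the free operad given by its values on the generators. -/
noncomputable def weightCharacter {Ω : Type} {R : Type u} [CommRing R] [Algebra K R]
    (g : Ω → K → K → R) : Character (free K Ω) R where
  ev ι _ w := freeLift fun t => t.1.weight g w
  ev_map {ι κ} _ _ e w x := by
    have : (freeLift fun t : MTerm Ω κ => t.1.weight g w) ∘ₗ (free K Ω).map e =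
        freeLift fun t : MTerm Ω ι => t.1.weight g (w ∘ e) := free_hom_ext fun t => by
      simp [free_map_mono, MTerm.rename, Term.weight_rename]
    exact LinearMap.congr_fun this x
  ev_one w := freeLift_mono _ _
  ev_comp {ι κ} _ _ i w x y := by
    have : ((free K Ω).comp i).compr₂ (freeLift fun t : MTerm Ω (Ins i κ) => t.1.weight g w) =
        (LinearMap.mul K R).compl₁₂
          (freeLift fun t : MTerm Ω ι => t.1.weight g (collapse i w))
          (freeLift fun t : MTerm Ω κ => t.1.weight g (w ∘ Sum.inr)) :=
      free_hom_ext fun t => free_hom_ext fun s => by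
        simp [free_comp_mono, Term.weight_insert]
    exact LinearMap.congr_fun (LinearMap.congr_fun this x) y

theorem weightCharacter_mono {Ω : Type} {R : Type u} [CommRing R] [Algebra K R]
    (g : Ω → K → K → R) {ι : Type} [Finite ι] (w : ι → K) (t : MTerm Ω ι) :
    (weightCharacter g).ev ι w (mono K t) = t.1.weight g w :=
  freeLift_mono _ _

/-! ### Characters of associated graded operads -/

/-- The character of the associated graded operad given by the leading coefficients
of a character with polynomial values. -/
noncomputable def Character.gr {P : SymOperad K} (χ : Character P K[X]) (f : P.Filtration)
    (h : ∀ (k : ℕ) (ι : Type) [Finite ι] (x : P.obj ι), x ∈ f.F k ι → ∀ w, X ^ k ∣ χ.ev ι w x) :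
    Character f.gr K[X] := by
  let θ (ι : Type) [Finite ι] (w : ι → K) : (⨁ k, f.piece k ι) →ₗ[K] K[X] :=
    DirectSum.toModule K ℕ _ fun k => Submodule.liftQ _
      (Polynomial.monomial k ∘ₗ lcoeff K k ∘ₗ χ.ev ι w ∘ₗ (f.F k ι).subtype) fun x hx => by
        -- Well defined on `F k / F (k + 1)`: values on `F (k + 1)` are multiples of `X ^ (k + 1)`
        -- and have no term of degree `k`.
        have := X_pow_dvd_iff.1 (h (k + 1) ι x.1 hx w) k (Nat.lt_succ_self k)
        simp [this]
  have hθ (ι : Type) [Finite ι] (w : ι → K) (k : ℕ) (x : P.obj ι) (hx : x ∈ f.F k ι) :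
      θ ι w (f.toGr k ι ⟨x, hx⟩) = Polynomial.monomial k ((χ.ev ι w x).coeff k) := by
    simp only [θ, Filtration.toGr, LinearMap.comp_apply, DirectSum.toModule_lof]
    rfl
  exact
  { ev := fun ι _ w => θ ι w
    ev_map := by
      intro ι κ _ _ e w x
      change θ κ w (f.grMap e x) = θ ι (w ∘ e) x
      induction x using f.gr_induction with
      | zero => simp
      | add x y hx hy => simp [hx, hy]
      | cls k x hx => rw [f.grMap_toGr, hθ, hθ, χ.ev_map]
    ev_one := by
      intro w
      refine (hθ Unit w 0 P.one f.one_mem).trans ?_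
      rw [χ.ev_one]
      simp
    ev_comp := by
      intro ι κ _ _ i w (x : ⨁ k, f.piece k ι) (y : ⨁ k, f.piece k κ)
      change θ (Ins i κ) w (f.grComp i x y) = θ ι (collapse i w) x * θ κ (w ∘ Sum.inr) y
      induction x using f.gr_induction with
      | zero => simp
      | add x x' hx hx' => simp [hx, hx', add_mul]
      | cls a x hx =>
        induction y using f.gr_induction with
        | zero => simp
        | add y y' hy hy' => simp [hy, hy', mul_add]
        | cls b y hy =>
          rw [f.grComp_toGr, hθ, hθ, hθ, χ.ev_comp, monomial_mul_monomial]
          congr 1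
          -- Since the two values are multiples of `X ^ a` and `X ^ b`, the coefficient of `X ^ (a +
          -- b)` in their product has no cross terms.
          obtain ⟨p, hp⟩ := h a ι x hx (collapse i w)
          obtain ⟨q, hq⟩ := h b κ y hy (w ∘ Sum.inr)
          rw [hp, hq]
          have : X ^ a * p * (X ^ b * q) = p * q * X ^ (a + b) := by ring
          rw [this]
          simp only [coeff_mul_X_pow', coeff_X_pow_mul', le_refl, if_true, Nat.sub_self,
            mul_coeff_zero] }

theorem Character.gr_toGr {P : SymOperad K} (χ : Character P K[X]) (f : P.Filtration)
    (h : ∀ (k : ℕ) (ι : Type) [Finite ι] (x : P.obj ι), x ∈ f.F k ι → ∀ w, X ^ k ∣ χ.ev ι w x)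
    {ι : Type} [Finite ι] (w : ι → K) (k : ℕ) (x : P.obj ι) (hx : x ∈ f.F k ι) :
    (χ.gr f h).ev ι w (f.toGr k ι ⟨x, hx⟩) = Polynomial.monomial k ((χ.ev ι w x).coeff k) := by
  simp only [Character.gr, Filtration.toGr, LinearMap.comp_apply]
  exact (DirectSum.toModule_lof _ _ _).trans rfl

/-- Characters turn composition into multiplication, so each use of an element of `I` contributes a
factor `X`. -/
theorem Character.pow_dvd {P : SymOperad K} (χ : Character P K[X]) (I : P.Ideal)
    (h : ∀ (ι : Type) [Finite ι] (x : P.obj ι), x ∈ I.carrier ι → ∀ w, X ∣ χ.ev ι w x)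
    (k : ℕ) (ι : Type) [Finite ι] (x : P.obj ι) (hx : x ∈ I.pow k ι) (w : ι → K) :
    X ^ k ∣ χ.ev ι w x := by
  have key : ∀ (m : ℕ) (ι : Type) [Finite ι] (x : P.obj ι), I.IsProduct m ι x →
      ∀ w, X ^ m ∣ χ.ev ι w x := by
    intro m ι _ x hx
    induction hx with
    | arbitrary x => simp
    | mem hx => simpa using h _ _ hx
    | map e _ h =>
      intro w
      rw [χ.ev_map]
      exact h _
    | comp i _ _ h h' =>
      intro w
      rw [χ.ev_comp, pow_add]
      exact mul_dvd_mul (h _) (h' _)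
  have : I.pow k ι ≤ ((_root_.Ideal.span {X ^ k}).restrictScalars K).comap (χ.ev ι w) := by
    refine Submodule.span_le.2 ?_
    rintro x ⟨m, hm, hx⟩
    exact _root_.Ideal.mem_span_singleton.2 ((pow_dvd_pow X hm).trans (key m ι x hx w))
  exact _root_.Ideal.mem_span_singleton.1 (this hx)

end Character

/-! ### The character of the Novikov operad on exponentials, and its leading coefficients. -/

section Novikov

variable (K : Type u) [Field K]

/-- The character of the Novikov operad that describes the action of the Novikov operations
`x ∘ y = x (1 + X D) y` on exponential functions. -/
noncomputable def novCharacter : Character (Nov K) K[X] :=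
  (weightCharacter fun _ _ b => 1 + X * C b).quotient _ fun ι _ x hx w => by
    -- The operations with all values zero form an operadic ideal, so only the defining relations
    -- need checking.
    have := hx ((weightCharacter fun _ _ b => 1 + X * C b : Character (free K Unit) K[X]).comap ⊥)
      (fun n => ?_)
    · exact Character.mem_comap.1 this w
    match n with
    | 3 =>
      rintro _ (rfl | rfl)
      all_goals
        -- For weights `a, b, c`, the value of `(x ∘ y) ∘ z` is `(1 + X b) (1 + X c)` and that of `x
        -- ∘ (y ∘ z)` is `(1 + X (b + c)) (1 + X c)`.
        refine Character.mem_comap.2 fun w => ?_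
        simp only [monomial_eq_mono, map_sub, weightCharacter_mono, Term.weight, Term.varSum_op,
          Term.varSum_var, C_add, Submodule.mem_bot]
        ring
    | 0 | 1 | 2 | n + 4 => exact Set.empty_subset _

theorem novCharacter_mk {ι : Type} [Finite ι] (w : ι → K) (x : (free K Unit).obj ι) :
    (novCharacter K).ev ι w (Submodule.Quotient.mk x) =
      (weightCharacter fun _ _ b => 1 + X * C b : Character (free K Unit) K[X]).ev ι w x := rfl

theorem novCharacter_novMul (w : Fin 2 → K) :
    (novCharacter K).ev _ w (novMul K) = 1 + X * C (w 1) := by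
  rw [novMul, novCharacter_mk, monomial_eq_mono, weightCharacter_mono]
  simp [Term.weight]

theorem novCharacter_novCommutator (w : Fin 2 → K) :
    (novCharacter K).ev _ w (novCommutator K) = X * (C (w 1) - C (w 0)) := by
  rw [novCommutator, map_sub, Character.ev_map, novCharacter_novMul, novCharacter_novMul]
  simp only [Function.comp_apply, Equiv.swap_apply_right]
  ring

theorem X_dvd_novCharacter (ι : Type) [Finite ι] (x : (Nov K).obj ι)
    (hx : x ∈ (commutatorIdeal K).carrier ι) (w : ι → K) : X ∣ (novCharacter K).ev ι w x := by
  have := hx ((novCharacter K).comap (_root_.Ideal.span {X})) (fun n => ?_)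
  · exact _root_.Ideal.mem_span_singleton.1 (Character.mem_comap.1 this w)
  match n with
  | 2 =>
    rintro _ rfl
    refine Character.mem_comap.2 fun w => ?_
    rw [novCharacter_novCommutator]
    exact _root_.Ideal.mem_span_singleton.2 (dvd_mul_right _ _)
  | 0 | 1 | n + 3 => exact Set.empty_subset _

/-- The character of `grNov` given by the leading coefficients of `novCharacter`. -/
noncomputable def grNovCharacter : Character (grNov K) K[X] :=
  (novCharacter K).gr _ ((novCharacter K).pow_dvd _ (X_dvd_novCharacter K))

/-- The values of the character of the free operad on a product and a bracket that describes
the action of `x · y = x y` and `[x, y] = X (x D y - y D x)` on exponential functions. -/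
noncomputable def tpWeight : TPOp → K → K → K[X]
  | .mul, _, _ => 1
  | .bracket, a, b => X * (C b - C a)

variable {K}

/-- Both sides are characters of a free operad, so generators suffice: `1 + X b` has leading term 1
in degree 0, and `X (b - a)` is its own leading term in degree 1. -/
theorem grNovCharacter_app {Φ : Hom (free K TPOp) (grNov K)} (hΦ : IsCanonical Φ) {ι : Type}
    [Finite ι] (w : ι → K) (x : (free K TPOp).obj ι) :
    (grNovCharacter K).ev ι w (Φ.app ι x) = (weightCharacter (tpWeight K)).ev ι w x := by
  refine Character.ext_of_gen (χ := (grNovCharacter K).pullback Φ) (fun o w => ?_) w x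
  rw [gen, weightCharacter_mono]
  cases o with
  | mul =>
    refine (congrArg ((grNovCharacter K).ev _ w) hΦ.1).trans ?_
    refine (Character.gr_toGr _ _ _ _ _ _ _).trans ?_
    rw [novCharacter_novMul]
    simp [Term.weight, tpWeight]
  | bracket =>
    refine (congrArg ((grNovCharacter K).ev _ w) hΦ.2).trans ?_
    refine (Character.gr_toGr _ _ _ _ _ _ _).trans ?_
    rw [novCharacter_novCommutator, ← C_sub, coeff_X_mul _ 0, coeff_C_zero,
      ← C_mul_X_eq_monomial]
    simp only [Term.weight, tpWeight, Term.varSum_var, C_sub]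
    ring

end Novikov

end PolynomialNotation

end SymOperad

namespace SymOperad

/-! ### Free algebras over a quotient of a free operad. -/

section FreeAlgebra

variable {K : Type u} [Field K] {Ω : Type}

/-- The bilinear extension of an operation symbol to linear combinations of expressions. -/
noncomputable def opLin (K : Type u) [Field K] {Ω : Type} (o : Ω) (κ : Type) :
    (Term Ω κ →₀ K) →ₗ[K] (Term Ω κ →₀ K) →ₗ[K] (Term Ω κ →₀ K) :=
  Finsupp.lift _ K _ fun t => Finsupp.lmapDomain K K (Term.op o t)

theorem opLin_single (o : Ω) {κ : Type} (s t : Term Ω κ) (a b : K) :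
    opLin K o κ (Finsupp.single s a) (Finsupp.single t b) =
      Finsupp.single (.op o s t) (a * b) := by
  simp [opLin, Finsupp.mapDomain_single]

/-- Substitution of expressions for the inputs of operations of the free operad. -/
noncomputable def bindLin {ι κ : Type} [Finite ι] (σ : ι → Term Ω κ) :
    (free K Ω).obj ι →ₗ[K] (Term Ω κ →₀ K) :=
  freeLift fun t => Finsupp.single (t.1.bind σ) 1

@[simp]
theorem bindLin_mono {ι κ : Type} [Finite ι] (σ : ι → Term Ω κ) (t : MTerm Ω ι) :
    bindLin σ (mono K t) = Finsupp.single (t.1.bind σ) 1 :=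
  freeLift_mono _ _

theorem bindLin_map {ι ι' κ : Type} [Finite ι] [Finite ι'] (σ : ι' → Term Ω κ) (e : ι ≃ ι')
    (p : (free K Ω).obj ι) : bindLin σ ((free K Ω).map e p) = bindLin (σ ∘ e) p := by
  have : bindLin σ ∘ₗ (free K Ω).map e = bindLin (σ ∘ e) := free_hom_ext fun t => by
    simp [free_map_mono, MTerm.rename, Term.rename_bind]
  exact LinearMap.congr_fun this p

theorem bindLin_comp_mono {ι ι' κ : Type} [Finite ι] [Finite ι'] {i : ι}
    (σ : Ins i ι' → Term Ω κ) (τ : ι → Term Ω κ) (p : (free K Ω).obj ι) (s : MTerm Ω ι')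
    (hi : τ i = s.1.bind (σ ∘ Sum.inr)) (h : ∀ j hj, τ j = σ (Sum.inl ⟨j, hj⟩)) :
    bindLin σ ((free K Ω).comp i p (mono K s)) = bindLin τ p := by
  have : bindLin σ ∘ₗ ((free K Ω).comp i).flip (mono K s) = bindLin τ := free_hom_ext fun t => by
    simp only [LinearMap.comp_apply, LinearMap.flip_apply, free_comp_mono, bindLin_mono]
    congr 1
    change (t.1.bind _).bind _ = _
    rw [Term.bind_bind]
    congr 1
    funext j
    by_cases hj : j = i
    · subst hj
      simp [hi, Term.rename_bind]
    · simp [hj, Term.bind, h j hj]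
  exact LinearMap.congr_fun this p

theorem bindLin_graft_one {ι κ : Type} [Finite ι] (o : Ω) (σ : ι → Term Ω κ) (s : Term Ω κ)
    (p : (free K Ω).obj ι) :
    bindLin (Sum.elim (fun _ => s) σ) ((free K Ω).graft (gen K o) (mono K MTerm.one) p) =
      opLin K o κ (Finsupp.single s 1) (bindLin σ p) := by
  have : bindLin (Sum.elim (fun _ => s) σ) ∘ₗ (free K Ω).graft (gen K o) (mono K MTerm.one) =
      opLin K o κ (Finsupp.single s 1) ∘ₗ bindLin σ := free_hom_ext fun t => by
    simp only [LinearMap.comp_apply, graft_gen_mono, bindLin_mono, opLin_single, mul_one]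
    congr 1
    change Term.op o ((Term.rename _ _).bind _) ((Term.rename _ _).bind _) = _
    rw [Term.rename_bind, Term.rename_bind]
    rfl
  exact LinearMap.congr_fun this p

theorem bindLin_graft_one_right {ι κ : Type} [Finite ι] (o : Ω) (σ : ι → Term Ω κ)
    (s : Term Ω κ) (p : (free K Ω).obj ι) :
    bindLin (Sum.elim σ fun _ => s) ((free K Ω).graft (gen K o) p (mono K MTerm.one)) =
      opLin K o κ (bindLin σ p) (Finsupp.single s 1) := by
  have : bindLin (Sum.elim σ fun _ => s) ∘ₗ
      ((free K Ω).graft (gen K o)).flip (mono K (MTerm.one : MTerm Ω Unit)) =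
      (opLin K o κ).flip (Finsupp.single s 1) ∘ₗ bindLin σ := free_hom_ext fun t => by
    simp only [LinearMap.comp_apply, LinearMap.flip_apply, graft_gen_mono, bindLin_mono,
      opLin_single, mul_one]
    congr 1
    change Term.op o ((Term.rename _ _).bind _) ((Term.rename _ _).bind _) = _
    rw [Term.rename_bind, Term.rename_bind]
    rfl
  exact LinearMap.congr_fun this p

theorem Ideal.graft_mem_left {P : SymOperad K} (J : P.Ideal) {ι κ : Type} [Finite ι] [Finite κ]
    (g : P.obj (Fin 2)) {x : P.obj ι} (y : P.obj κ) (hx : x ∈ J.carrier ι) :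
    P.graft g x y ∈ J.carrier (ι ⊕ κ) :=
  J.map_mem _ (J.comp_mem_left _ _ (J.comp_mem_right _ _ hx))

theorem Ideal.graft_mem_right {P : SymOperad K} (J : P.Ideal) {ι κ : Type} [Finite ι] [Finite κ]
    (g : P.obj (Fin 2)) (x : P.obj ι) {y : P.obj κ} (hy : y ∈ J.carrier κ) :
    P.graft g x y ∈ J.carrier (ι ⊕ κ) :=
  J.map_mem _ (J.comp_mem_right _ _ hy)

/-- The number of operation symbols in an expression. -/
def Term.numOps {κ : Type} : Term Ω κ → ℕ
  | .var _ => 0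
  | .op _ s t => s.numOps + t.numOps + 1

variable (J : (free K Ω).Ideal)

/-- The consequences of the identities in an operadic ideal that are obtained by renaming
variables. -/
noncomputable def identities (κ : Type) : Submodule K (Term Ω κ →₀ K) :=
  Submodule.span K {x | ∃ (ι : Type) (_ : Finite ι) (f : ι → κ) (p : (free K Ω).obj ι),
    p ∈ J.carrier ι ∧ x = bindLin (fun i => .var (f i)) p}

variable {J}

/-- Only renamings of variables enter the definition of `identities`. For general substitutions, the
root operation of a substituted expression is absorbed into `p` by composing with a generator, which
stays in `J`; the number of remaining operation symbols drops by one. -/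
theorem bindLin_mem_identities {ι κ : Type} [Finite ι] (σ : ι → Term Ω κ)
    {p : (free K Ω).obj ι} (hp : p ∈ J.carrier ι) : bindLin σ p ∈ identities J κ := by
  have key : ∀ (n : ℕ) (ι : Type) [Fintype ι] (σ : ι → Term Ω κ) (p : (free K Ω).obj ι),
      p ∈ J.carrier ι → ∑ i, (σ i).numOps = n → bindLin σ p ∈ identities J κ := by
    intro n
    induction n with
    | zero =>
      intro ι _ σ p hp hσ
      have : ∀ i, ∃ j, σ i = .var j := by
        intro i
        have := Finset.sum_eq_zero_iff.1 hσ i (Finset.mem_univ i)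
        cases h : σ i with
        | var j => exact ⟨j, rfl⟩
        | op o s t =>
          rw [h] at this
          simp [Term.numOps] at this
      choose f hf using this
      obtain rfl : σ = fun i => .var (f i) := funext hf
      exact Submodule.subset_span ⟨ι, inferInstance, f, p, hp, rfl⟩
    | succ n ih =>
      intro ι _ σ p hp hσ
      classical
      obtain ⟨i, -, hi⟩ := Finset.exists_ne_zero_of_sum_ne_zero (by rw [hσ]; omega)
      cases h : σ i with
      | var j => simp [h, Term.numOps] at hi
      | op o s t =>
        let τ : Ins i (Fin 2) → Term Ω κ := Sum.elim (fun j => σ j.1) ![s, t]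
        have h1 : bindLin τ ((free K Ω).comp i p (gen K o)) = bindLin σ p :=
          bindLin_comp_mono τ σ p _ h fun _ _ => rfl
        rw [← h1]
        refine ih _ τ _ (J.comp_mem_left i _ hp) ?_
        rw [Fintype.sum_eq_add_sum_subtype_ne _ i, h] at hσ
        simp only [Fintype.sum_sum_type, Fin.sum_univ_two, τ, Sum.elim_inl, Sum.elim_inr,
          Matrix.cons_val_zero, Matrix.cons_val_one]
        simp only [Term.numOps] at hσ
        omega
  have := Fintype.ofFinite ι
  exact key _ ι σ p hp rfl

theorem opLin_mem_identities_right {κ : Type} (o : Ω) (x : Term Ω κ →₀ K) {y : Term Ω κ →₀ K}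
    (hy : y ∈ identities J κ) : opLin K o κ x y ∈ identities J κ := by
  induction x using Finsupp.induction_linear with
  | zero => simp
  | add x x' hx hx' =>
    rw [map_add]
    exact add_mem hx hx'
  | single s a =>
    rw [← Finsupp.smul_single_one, map_smul]
    refine Submodule.smul_mem _ a ?_
    have : identities J κ ≤ (identities J κ).comap (opLin K o κ (Finsupp.single s 1)) := by
      refine Submodule.span_le.2 ?_
      rintro _ ⟨ι, _, f, p, hp, rfl⟩
      rw [SetLike.mem_coe, Submodule.mem_comap, ← bindLin_graft_one]
      exact bindLin_mem_identities _ (J.graft_mem_right _ _ hp)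
    exact this hy

theorem opLin_mem_identities_left {κ : Type} (o : Ω) {x : Term Ω κ →₀ K} (y : Term Ω κ →₀ K)
    (hx : x ∈ identities J κ) : opLin K o κ x y ∈ identities J κ := by
  induction y using Finsupp.induction_linear with
  | zero => simp
  | add y y' hy hy' =>
    rw [map_add]
    exact add_mem hy hy'
  | single s a =>
    rw [← Finsupp.smul_single_one, map_smul]
    refine Submodule.smul_mem _ a ?_
    have : identities J κ ≤
        (identities J κ).comap ((opLin K o κ).flip (Finsupp.single s 1)) := by
      refine Submodule.span_le.2 ?_
      rintro _ ⟨ι, _, f, p, hp, rfl⟩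
      rw [SetLike.mem_coe, Submodule.mem_comap, LinearMap.flip_apply, ← bindLin_graft_one_right]
      exact bindLin_mem_identities _ (J.graft_mem_left _ _ hp)
    exact this hx

variable (J)

/-- The free algebra over the quotient of a free operad by an ideal. -/
abbrev FreeAlg (κ : Type) : Type u := (Term Ω κ →₀ K) ⧸ identities J κ

namespace FreeAlg

variable {κ : Type}

/-- The operations of the free algebra. -/
noncomputable def op (o : Ω) : FreeAlg J κ →ₗ[K] FreeAlg J κ →ₗ[K] FreeAlg J κ :=
  quotBilin _ _ _ (opLin K o κ) (fun _ hx y => opLin_mem_identities_left o y hx)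
    fun x _ hy => opLin_mem_identities_right o x hy

/-- The class of an expression in the free algebra. -/
noncomputable def mk (t : Term Ω κ) : FreeAlg J κ :=
  Submodule.Quotient.mk (Finsupp.single t 1)

theorem op_mk (o : Ω) (s t : Term Ω κ) : op J o (mk J s) (mk J t) = mk J (.op o s t) := by
  refine (quotBilin_mk _ _ _ _ _ _ _ _).trans ?_
  rw [opLin_single, mul_one, mk]

/-- Substitution of expressions for the inputs of an operation of the free operad. -/
noncomputable def subst {ι : Type} [Finite ι] (σ : ι → Term Ω κ) :
    (free K Ω).obj ι →ₗ[K] FreeAlg J κ :=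
  (identities J κ).mkQ ∘ₗ bindLin σ

theorem subst_mono {ι : Type} [Finite ι] (σ : ι → Term Ω κ) (t : MTerm Ω ι) :
    subst J σ (mono K t) = mk J (t.1.bind σ) := by
  simp only [subst, LinearMap.comp_apply, bindLin_mono]
  rfl

variable {J}

theorem subst_eq_zero {ι : Type} [Finite ι] (σ : ι → Term Ω κ) {p : (free K Ω).obj ι}
    (hp : p ∈ J.carrier ι) : subst J σ p = 0 :=
  (Submodule.Quotient.mk_eq_zero _).2 (bindLin_mem_identities σ hp)

@[elab_as_elim]
theorem induction {p : FreeAlg J κ → Prop} (x : FreeAlg J κ) (zero : p 0) (mk : ∀ t, p (mk J t))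
    (add : ∀ x y, p x → p y → p (x + y)) (smul : ∀ (a : K) x, p x → p (a • x)) : p x := by
  obtain ⟨x, rfl⟩ := Submodule.Quotient.mk_surjective _ x
  induction x using Finsupp.induction_linear with
  | zero => exact zero
  | add x y hx hy => exact add _ _ hx hy
  | single t a =>
    have := smul a _ (mk t)
    rwa [FreeAlg.mk, ← Submodule.Quotient.mk_smul, Finsupp.smul_single_one] at this

open Classical in
variable (J) in
/-- The multilinear part of an element of the free algebra. -/
noncomputable def multilinearPart [Finite κ] :
    FreeAlg J κ →ₗ[K] (free K Ω).obj κ ⧸ J.carrier κ :=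
  (identities J κ).liftQ (Finsupp.linearCombination K fun t : Term Ω κ =>
    if h : t.IsMultilinear then (J.carrier κ).mkQ (mono K ⟨t, h⟩) else 0) <| by
    refine Submodule.span_le.2 ?_
    rintro _ ⟨ι, _, f, p, hp, rfl⟩
    change Finsupp.linearCombination K _ _ = 0
    -- A bijective renaming is a relabelling, under which `J` is stable. Any other renaming repeats
    -- or omits a variable, so no multilinear expression results.
    by_cases hf : Function.Bijective f
    · have : (Finsupp.linearCombination K fun t : Term Ω κ =>
          if h : t.IsMultilinear then (J.carrier κ).mkQ (mono K ⟨t, h⟩) else 0) ∘ₗ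
          bindLin (fun i => .var (f i)) =
          (J.carrier κ).mkQ ∘ₗ (free K Ω).map (Equiv.ofBijective f hf) :=
        free_hom_ext fun t => by
          have ht := (t.rename (Equiv.ofBijective f hf)).2
          simp only [LinearMap.comp_apply, bindLin_mono, Finsupp.linearCombination_single,
            one_smul, free_map_mono]
          exact dif_pos ht
      refine (LinearMap.congr_fun this p).trans ?_
      exact (Submodule.Quotient.mk_eq_zero _).2 (J.map_mem _ hp)
    · have : (Finsupp.linearCombination K fun t : Term Ω κ =>
          if h : t.IsMultilinear then (J.carrier κ).mkQ (mono K ⟨t, h⟩) else 0) ∘ₗ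
          bindLin (fun i => .var (f i)) = 0 :=
        free_hom_ext fun t => by
          simp only [LinearMap.comp_apply, bindLin_mono, Finsupp.linearCombination_single,
            one_smul, LinearMap.zero_apply]
          refine dif_neg fun h => hf ?_
          change (t.1.rename f).IsMultilinear at h
          rw [Term.IsMultilinear, Term.vars_rename] at h
          refine ⟨fun a b hab => List.inj_on_of_nodup_map h.1 (t.2.2 a) (t.2.2 b) hab,
            fun i => ?_⟩
          obtain ⟨a, _, ha⟩ := List.mem_map.1 (h.2 i)
          exact ⟨a, ha⟩
      exact LinearMap.congr_fun this p

theorem multilinearPart_mk [Finite κ] (t : MTerm Ω κ) :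
    multilinearPart J (mk J t.1) = (J.carrier κ).mkQ (mono K t) := by
  refine (Finsupp.linearCombination_single _ _ _).trans ?_
  rw [one_smul]
  exact dif_pos t.2

/-- The way back from calculations with elements of the free algebra to membership in the operadic
ideal. -/
theorem mem_of_subst_var_eq_zero [Finite κ] {p : (free K Ω).obj κ}
    (h : subst J Term.var p = 0) : p ∈ J.carrier κ := by
  have : multilinearPart J ∘ₗ subst J Term.var = (J.carrier κ).mkQ := free_hom_ext fun t => by
    rw [LinearMap.comp_apply, subst_mono, Term.bind_var, multilinearPart_mk]
  rw [← Submodule.ker_mkQ (J.carrier κ), LinearMap.mem_ker, ← this, LinearMap.comp_apply, h,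
    map_zero]

end FreeAlg

end FreeAlgebra

end SymOperad

namespace SymOperad

/-! ### Leading terms, kernels and preimages of ideals. -/

section Leading

variable {K : Type u} [Field K] {P Q : SymOperad K} {f : P.Filtration}

/-- The morphism `Φ` to the associated graded operad sends `x` to the class in degree `k` of its
image under `Ψ`. -/
def IsLeading (Φ : Hom Q f.gr) (Ψ : Hom Q P) (k : ℕ) {ι : Type} [Finite ι] (x : Q.obj ι) : Prop :=
  ∃ h : Ψ.app ι x ∈ f.F k ι, Φ.app ι x = f.toGr k ι ⟨Ψ.app ι x, h⟩

namespace IsLeading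

variable {Φ : Hom Q f.gr} {Ψ : Hom Q P} {k l : ℕ} {ι κ : Type} [Finite ι] [Finite κ]

theorem add {x y : Q.obj ι} (hx : IsLeading Φ Ψ k x) (hy : IsLeading Φ Ψ k y) :
    IsLeading Φ Ψ k (x + y) := by
  obtain ⟨hx, hx'⟩ := hx
  obtain ⟨hy, hy'⟩ := hy
  refine ⟨by rw [map_add]; exact add_mem hx hy, ?_⟩
  rw [map_add, hx', hy']
  exact (map_add (f.toGr k ι) ⟨_, hx⟩ ⟨_, hy⟩).symm.trans
    (f.toGr_congr rfl _ _ (map_add _ _ _).symm)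

theorem smul {x : Q.obj ι} (a : K) (hx : IsLeading Φ Ψ k x) : IsLeading Φ Ψ k (a • x) := by
  obtain ⟨hx, hx'⟩ := hx
  refine ⟨by rw [map_smul]; exact Submodule.smul_mem _ a hx, ?_⟩
  rw [map_smul, hx']
  exact (map_smul (f.toGr k ι) a ⟨_, hx⟩).symm.trans
    (f.toGr_congr rfl _ _ (map_smul _ _ _).symm)

theorem sub {x y : Q.obj ι} (hx : IsLeading Φ Ψ k x) (hy : IsLeading Φ Ψ k y) :
    IsLeading Φ Ψ k (x - y) := by
  rw [sub_eq_add_neg, ← neg_one_smul K y]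
  exact hx.add (hy.smul _)

theorem one : IsLeading Φ Ψ 0 Q.one := by
  refine ⟨by rw [Ψ.app_one]; exact f.one_mem, ?_⟩
  rw [Φ.app_one]
  exact f.toGr_congr rfl f.one_mem _ Ψ.app_one.symm

theorem map (e : ι ≃ κ) {x : Q.obj ι} (hx : IsLeading Φ Ψ k x) :
    IsLeading Φ Ψ k (Q.map e x) := by
  obtain ⟨hx, hx'⟩ := hx
  refine ⟨by rw [Ψ.app_map]; exact f.map_mem k e hx, ?_⟩
  rw [Φ.app_map, hx']
  exact (f.grMap_toGr k e _ hx).trans (f.toGr_congr rfl _ _ (Ψ.app_map e x).symm)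

theorem comp (i : ι) {x : Q.obj ι} {y : Q.obj κ} (hx : IsLeading Φ Ψ k x)
    (hy : IsLeading Φ Ψ l y) : IsLeading Φ Ψ (k + l) (Q.comp i x y) := by
  obtain ⟨hx, hx'⟩ := hx
  obtain ⟨hy, hy'⟩ := hy
  refine ⟨by rw [Ψ.app_comp]; exact f.comp_mem k l i hx hy, ?_⟩
  rw [Φ.app_comp, hx', hy']
  exact (f.grComp_toGr k l i _ _ hx hy).trans (f.toGr_congr rfl _ _ (Ψ.app_comp i x y).symm)

theorem graft {d : ℕ} {g : Q.obj (Fin 2)} {x : Q.obj ι} {y : Q.obj κ} (hg : IsLeading Φ Ψ d g)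
    (hx : IsLeading Φ Ψ k x) (hy : IsLeading Φ Ψ l y) :
    IsLeading Φ Ψ (d + k + l) (Q.graft g x y) :=
  ((hg.comp _ hx).comp _ hy).map _

theorem app_eq_zero {x : Q.obj ι} (hx : IsLeading Φ Ψ k x) (h : Ψ.app ι x ∈ f.F (k + 1) ι) :
    Φ.app ι x = 0 := by
  obtain ⟨hx, hx'⟩ := hx
  rw [hx']
  exact f.toGr_eq_zero _ h

end IsLeading

/-- The kernel of a morphism of operads. -/
def Hom.ker (F : Hom P Q) : P.Ideal where
  carrier ι _ := LinearMap.ker (F.app ι)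
  map_mem e x hx := by
    rw [LinearMap.mem_ker] at hx ⊢
    rw [F.app_map, hx, map_zero]
  comp_mem_left i x y hx := by
    rw [LinearMap.mem_ker] at hx ⊢
    rw [F.app_comp, hx, map_zero, LinearMap.zero_apply]
  comp_mem_right i x y hy := by
    rw [LinearMap.mem_ker] at hy ⊢
    rw [F.app_comp, hy, map_zero]

/-- The preimage of an ideal under a morphism of operads. -/
def Ideal.comap (F : Hom P Q) (I : Q.Ideal) : P.Ideal where
  carrier ι _ := (I.carrier ι).comap (F.app ι)
  map_mem e x hx := by
    rw [Submodule.mem_comap] at hx ⊢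
    rw [F.app_map]
    exact I.map_mem e hx
  comp_mem_left i x y hx := by
    rw [Submodule.mem_comap] at hx ⊢
    rw [F.app_comp]
    exact I.comp_mem_left i _ hx
  comp_mem_right i x y hy := by
    rw [Submodule.mem_comap] at hy ⊢
    rw [F.app_comp]
    exact I.comp_mem_right i _ hy

end Leading

/-! ### The degree of an expression -/

/-- The degree of the two operations of transposed Poisson algebras. -/
def TPOp.degree : TPOp → ℕ
  | .mul => 0
  | .bracket => 1

/-- The number of brackets in an expression. -/
def Term.degree {ι : Type} : Term TPOp ι → ℕ
  | .var _ => 0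
  | .op o s t => o.degree + s.degree + t.degree

theorem Term.degree_rename {ι κ : Type} (t : Term TPOp ι) (f : ι → κ) :
    (t.rename f).degree = t.degree := by
  induction t with
  | var i => rfl
  | op o s t hs ht =>
    change o.degree + (s.rename f).degree + (t.rename f).degree = _
    rw [hs, ht]
    rfl

/-! ### Interpreting the bracket as a commutator. -/

section Commutator

variable {K : Type u} [Field K]

theorem bindLin_graft_mono {Ω ι ι' κ : Type} [Finite ι] [Finite ι'] (σ : ι ⊕ ι' → Term Ω κ)
    (r : MTerm Ω (Fin 2)) (s : MTerm Ω ι) (t : MTerm Ω ι') :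
    bindLin σ ((free K Ω).graft (mono K r) (mono K s) (mono K t)) =
      Finsupp.single (r.1.bind ![s.1.bind (σ ∘ Sum.inl), t.1.bind (σ ∘ Sum.inr)]) 1 := by
  rw [graft_apply, bindLin_map,
    bindLin_comp_mono _ (Sum.elim (fun _ => t.1.bind (σ ∘ Sum.inr)) (σ ∘ Sum.inl)),
    bindLin_comp_mono _ ![s.1.bind (σ ∘ Sum.inl), t.1.bind (σ ∘ Sum.inr)], bindLin_mono]
  · rfl
  · intro j hj
    obtain rfl : j = 1 := congrArg Subtype.val (subtype_ne_zero_eq_one ⟨j, hj⟩)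
    rfl
  · rfl
  · rintro (j | j) hj
    · exact (hj (congrArg Sum.inl (subtype_ne_zero_eq_one j))).elim
    · rfl

/-- The product and the commutator in the free operad on one binary operation. -/
noncomputable def commGen (K : Type u) [Field K] : TPOp → (free K Unit).obj (Fin 2)
  | .mul => gen K ()
  | .bracket => gen K () - (free K Unit).map (Equiv.swap 0 1) (gen K ())

/-- The morphism that interprets the product and the bracket as the product and the commutator
of the free operad on one binary operation. -/
noncomputable def commHom (K : Type u) [Field K] : Hom (free K TPOp) (free K Unit) :=
  lift _ (commGen K)

theorem commHom_gen (o : TPOp) : (commHom K).app _ (gen K o) = commGen K o := lift_gen _ _ o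

variable (J : (free K Unit).Ideal)

/-- The product and the commutator in the free algebra. -/
noncomputable def commOp {κ : Type} : TPOp → FreeAlg J κ → FreeAlg J κ → FreeAlg J κ
  | .mul, x, y => FreeAlg.op J () x y
  | .bracket, x, y => FreeAlg.op J () x y - FreeAlg.op J () y x

/-- The value of an expression when the product and the bracket are interpreted as the product
and the commutator. -/
noncomputable def commEval {ι κ : Type} (σ : ι → Term Unit κ) : Term TPOp ι → FreeAlg J κ
  | .var i => FreeAlg.mk J (σ i)
  | .op o s t => commOp J o (commEval σ s) (commEval σ t)

theorem commEval_rename {ι ι' κ : Type} (σ : ι' → Term Unit κ) (f : ι → ι') (t : Term TPOp ι) :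
    commEval J σ (t.rename f) = commEval J (σ ∘ f) t := by
  induction t with
  | var i => rfl
  | op o s t hs ht =>
    change commEval J σ (.op o (s.rename f) (t.rename f)) = _
    simp only [commEval, hs, ht]

theorem subst_graft_gen {ι ι' κ : Type} [Finite ι] [Finite ι'] (σ : ι ⊕ ι' → Term Unit κ)
    (x : (free K Unit).obj ι) (y : (free K Unit).obj ι') :
    FreeAlg.subst J σ ((free K Unit).graft (gen K ()) x y) =
      FreeAlg.op J () (FreeAlg.subst J (σ ∘ Sum.inl) x) (FreeAlg.subst J (σ ∘ Sum.inr) y) := by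
  have : ((free K Unit).graft (gen K ())).compr₂ (FreeAlg.subst J σ) =
      (FreeAlg.op J ()).compl₁₂ (FreeAlg.subst J (σ ∘ Sum.inl))
        (FreeAlg.subst J (σ ∘ Sum.inr)) := free_hom_ext fun t => free_hom_ext fun s => by
    simp only [LinearMap.compr₂_apply, LinearMap.compl₁₂_apply, FreeAlg.subst_mono,
      FreeAlg.op_mk]
    rw [FreeAlg.subst, LinearMap.comp_apply, gen, bindLin_graft_mono]
    rfl
  exact LinearMap.congr_fun (LinearMap.congr_fun this x) y

theorem subst_graft_map_swap_gen {ι ι' κ : Type} [Finite ι] [Finite ι']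
    (σ : ι ⊕ ι' → Term Unit κ) (x : (free K Unit).obj ι) (y : (free K Unit).obj ι') :
    FreeAlg.subst J σ
        ((free K Unit).graft ((free K Unit).map (Equiv.swap 0 1) (gen K ())) x y) =
      FreeAlg.op J () (FreeAlg.subst J (σ ∘ Sum.inr) y) (FreeAlg.subst J (σ ∘ Sum.inl) x) := by
  have : ((free K Unit).graft ((free K Unit).map (Equiv.swap 0 1) (gen K ()))).compr₂
      (FreeAlg.subst J σ) = (FreeAlg.op J ()).flip.compl₁₂ (FreeAlg.subst J (σ ∘ Sum.inl))
        (FreeAlg.subst J (σ ∘ Sum.inr)) := free_hom_ext fun t => free_hom_ext fun s => by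
    simp only [LinearMap.compr₂_apply, LinearMap.compl₁₂_apply, LinearMap.flip_apply,
      FreeAlg.subst_mono, FreeAlg.op_mk]
    rw [FreeAlg.subst, LinearMap.comp_apply, gen, free_map_mono, bindLin_graft_mono]
    rfl
  exact LinearMap.congr_fun (LinearMap.congr_fun this x) y

theorem subst_map {Ω ι ι' κ : Type} [Finite ι] [Finite ι'] (J : (free K Ω).Ideal)
    (σ : ι' → Term Ω κ) (e : ι ≃ ι') (p : (free K Ω).obj ι) :
    FreeAlg.subst J σ ((free K Ω).map e p) = FreeAlg.subst J (σ ∘ e) p := by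
  rw [FreeAlg.subst, LinearMap.comp_apply, bindLin_map]
  rfl

theorem graft_sub {P : SymOperad K} {ι κ : Type} [Finite ι] [Finite κ] (g h : P.obj (Fin 2))
    (x : P.obj ι) (y : P.obj κ) :
    P.graft (g - h) x y = P.graft g x y - P.graft h x y := by
  simp [graft_apply]

theorem subst_graft_commGen {ι ι' κ : Type} [Finite ι] [Finite ι'] (o : TPOp)
    (σ : ι ⊕ ι' → Term Unit κ) (x : (free K Unit).obj ι) (y : (free K Unit).obj ι') :
    FreeAlg.subst J σ ((free K Unit).graft (commGen K o) x y) =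
      commOp J o (FreeAlg.subst J (σ ∘ Sum.inl) x) (FreeAlg.subst J (σ ∘ Sum.inr) y) := by
  cases o with
  | mul => rw [commGen, commOp, subst_graft_gen]
  | bracket => rw [commGen, commOp, graft_sub, map_sub, subst_graft_gen, subst_graft_map_swap_gen]

theorem subst_commHom_node {ι ι' κ : Type} [Finite ι] [Finite ι'] (o : TPOp) (s : MTerm TPOp ι)
    (t : MTerm TPOp ι')
    (hs : ∀ σ : ι → Term Unit κ,
      FreeAlg.subst J σ ((commHom K).app _ (mono K s)) = commEval J σ s.1)
    (ht : ∀ σ : ι' → Term Unit κ,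
      FreeAlg.subst J σ ((commHom K).app _ (mono K t)) = commEval J σ t.1)
    (σ : ι ⊕ ι' → Term Unit κ) :
    FreeAlg.subst J σ ((commHom K).app _ (mono K (MTerm.node o s t))) =
      commEval J σ (MTerm.node o s t).1 := by
  rw [← graft_gen_mono, Hom.app_graft, commHom_gen, subst_graft_commGen, hs, ht,
    ← commEval_rename, ← commEval_rename]
  rfl

theorem subst_commHom_tree (s : Tree TPOp) {κ : Type} (σ : s.Leaf → Term Unit κ) :
    FreeAlg.subst J σ ((commHom K).app _ (mono K s.mterm)) = commEval J σ s.mterm.1 := by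
  induction s with
  | leaf =>
    have h : (commHom K).app Unit (mono K MTerm.one) = mono K MTerm.one := (commHom K).app_one
    exact (congrArg (FreeAlg.subst J σ) h).trans (FreeAlg.subst_mono J σ _)
  | node o l r hl hr => exact subst_commHom_node J o _ _ hl hr σ

/-- This turns relations between operations into equations between products and commutators of
elements, to which the Novikov identities apply directly. -/
theorem subst_commHom_mono {ι κ : Type} [Finite ι] (t : MTerm TPOp ι) (σ : ι → Term Unit κ) :
    FreeAlg.subst J σ ((commHom K).app _ (mono K t)) = commEval J σ t.1 := by
  obtain ⟨s, e, rfl⟩ := Tree.exists_eq_mterm_rename t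
  rw [← free_map_mono, Hom.app_map, subst_map, subst_commHom_tree, ← commEval_rename]
  rfl

end Commutator

/-! ### The transposed Poisson relations hold in the associated graded operad. -/

section Novikov

variable {K : Type u} [Field K]

/-- The composite of two morphisms. -/
def Hom.trans {P Q R : SymOperad K} (F : Hom P Q) (G : Hom Q R) : Hom P R where
  app ι _ := G.app ι ∘ₗ F.app ι
  app_map e x := by simp [F.app_map, G.app_map]
  app_one := by simp [F.app_one, G.app_one]
  app_comp i x y := by simp [F.app_comp, G.app_comp]

/-- The interpretation of the product and the bracket in the Novikov operad as the product
and the commutator. -/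
noncomputable def novHom (K : Type u) [Field K] : Hom (free K TPOp) (Nov K) :=
  (commHom K).trans (novProj K)

theorem novHom_gen_mul : (novHom K).app _ (gen K .mul) = novMul K := by
  change (novProj K).app _ ((commHom K).app _ (gen K .mul)) = _
  rw [commHom_gen, commGen, novProj_gen]

theorem novHom_gen_bracket : (novHom K).app _ (gen K .bracket) = novCommutator K := by
  change (novProj K).app _ ((commHom K).app _ (gen K .bracket)) = _
  rw [commHom_gen, commGen, map_sub, Hom.app_map, novProj_gen, novCommutator]

variable {Φ : Hom (free K TPOp) (grNov K)}

theorem isLeading_gen (hΦ : IsCanonical Φ) (o : TPOp) :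
    IsLeading (f := novFiltration K) Φ (novHom K) o.degree (gen K o) := by
  obtain ⟨h1, h2⟩ := isCanonical_iff.1 hΦ
  cases o with
  | mul =>
    refine ⟨(commutatorIdeal K).mem_pow_zero _, h1.trans ?_⟩
    exact (novFiltration K).toGr_congr rfl _ _ novHom_gen_mul.symm
  | bracket =>
    refine ⟨(commutatorIdeal K).mem_pow_one ?_, h2.trans ?_⟩
    · rw [novHom_gen_bracket]
      exact novCommutator_mem K
    · exact (novFiltration K).toGr_congr rfl _ _ novHom_gen_bracket.symm

theorem isLeading_node (hΦ : IsCanonical Φ) {ι κ : Type} [Finite ι] [Finite κ] (o : TPOp)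
    (s : MTerm TPOp ι) (t : MTerm TPOp κ)
    (hs : IsLeading (f := novFiltration K) Φ (novHom K) s.1.degree (mono K s))
    (ht : IsLeading (f := novFiltration K) Φ (novHom K) t.1.degree (mono K t)) :
    IsLeading (f := novFiltration K) Φ (novHom K) (MTerm.node o s t).1.degree
      (mono K (MTerm.node o s t)) := by
  have hd : (MTerm.node o s t).1.degree = o.degree + s.1.degree + t.1.degree := by
    change o.degree + (Term.rename _ _).degree + (Term.rename _ _).degree = _
    rw [Term.degree_rename, Term.degree_rename]
  rw [← graft_gen_mono, hd]
  exact (isLeading_gen hΦ o).graft hs ht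

theorem isLeading_tree (hΦ : IsCanonical Φ) (s : Tree TPOp) :
    IsLeading (f := novFiltration K) Φ (novHom K) s.mterm.1.degree (mono K s.mterm) := by
  induction s with
  | leaf => exact IsLeading.one
  | node o l r hl hr => exact isLeading_node hΦ o _ _ hl hr

/-- Each bracket uses one commutator, and the agreement of `Φ` with leading classes on generators
survives composition, where degrees add. -/
theorem isLeading_mono (hΦ : IsCanonical Φ) {ι : Type} [Finite ι] {k : ℕ} {t : MTerm TPOp ι}
    (ht : t.1.degree = k) : IsLeading (f := novFiltration K) Φ (novHom K) k (mono K t) := by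
  subst ht
  obtain ⟨s, e, rfl⟩ := Tree.exists_eq_mterm_rename t
  rw [← free_map_mono]
  have : (s.mterm.rename e).1.degree = s.mterm.1.degree := Term.degree_rename _ _
  rw [this]
  exact (isLeading_tree hΦ s).map e

/-- The ideal of the relations of the Novikov operad. -/
noncomputable abbrev novIdeal (K : Type u) [Field K] : (free K Unit).Ideal :=
  Ideal.span (novRelations K)

theorem app_eq_zero_of_subst_novIdeal {k : ℕ} {ι : Type} [Finite ι]
    {x : (free K TPOp).obj ι} (hx : IsLeading (f := novFiltration K) Φ (novHom K) k x)
    (h : FreeAlg.subst (novIdeal K) Term.var ((commHom K).app ι x) = 0) : Φ.app ι x = 0 := by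
  refine hx.app_eq_zero ?_
  have : (novHom K).app ι x = 0 :=
    (Submodule.Quotient.mk_eq_zero _).2 (FreeAlg.mem_of_subst_var_eq_zero h)
  rw [this]
  exact zero_mem _

/-- The preimage of the commutator ideal in the free operad. -/
noncomputable abbrev commutatorPreideal (K : Type u) [Field K] : (free K Unit).Ideal :=
  (commutatorIdeal K).comap (novProj K)

/-- In degree 0 it is enough that a relation holds modulo commutators, since then it lies in the
first step of the filtration. -/
theorem app_eq_zero_of_subst_commutatorPreideal {ι : Type} [Finite ι]
    {x : (free K TPOp).obj ι} (hx : IsLeading (f := novFiltration K) Φ (novHom K) 0 x)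
    (h : FreeAlg.subst (commutatorPreideal K) Term.var ((commHom K).app ι x) = 0) :
    Φ.app ι x = 0 := by
  refine hx.app_eq_zero ((commutatorIdeal K).mem_pow_one ?_)
  exact FreeAlg.mem_of_subst_var_eq_zero h

theorem novRelations_subset_novIdeal (n : ℕ) :
    novRelations K n ⊆ (novIdeal K).carrier (Fin n) := Ideal.subset_span _ n

theorem novRelations_subset_commutatorPreideal (n : ℕ) :
    novRelations K n ⊆ (commutatorPreideal K).carrier (Fin n) := fun x hx => by
  have : (novProj K).app _ x = 0 :=
    (Submodule.Quotient.mk_eq_zero _).2 (novRelations_subset_novIdeal n hx)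
  change (novProj K).app _ x ∈ (commutatorIdeal K).carrier _
  rw [this]
  exact zero_mem _

section Identities

variable {J : (free K Unit).Ideal} (hJ : ∀ n, novRelations K n ⊆ J.carrier (Fin n)) {κ : Type}
  (a b c : Term Unit κ)

include hJ

theorem nov_left_symm :
    (FreeAlg.op J () (FreeAlg.op J () (.mk J a) (.mk J b)) (.mk J c) -
      FreeAlg.op J () (FreeAlg.op J () (.mk J b) (.mk J a)) (.mk J c)) -
    (FreeAlg.op J () (.mk J a) (FreeAlg.op J () (.mk J b) (.mk J c)) -
      FreeAlg.op J () (.mk J b) (FreeAlg.op J () (.mk J a) (.mk J c))) = 0 := by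
  have := FreeAlg.subst_eq_zero ![a, b, c] (hJ 3 (Or.inl rfl))
  simpa only [monomial_eq_mono, map_sub, FreeAlg.subst_mono, Term.bind, FreeAlg.op_mk]

theorem nov_right_comm :
    FreeAlg.op J () (FreeAlg.op J () (.mk J a) (.mk J b)) (.mk J c) -
      FreeAlg.op J () (FreeAlg.op J () (.mk J a) (.mk J c)) (.mk J b) = 0 := by
  have := FreeAlg.subst_eq_zero ![a, b, c] (hJ 3 (Or.inr rfl))
  simpa only [monomial_eq_mono, map_sub, FreeAlg.subst_mono, Term.bind, FreeAlg.op_mk]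

end Identities

theorem op_comm_commutatorPreideal {κ : Type} (a b : Term Unit κ) :
    FreeAlg.op (commutatorPreideal K) () (.mk _ a) (.mk _ b) =
      FreeAlg.op (commutatorPreideal K) () (.mk _ b) (.mk _ a) := by
  have h : gen K () - (free K Unit).map (Equiv.swap 0 1) (gen K ()) ∈
      (commutatorPreideal K).carrier (Fin 2) := by
    change (novProj K).app _ _ ∈ (commutatorIdeal K).carrier (Fin 2)
    rw [map_sub, Hom.app_map, novProj_gen]
    exact novCommutator_mem K
  have := FreeAlg.subst_eq_zero ![a, b] h
  rw [map_sub, subst_map, gen, FreeAlg.subst_mono, FreeAlg.subst_mono, sub_eq_zero] at this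
  rw [FreeAlg.op_mk, FreeAlg.op_mk]
  exact this

theorem tpoisIdeal_le_ker (hΦ : IsCanonical Φ) (ι : Type) [Finite ι] :
    (tpoisIdeal K).carrier ι ≤ LinearMap.ker (Φ.app ι) := by
  intro x hx
  refine hx Φ.ker fun n => ?_
  match n with
  | 2 =>
    rintro _ (rfl | rfl)
    · change Φ.app _ _ = 0
      simp only [monomial_eq_mono]
      refine app_eq_zero_of_subst_commutatorPreideal
        ((isLeading_mono hΦ (by rfl)).sub (isLeading_mono hΦ (by rfl))) ?_
      simp only [map_sub, subst_commHom_mono, commEval, commOp]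
      rw [op_comm_commutatorPreideal, sub_self]
    · change Φ.app _ _ = 0
      simp only [monomial_eq_mono]
      refine app_eq_zero_of_subst_novIdeal (k := 1)
        ((isLeading_mono hΦ (by rfl)).add (isLeading_mono hΦ (by rfl))) ?_
      simp only [map_add, subst_commHom_mono, commEval, commOp]
      abel
  | 3 =>
    rintro _ (rfl | rfl | rfl)
    · change Φ.app _ _ = 0
      simp only [monomial_eq_mono]
      refine app_eq_zero_of_subst_commutatorPreideal
        ((isLeading_mono hΦ (by rfl)).sub (isLeading_mono hΦ (by rfl))) ?_
      simp only [map_sub, subst_commHom_mono, commEval, commOp]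
      -- Modulo commutators `(x ∘ y) ∘ z = (y ∘ x) ∘ z` and `x ∘ (y ∘ z) = (y ∘ z) ∘ x`; right
      -- commutativity identifies the two.
      have h1 := nov_right_comm (J := commutatorPreideal K) novRelations_subset_commutatorPreideal
        (Term.var 1 : Term Unit (Fin 3)) (Term.var 0) (Term.var 2)
      have h2 : FreeAlg.op (commutatorPreideal K) () (.mk _ (.var 0))
          (FreeAlg.op (commutatorPreideal K) () (.mk _ (.var 1)) (.mk _ (.var 2))) =
          FreeAlg.op (commutatorPreideal K) ()
          (FreeAlg.op (commutatorPreideal K) () (.mk _ (.var 1)) (.mk _ (.var (2 : Fin 3))))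
          (.mk _ (.var 0)) := by
        rw [FreeAlg.op_mk, op_comm_commutatorPreideal]
      rw [h2, op_comm_commutatorPreideal (K := K) (.var 0) (.var 1)]
      exact h1
    · change Φ.app _ _ = 0
      simp only [monomial_eq_mono]
      refine app_eq_zero_of_subst_novIdeal (k := 2)
        (((isLeading_mono hΦ (by rfl)).add (isLeading_mono hΦ (by rfl))).add
          (isLeading_mono hΦ (by rfl))) ?_
      simp only [map_add, subst_commHom_mono, commEval, commOp, map_sub, LinearMap.sub_apply]
      have h := fun i j k : Fin 3 => nov_left_symm (J := novIdeal K) novRelations_subset_novIdeal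
        (.var i) (.var j) (.var k)
      -- Left-symmetric algebras are Lie-admissible: the Jacobi identity is the cyclic sum of left
      -- symmetry.
      linear_combination (norm := module) h 0 1 2 + h 1 2 0 + h 2 0 1
    · change Φ.app _ _ = 0
      simp only [monomial_eq_mono]
      refine app_eq_zero_of_subst_novIdeal (k := 1)
        (((isLeading_mono hΦ (by rfl)).smul 2).sub
          ((isLeading_mono hΦ (by rfl)).add (isLeading_mono hΦ (by rfl)))) ?_
      simp only [map_add, map_smul, subst_commHom_mono, commEval, commOp, map_sub,
        LinearMap.sub_apply]
      have h := fun i j k : Fin 3 => nov_left_symm (J := novIdeal K) novRelations_subset_novIdeal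
        (.var i) (.var j) (.var k)
      have h' := fun i j k : Fin 3 => nov_right_comm (J := novIdeal K)
        novRelations_subset_novIdeal (.var i) (.var j) (.var k)
      -- Left symmetry accounts for one copy of the commutator times `z` and the terms `x ∘ (y ∘
      -- z)`, `y ∘ (x ∘ z)`; right commutativity matches the other copy with `(x ∘ z) ∘ y` and `(y ∘
      -- z) ∘ x`.
      linear_combination (norm := module) h 0 1 2 + h' 0 1 2 + h' 1 2 0
  | 0 | 1 | n + 4 => exact Set.empty_subset _

end Novikov

end SymOperad

namespace SymOperad

/-! ### Straightening expressions in at most four letters into words. -/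

section TransposedPoisson

variable {K : Type u} [Field K] {A : Type u} [AddCommGroup A] [Module K A]

/-- The identities of transposed Poisson algebras for a product `m` and a bracket `b`. -/
structure IsTransposedPoisson (m b : A →ₗ[K] A →ₗ[K] A) : Prop where
  comm : ∀ x y, m x y = m y x
  assoc : ∀ x y z, m (m x y) z = m x (m y z)
  anti : ∀ x y, b x y = -b y x
  jacobi : ∀ x y z, b (b x y) z + b (b y z) x + b (b z x) y = 0
  compat : ∀ x y z, (2 : K) • m (b x y) z = b x (m y z) + b (m x z) y

/-- The operation `[a₁, [a₂, … [aₖ, aₖ₊₁ ⋯ aₙ]]]`, which is zero for `k ≥ n`. -/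
def word (m b : A →ₗ[K] A →ₗ[K] A) : ℕ → List A → A
  | _, [] => 0
  | 0, [a] => a
  | _ + 1, [_] => 0
  | 0, a :: c :: l => m a (word m b 0 (c :: l))
  | k + 1, a :: c :: l => b a (word m b k (c :: l))

theorem word_zero_cons (m b : A →ₗ[K] A →ₗ[K] A) (a : A) {l : List A} (hl : l ≠ []) :
    word m b 0 (a :: l) = m a (word m b 0 l) := by
  cases l with
  | nil => exact (hl rfl).elim
  | cons c l => rfl

theorem word_succ_cons (m b : A →ₗ[K] A →ₗ[K] A) (k : ℕ) (a : A) (l : List A) :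
    word m b (k + 1) (a :: l) = b a (word m b k l) := by
  cases l with
  | nil => cases k <;> simp [word]
  | cons c l => rfl

namespace IsTransposedPoisson

variable {m b : A →ₗ[K] A →ₗ[K] A} (h : IsTransposedPoisson m b)

include h

theorem left_comm (x y z : A) : m x (m y z) = m y (m x z) := by
  rw [← h.assoc, h.comm x y, h.assoc]

/-- The form of the Jacobi identity that moves the outermost argument, possibly composite, to the
innermost place. -/
theorem bracket_bracket (x y z : A) : b x (b y z) = b z (b y x) - b y (b z x) := by
  have h1 := h.jacobi x y z
  have h2 := h.anti (b x y) z
  have h3 := h.anti (b y z) x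
  have h4 := h.anti (b z x) y
  have h5 : b z (b x y) = -b z (b y x) := by rw [h.anti x y, map_neg]
  linear_combination (norm := module) -h1 + h2 + h3 + h4 - h5

variable [CharZero K]

/-- The compatibility relation, read as a rule that pushes a factor inside a bracket; it costs a
division by 2. -/
theorem mul_bracket (x y z : A) :
    m x (b y z) = (2⁻¹ : K) • (b y (m z x) - b z (m y x)) := by
  have h1 := h.compat y z x
  have h2 := h.anti (m y x) z
  rw [← h.comm x] at h1
  have h3 : m x (b y z) = (2⁻¹ : K) • (2 : K) • m x (b y z) := by
    rw [smul_smul, inv_mul_cancel₀ two_ne_zero, one_smul]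
  rw [h3, h1, h2, sub_eq_add_neg]

omit [CharZero K] in
-- Four times `[x, y] · z · t` is computed in two ways: multiplying by `z · t` at once, or by `z`
-- and then by `t`.
theorem bracket_mul_mul_add (x y z t : A) :
    b (m x z) (m y t) + b (m x t) (m y z) = b x (m y (m z t)) - b y (m x (m z t)) := by
  have h1 := h.compat x y (m z t)
  have h2 := h.compat x y z
  have h3 := h.compat x (m y z) t
  have h4 := h.compat (m x z) y t
  have h5 := h.anti (m x (m z t)) y
  have h6 : (2 : K) • (2 : K) • m (m (b x y) z) t =
      (2 : K) • (m (b x (m y z)) t + m (b (m x z) y) t) := by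
    rw [← LinearMap.add_apply, ← map_add, ← h2, map_smul, LinearMap.smul_apply]
  rw [h.assoc (b x y), h1, smul_add, smul_add, h3, h4, h.assoc y, h.assoc x, h5] at h6
  linear_combination (norm := module) -h6

/-- Four letters split into two pairs in three ways, and `bracket_mul_mul_add` gives the sum of the
brackets for any two of the splittings. Two of these sums minus the third isolate twice a single
bracket. -/
theorem bracket_mul_mul (x y z t : A) :
    b (m x y) (m z t) = (2⁻¹ : K) • (b x (m y (m z t)) + b y (m x (m z t)) -
      b z (m x (m y t)) - b t (m x (m y z))) := by
  have h1 := h.bracket_mul_mul_add x y z t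
  have h2 := h.bracket_mul_mul_add x z y t
  have h3 := h.bracket_mul_mul_add x t y z
  have h4 : m z y = m y z := h.comm z y
  have h5 : b (m x z) (m t y) = b (m x z) (m y t) := by rw [h.comm t]
  have h6 : b (m x y) (m t z) = b (m x y) (m z t) := by rw [h.comm t]
  rw [h4, h.left_comm z y t] at h2
  rw [h5, h6, h.left_comm t y z, h.comm t z] at h3
  have h7 : (2 : K) • b (m x y) (m z t) = b x (m y (m z t)) + b y (m x (m z t)) -
      b z (m x (m y t)) - b t (m x (m y z)) := by
    linear_combination (norm := module) h2 + h3 - h1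
  rw [← h7, smul_smul, inv_mul_cancel₀ two_ne_zero, one_smul]

end IsTransposedPoisson

/-! ### The span of the words -/

/-- Writing lists as sums of singletons lets `abel` verify permutations of explicit lists of
letters. -/
theorem perm_of_sum_singleton {κ : Type} {l l' : List κ}
    (h : (l.map fun i => ({i} : Multiset κ)).sum = (l'.map fun i => ({i} : Multiset κ)).sum) :
    l.Perm l' := by
  have key : ∀ l : List κ, (l.map fun i => ({i} : Multiset κ)).sum = (l : Multiset κ) := by
    intro l
    induction l with
    | nil => rfl
    | cons i l ih =>
      rw [List.map_cons, List.sum_cons, ih, Multiset.singleton_add, Multiset.cons_coe]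
  rw [key, key] at h
  exact Multiset.coe_eq_coe.1 h

/-- The span of the words in the elements `x i`, `i ∈ l`, in any order. -/
def wordSpan (m b : A →ₗ[K] A →ₗ[K] A) {κ : Type} (x : κ → A) (l : List κ) (k : ℕ) :
    Submodule K A :=
  Submodule.span K {y | ∃ l' : List κ, l'.Perm l ∧ y = word m b k (l'.map x)}

variable {m b : A →ₗ[K] A →ₗ[K] A} {κ : Type} {x : κ → A}

theorem word_mem_wordSpan {l l' : List κ} (k : ℕ)
    (h : (l'.map fun i => ({i} : Multiset κ)).sum = (l.map fun i => ({i} : Multiset κ)).sum := by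
      simp only [List.map, List.sum_cons, List.sum_nil]; abel) :
    word m b k (l'.map x) ∈ wordSpan m b x l k :=
  Submodule.subset_span ⟨l', perm_of_sum_singleton h, rfl⟩

theorem wordSpan_perm {l l' : List κ} (h : l.Perm l') (k : ℕ) :
    wordSpan m b x l k = wordSpan m b x l' k := by
  rw [wordSpan, wordSpan]
  congr 1
  ext y
  exact ⟨fun ⟨r, hr, hy⟩ => ⟨r, hr.trans h, hy⟩, fun ⟨r, hr, hy⟩ => ⟨r, hr.trans h.symm, hy⟩⟩

theorem apply_mem_of_mem_wordSpan (B : A →ₗ[K] A →ₗ[K] A) {l₁ l₂ : List κ} {k₁ k₂ : ℕ} {u v : A}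
    {S : Submodule K A} (hu : u ∈ wordSpan m b x l₁ k₁) (hv : v ∈ wordSpan m b x l₂ k₂)
    (H : ∀ r₁ r₂ : List κ, r₁.Perm l₁ → r₂.Perm l₂ →
      B (word m b k₁ (r₁.map x)) (word m b k₂ (r₂.map x)) ∈ S) : B u v ∈ S := by
  rw [wordSpan] at hu hv
  induction hu, hv using Submodule.span_induction₂ with
  | mem_mem u v hu hv =>
    obtain ⟨r₁, h₁, rfl⟩ := hu
    obtain ⟨r₂, h₂, rfl⟩ := hv
    exact H r₁ r₂ h₁ h₂
  | zero_left y hy => simp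
  | zero_right x hx => simp
  | add_left x x' y _ _ _ h h' => simpa using add_mem h h'
  | add_right x y y' _ _ _ h h' => simpa using add_mem h h'
  | smul_left c x y _ _ h => simpa using Submodule.smul_mem _ c h
  | smul_right c x y _ _ h => simpa using Submodule.smul_mem _ c h

theorem bracket_word_mem_of_singleton (i : κ) (r : List κ) (k : ℕ) :
    b (x i) (word m b k (r.map x)) ∈ wordSpan m b x (i :: r) (k + 1) := by
  rw [← word_succ_cons, ← List.map_cons]
  exact word_mem_wordSpan _ rfl

namespace IsTransposedPoisson

variable (h : IsTransposedPoisson m b) [CharZero K]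

include h

theorem mul_word_mem_of_singleton (i : κ) (r : List κ) (hr : r ≠ []) (hr' : r.length ≤ 3)
    (k : ℕ) : m (x i) (word m b k (r.map x)) ∈ wordSpan m b x (i :: r) k := by
  cases k with
  | zero =>
    rw [← word_zero_cons m b (x i) (by simpa using hr), ← List.map_cons]
    exact word_mem_wordSpan 0 rfl
  | succ k =>
    match r, hr' with
    | [], _ => exact (hr rfl).elim
    | [p], _ => simp [word]
    | [p, q], _ =>
      match k with
      | 0 =>
        change m (x i) (b (x p) (x q)) ∈ _
        rw [h.mul_bracket]
        refine Submodule.smul_mem _ _ (sub_mem ?_ ?_)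
        · exact word_mem_wordSpan (l' := [p, q, i]) 1
        · exact word_mem_wordSpan (l' := [q, p, i]) 1
      | k + 1 => simp [word]
    | [p, q, r], _ =>
      match k with
      | 0 =>
        change m (x i) (b (x p) (m (x q) (x r))) ∈ _
        -- Pushing the letter inside also creates a bracket of two products, which `bracket_mul_mul`
        -- resolves.
        rw [h.mul_bracket, h.bracket_mul_mul, h.assoc]
        refine Submodule.smul_mem _ _ (sub_mem ?_ (Submodule.smul_mem _ _
          (sub_mem (sub_mem (add_mem ?_ ?_) ?_) ?_)))
        · exact word_mem_wordSpan (l' := [p, q, r, i]) 1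
        · exact word_mem_wordSpan (l' := [q, r, p, i]) 1
        · exact word_mem_wordSpan (l' := [r, q, p, i]) 1
        · exact word_mem_wordSpan (l' := [p, q, r, i]) 1
        · exact word_mem_wordSpan (l' := [i, q, r, p]) 1
      | 1 =>
        change m (x i) (b (x p) (b (x q) (x r))) ∈ _
        -- The letter is pushed inside twice; the remaining term has the product of `x p` and `x i`
        -- outermost, and `bracket_bracket` moves it to the inside.
        rw [h.mul_bracket, h.anti (b (x q) (x r)), h.comm _ (x i), h.mul_bracket,
          h.bracket_bracket _ (x q), map_smul, map_sub]
        refine Submodule.smul_mem _ _ (sub_mem (Submodule.smul_mem _ _ (sub_mem ?_ ?_))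
          (neg_mem (sub_mem ?_ ?_)))
        · exact word_mem_wordSpan (l' := [p, q, r, i]) 2
        · exact word_mem_wordSpan (l' := [p, r, q, i]) 2
        · exact word_mem_wordSpan (l' := [r, q, p, i]) 2
        · exact word_mem_wordSpan (l' := [q, r, p, i]) 2
      | k + 2 => simp [word]

theorem mul_word_mem_of_pair (i j p q : κ) (k₁ k₂ : ℕ) :
    m (word m b k₁ ([i, j].map x)) (word m b k₂ ([p, q].map x)) ∈
      wordSpan m b x [i, j, p, q] (k₁ + k₂) := by
  have key (i j p q : κ) : m (m (x i) (x j)) (b (x p) (x q)) ∈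
      wordSpan m b x [i, j, p, q] 1 := by
    rw [h.mul_bracket, h.left_comm (x q), h.left_comm (x p)]
    refine Submodule.smul_mem _ _ (sub_mem ?_ ?_)
    · exact word_mem_wordSpan (l' := [p, i, q, j]) 1
    · exact word_mem_wordSpan (l' := [q, i, p, j]) 1
  match k₁, k₂ with
  | 0, 0 =>
    change m (m (x i) (x j)) (m (x p) (x q)) ∈ _
    rw [h.assoc]
    exact word_mem_wordSpan (l' := [i, j, p, q]) 0 rfl
  | 0, 1 => exact key i j p q
  | 1, 0 =>
    change m (b (x i) (x j)) (m (x p) (x q)) ∈ _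
    rw [h.comm, wordSpan_perm (l' := [p, q, i, j])
      (perm_of_sum_singleton (by simp only [List.map, List.sum_cons, List.sum_nil]; abel))]
    exact key p q i j
  | 1, 1 =>
    change m (b (x i) (x j)) (b (x p) (x q)) ∈ _
    rw [h.mul_bracket, h.comm (x q), h.comm (x p), h.comm _ (x q), h.comm _ (x p),
      h.mul_bracket, h.mul_bracket]
    simp only [map_smul, map_sub]
    refine Submodule.smul_mem _ _ (sub_mem (Submodule.smul_mem _ _ (sub_mem ?_ ?_))
      (Submodule.smul_mem _ _ (sub_mem ?_ ?_)))
    · exact word_mem_wordSpan (l' := [p, i, j, q]) 2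
    · exact word_mem_wordSpan (l' := [p, j, i, q]) 2
    · exact word_mem_wordSpan (l' := [q, i, j, p]) 2
    · exact word_mem_wordSpan (l' := [q, j, i, p]) 2
  | k₁ + 2, _ => simp [word]
  | _, k₂ + 2 => simp [word]

theorem bracket_word_mem_of_pair (i j p q : κ) (k₁ k₂ : ℕ) :
    b (word m b k₁ ([i, j].map x)) (word m b k₂ ([p, q].map x)) ∈
      wordSpan m b x [i, j, p, q] (k₁ + k₂ + 1) := by
  have key (i j p q : κ) : b (m (x i) (x j)) (b (x p) (x q)) ∈
      wordSpan m b x [i, j, p, q] 2 := by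
    rw [h.bracket_bracket]
    refine sub_mem ?_ ?_
    · exact word_mem_wordSpan (l' := [q, p, i, j]) 2
    · exact word_mem_wordSpan (l' := [p, q, i, j]) 2
  match k₁, k₂ with
  | 0, 0 =>
    change b (m (x i) (x j)) (m (x p) (x q)) ∈ _
    rw [h.bracket_mul_mul]
    refine Submodule.smul_mem _ _ (sub_mem (sub_mem (add_mem ?_ ?_) ?_) ?_)
    · exact word_mem_wordSpan (l' := [i, j, p, q]) 1 (by simp)
    · exact word_mem_wordSpan (l' := [j, i, p, q]) 1
    · exact word_mem_wordSpan (l' := [p, i, j, q]) 1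
    · exact word_mem_wordSpan (l' := [q, i, j, p]) 1
  | 0, 1 => exact key i j p q
  | 1, 0 =>
    change b (b (x i) (x j)) (m (x p) (x q)) ∈ _
    rw [h.anti, wordSpan_perm (l' := [p, q, i, j])
      (perm_of_sum_singleton (by simp only [List.map, List.sum_cons, List.sum_nil]; abel))]
    exact neg_mem (key p q i j)
  | 1, 1 =>
    change b (b (x i) (x j)) (b (x p) (x q)) ∈ _
    rw [h.bracket_bracket]
    refine sub_mem ?_ ?_
    · exact word_mem_wordSpan (l' := [q, p, i, j]) 3
    · exact word_mem_wordSpan (l' := [p, q, i, j]) 3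
  | k₁ + 2, _ => simp [word]
  | _, k₂ + 2 => simp [word]

/-- With four letters in all, the shorter word is a single letter or both words have two letters. -/
theorem word_mem_of_length_le (r₁ r₂ : List κ) (h₁ : r₁ ≠ []) (h₂ : r₁.length ≤ r₂.length)
    (h₃ : r₁.length + r₂.length ≤ 4) (k₁ k₂ : ℕ) :
    m (word m b k₁ (r₁.map x)) (word m b k₂ (r₂.map x)) ∈
      wordSpan m b x (r₁ ++ r₂) (k₁ + k₂) ∧
    b (word m b k₁ (r₁.map x)) (word m b k₂ (r₂.map x)) ∈
      wordSpan m b x (r₁ ++ r₂) (k₁ + k₂ + 1) := by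
  match r₁, h₁, h₂, h₃ with
  | [i], _, h₂, h₃ =>
    cases k₁ with
    | zero =>
      rw [zero_add]
      refine ⟨h.mul_word_mem_of_singleton i r₂ ?_ ?_ k₂, bracket_word_mem_of_singleton i r₂ k₂⟩
      · rintro rfl
        simp at h₂
      · simp only [List.length_singleton] at h₃
        omega
    | succ k => simp [word]
  | [i, j], _, h₂, h₃ =>
    simp only [List.length_cons, List.length_nil] at h₂ h₃
    obtain ⟨p, q, rfl⟩ := List.length_eq_two.1 (show r₂.length = 2 by omega)
    exact ⟨h.mul_word_mem_of_pair i j p q k₁ k₂, h.bracket_word_mem_of_pair i j p q k₁ k₂⟩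
  | i :: j :: p :: r, _, h₂, h₃ =>
    simp only [List.length_cons] at h₂ h₃
    omega

theorem word_mem (r₁ r₂ : List κ) (h₁ : r₁ ≠ []) (h₂ : r₂ ≠ [])
    (h₃ : r₁.length + r₂.length ≤ 4) (k₁ k₂ : ℕ) :
    m (word m b k₁ (r₁.map x)) (word m b k₂ (r₂.map x)) ∈
      wordSpan m b x (r₁ ++ r₂) (k₁ + k₂) ∧
    b (word m b k₁ (r₁.map x)) (word m b k₂ (r₂.map x)) ∈
      wordSpan m b x (r₁ ++ r₂) (k₁ + k₂ + 1) := by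
  rcases le_total r₁.length r₂.length with hl | hl
  · exact h.word_mem_of_length_le r₁ r₂ h₁ hl h₃ k₁ k₂
  · rw [h.comm, h.anti,
      wordSpan_perm (List.perm_append_comm : (r₁ ++ r₂).Perm (r₂ ++ r₁)) (k₁ + k₂),
      wordSpan_perm (List.perm_append_comm : (r₁ ++ r₂).Perm (r₂ ++ r₁)) (k₁ + k₂ + 1),
      add_comm k₁]
    have := h.word_mem_of_length_le r₂ r₁ h₂ hl (by omega) k₂ k₁ (x := x)
    exact ⟨this.1, neg_mem this.2⟩

theorem mem_wordSpan_append {l₁ l₂ : List κ} {k₁ k₂ : ℕ} {u v : A} (h₁ : l₁ ≠ [])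
    (h₂ : l₂ ≠ []) (h₃ : l₁.length + l₂.length ≤ 4) (hu : u ∈ wordSpan m b x l₁ k₁)
    (hv : v ∈ wordSpan m b x l₂ k₂) :
    m u v ∈ wordSpan m b x (l₁ ++ l₂) (k₁ + k₂) ∧
    b u v ∈ wordSpan m b x (l₁ ++ l₂) (k₁ + k₂ + 1) := by
  have key (r₁ r₂ : List κ) (hr₁ : r₁.Perm l₁) (hr₂ : r₂.Perm l₂) :=
    h.word_mem r₁ r₂ (fun h0 => h₁ (List.perm_nil.1 (h0 ▸ hr₁).symm))
      (fun h0 => h₂ (List.perm_nil.1 (h0 ▸ hr₂).symm))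
      (by rw [hr₁.length_eq, hr₂.length_eq]; exact h₃) k₁ k₂ (x := x)
  constructor
  · refine apply_mem_of_mem_wordSpan m hu hv fun r₁ r₂ hr₁ hr₂ => ?_
    rw [← wordSpan_perm (hr₁.append hr₂)]
    exact (key r₁ r₂ hr₁ hr₂).1
  · refine apply_mem_of_mem_wordSpan b hu hv fun r₁ r₂ hr₁ hr₂ => ?_
    rw [← wordSpan_perm (hr₁.append hr₂)]
    exact (key r₁ r₂ hr₁ hr₂).2

end IsTransposedPoisson

end TransposedPoisson

end SymOperad

namespace SymOperad

/-! ### Relations among words, and detecting zero by characters. -/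

section Words

variable {K : Type u} [Field K] {A : Type u} [AddCommGroup A] [Module K A]
  {m b : A →ₗ[K] A →ₗ[K] A}

namespace IsTransposedPoisson

variable (h : IsTransposedPoisson m b)

include h

theorem word_zero_perm {l l' : List A} (hl : l.Perm l') : word m b 0 l = word m b 0 l' := by
  induction hl with
  | nil => rfl
  | @cons a l l' hl ih =>
    rcases l with _ | ⟨c, l⟩
    · rw [List.nil_perm.1 hl]
    · rw [word_zero_cons m b a (by simp), ih, word_zero_cons m b a]
      rintro rfl
      simp at hl
  | swap a c l =>
    cases l with
    | nil => exact h.comm _ _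
    | cons d l => exact h.left_comm _ _ _
  | trans _ _ h₁ h₂ => exact h₁.trans h₂

theorem bracket_bracket_left (x y z : A) : b (b x y) z = b x (b y z) - b y (b x z) := by
  have h1 := h.bracket_bracket x y z
  have h2 := h.anti (b x y) z
  have h3 : b z (b x y) = -b z (b y x) := by rw [h.anti x y, map_neg]
  have h4 : b y (b x z) = -b y (b z x) := by rw [h.anti x z, map_neg]
  linear_combination (norm := module) h2 - h1 - h3 + h4

theorem bracket_bracket_bracket (x y z t : A) : b x (b y (b z t)) =
    b y (b t (b z x)) - b y (b z (b t x)) + (b z (b t (b y x)) - b t (b z (b y x))) := by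
  rw [h.bracket_bracket x y, h.bracket_bracket_left z t, h.anti (b z t) x,
    h.bracket_bracket x z t, map_neg, map_sub]
  module

variable [CharZero K]

/-- The rule `mul_bracket` applied first with `[u, v]` as the factor, then to `[u, v]` itself. The
result is not visibly symmetric in the two brackets. -/
theorem mul_bracket_bracket (u v z t : A) : (4 : K) • m (b u v) (b z t) =
    b z (b u (m v t)) - b z (b v (m u t)) - b t (b u (m v z)) + b t (b v (m u z)) := by
  have e (y : A) : (2 : K) • m y (b u v) = b u (m v y) - b v (m u y) := by
    rw [h.mul_bracket, smul_smul, mul_inv_cancel₀ two_ne_zero, one_smul]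
  have e' : (2 : K) • m (b u v) (b z t) = b z (m t (b u v)) - b t (m z (b u v)) := by
    rw [h.mul_bracket, smul_smul, mul_inv_cancel₀ two_ne_zero, one_smul]
  have e₁ : (2 : K) • b z (m t (b u v)) = b z (b u (m v t)) - b z (b v (m u t)) := by
    rw [← map_smul, e, map_sub]
  have e₂ : (2 : K) • b t (m z (b u v)) = b t (b u (m v z)) - b t (b v (m u z)) := by
    rw [← map_smul, e, map_sub]
  linear_combination (norm := module) (2 : K) • e' + e₁ - e₂

/-- Commutativity of `[u, v] · [z, t]` equates two expansions by `mul_bracket_bracket`. Combining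
these equations for the three pairings of the letters gives the relation that cuts the twelve words
`[i, [j, k t]]` down to nine. -/
theorem bracket_bracket_mul_cyclic (x y z t : A) :
    (b x (b y (m z t)) - b y (b x (m z t))) + (b y (b z (m x t)) - b z (b y (m x t))) +
      (b z (b x (m y t)) - b x (b z (m y t))) = 0 := by
  have e (u v z t : A) : b z (b u (m v t)) - b z (b v (m u t)) - b t (b u (m v z)) +
      b t (b v (m u z)) = b u (b z (m t v)) - b u (b t (m z v)) - b v (b z (m t u)) +
      b v (b t (m z u)) := by
    rw [← h.mul_bracket_bracket, h.comm, h.mul_bracket_bracket]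
  have e₁ := e x y z t
  have e₂ := e x z y t
  have e₃ := e y z x t
  simp only [h.comm y x, h.comm z x, h.comm t x, h.comm z y, h.comm t y, h.comm t z]
    at e₁ e₂ e₃ ⊢
  linear_combination (norm := module) (2⁻¹ : K) • (e₁ - e₂ + e₃)

end IsTransposedPoisson

/-- The value of the operation `[a₁, [a₂, … [aₖ, aₖ₊₁ ⋯ aₙ]]]` on exponential functions with the
given exponents, for `k < n`. -/
def wordWeight : ℕ → List K → K
  | 0, _ => 1
  | _ + 1, [] => 0
  | k + 1, a :: l => (l.sum - a) * wordWeight k l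

variable {n k : ℕ} {x : Fin n → A} {ℓ : (Fin n → K) → A →ₗ[K] K}

/-- If finitely many words span and their values are linearly independent as functions of the
exponents, then the functionals `ℓ p` together separate points. -/
theorem eq_zero_of_mem_span_words {r : ℕ} (L : Fin r → List (Fin n))
    (hspan : ∀ l : List (Fin n), l.Perm (List.finRange n) → word m b k (l.map x) ∈
      Submodule.span K (Set.range fun s => word m b k ((L s).map x)))
    (hℓ : ∀ s p, ℓ p (word m b k ((L s).map x)) = wordWeight k ((L s).map p))
    (hL : ∀ c : Fin r → K, (∀ p : Fin n → K, ∑ s, c s * wordWeight k ((L s).map p) = 0) → c = 0)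
    {z : A} (hz : z ∈ wordSpan m b x (List.finRange n) k) (h0 : ∀ p, ℓ p z = 0) : z = 0 := by
  have : wordSpan m b x (List.finRange n) k ≤
      Submodule.span K (Set.range fun s => word m b k ((L s).map x)) := by
    refine Submodule.span_le.2 ?_
    rintro _ ⟨l, hl, rfl⟩
    exact hspan l hl
  obtain ⟨c, rfl⟩ := (Submodule.mem_span_range_iff_exists_fun K).1 (this hz)
  have hc := hL c fun p => by simpa [hℓ] using h0 p
  simp [hc]

theorem eq_zero_of_le (hk : n ≤ k) {z : A} (hz : z ∈ wordSpan m b x (List.finRange n) k) :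
    z = 0 := by
  have key : ∀ (k : ℕ) (l : List A), l.length ≤ k → word m b k l = 0 := by
    intro k
    induction k with
    | zero =>
      intro l hl
      rw [List.length_eq_zero_iff.1 (Nat.le_zero.1 hl), word]
    | succ k ih =>
      rintro (_ | ⟨a, l⟩) hl
      · rw [word]
      · rw [word_succ_cons, ih l (by simpa using hl), map_zero]
  have : wordSpan m b x (List.finRange n) k ≤ ⊥ := by
    refine Submodule.span_le.2 ?_
    rintro _ ⟨l, hl, rfl⟩
    exact key k _ (by simpa [hl.length_eq] using hk)
  exact (Submodule.mem_bot K).1 (this hz)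

namespace IsTransposedPoisson

variable (h : IsTransposedPoisson m b)
  (hℓ : ∀ (p : Fin n → K) (l : List (Fin n)), l.Perm (List.finRange n) →
    ℓ p (word m b k (l.map x)) = wordWeight k (l.map p))

include h hℓ

theorem eq_zero_of_word_zero (hk : k = 0) {z : A}
    (hz : z ∈ wordSpan m b x (List.finRange n) k) (h0 : ∀ p, ℓ p z = 0) : z = 0 := by
  subst hk
  refine eq_zero_of_mem_span_words (fun _ : Fin 1 => List.finRange n) (fun l hl => ?_)
    (fun _ p => hℓ p _ (.refl _)) (fun c hc => ?_) hz h0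
  · rw [h.word_zero_perm (hl.map x)]
    exact Submodule.subset_span ⟨0, rfl⟩
  · ext i
    fin_cases i
    simpa [wordWeight] using hc 0

/-- The word starting with `i` has value `∑ j, p j - 2 * p i`. At unit vectors a linear relation
gives `∑ i, c i = 2 * c j` for each `j`, and summing over `j` gives `(n - 2) * ∑ i, c i = 0`. The
case `n = 2` is a true exception, as `[x, y]` and `[y, x]` are proportional. -/
theorem eq_zero_of_word_one [CharZero K] (hn : (n : K) ≠ 2) (hk : k = 1) {z : A}
    (hz : z ∈ wordSpan m b x (List.finRange n) k) (h0 : ∀ p, ℓ p z = 0) : z = 0 := by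
  subst hk
  have hp (i : Fin n) : (i :: (List.finRange n).erase i).Perm (List.finRange n) :=
    (List.perm_cons_erase (List.mem_finRange i)).symm
  refine eq_zero_of_mem_span_words (fun i : Fin n => i :: (List.finRange n).erase i)
    (fun l hl => ?_) (fun i p => hℓ p _ (hp i)) (fun c hc => ?_) hz h0
  · cases l with
    | nil => simp [word]
    | cons i l =>
      refine Submodule.subset_span ⟨i, ?_⟩
      have : ((List.finRange n).erase i).Perm l :=
        (List.cons_perm_iff_perm_erase.1 hl).2.symm
      simp only [List.map_cons, word_succ_cons]
      rw [h.word_zero_perm (this.map x)]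
  · have hw (i : Fin n) (p : Fin n → K) :
        wordWeight 1 ((i :: (List.finRange n).erase i).map p) = ∑ j, p j - 2 * p i := by
      have := ((hp i).map p).sum_eq
      rw [List.map_cons, List.sum_cons, ← List.ofFn_eq_map, List.sum_ofFn] at this
      simp only [List.map_cons, wordWeight, mul_one, ← this]
      ring
    have h1 (j : Fin n) : ∑ i, c i = 2 * c j := by
      have := hc (Pi.single j 1)
      simp only [hw, Finset.mem_univ, if_true, mul_sub,
        Finset.sum_sub_distrib, mul_one, Pi.single_apply, mul_ite, mul_zero,
        Finset.sum_ite_eq'] at this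
      linear_combination this
    have h2 : ∑ i, c i = 0 := by
      have : ∑ _j : Fin n, ∑ i, c i = ∑ j, 2 * c j := Finset.sum_congr rfl fun j _ => h1 j
      rw [Finset.sum_const, Finset.card_univ, Fintype.card_fin, ← Finset.mul_sum, nsmul_eq_mul,
        ← sub_eq_zero, ← sub_mul] at this
      exact (mul_eq_zero.1 this).resolve_left (sub_ne_zero.2 hn)
    ext j
    have := h1 j
    rw [h2, zero_eq_mul] at this
    exact this.resolve_left two_ne_zero

end IsTransposedPoisson

end Words

end SymOperad

namespace SymOperad

/-! ### Explicit spanning sets with two and three brackets. -/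

section Words

variable {K : Type u} [Field K] {A : Type u} [AddCommGroup A] [Module K A]
  {m b : A →ₗ[K] A →ₗ[K] A}

/-- Indices of words with 2 brackets in 3 variables that span all such words. -/
def threeTwoWords : Fin 2 → List (Fin 3) :=
  ![[0, 1, 2], [1, 0, 2]]

/-- Indices of words with 2 brackets in 4 variables that span all such words. -/
def fourTwoWords : Fin 9 → List (Fin 4) :=
  ![[0, 1, 2, 3],
    [0, 2, 1, 3],
    [0, 3, 1, 2],
    [1, 2, 0, 3],
    [1, 3, 0, 2],
    [2, 3, 0, 1],
    [1, 0, 2, 3],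
    [2, 0, 1, 3],
    [3, 0, 1, 2]]

/-- Indices of words with 3 brackets in 4 variables that span all such words. -/
def fourThreeWords : Fin 6 → List (Fin 4) :=
  ![[0, 1, 2, 3], [0, 2, 1, 3], [1, 0, 2, 3], [1, 2, 0, 3], [2, 0, 1, 3], [2, 1, 0, 3]]

namespace IsTransposedPoisson

variable (h : IsTransposedPoisson m b) [CharZero K]

include h

omit [CharZero K] in
theorem eq_zero_three_two {x : Fin 3 → A} {ℓ : (Fin 3 → K) → A →ₗ[K] K}
    (hℓ : ∀ (p : Fin 3 → K) (l : List (Fin 3)), l.Perm (List.finRange 3) →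
      ℓ p (word m b 2 (l.map x)) = wordWeight 2 (l.map p))
    {z : A} (hz : z ∈ wordSpan m b x (List.finRange 3) 2) (h0 : ∀ p, ℓ p z = 0) : z = 0 := by
  refine eq_zero_of_mem_span_words (r := 2)
    threeTwoWords
    (fun l hl => ?_) (fun s p => hℓ p _ (by fin_cases s <;> decide)) (fun c hc => ?_) hz h0
  · generalize hS : Submodule.span K (Set.range fun s => word m b 2 ((threeTwoWords s).map x)) = S
    have hS' (s) : word m b 2 ((threeTwoWords s).map x) ∈ S :=
      hS ▸ Submodule.subset_span (Set.mem_range_self s)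
    have h0 : b (x 0) (b (x 1) (x 2)) ∈ S := hS' 0
    have h1 : b (x 1) (b (x 0) (x 2)) ∈ S := hS' 1
    have key : ∀ l ∈ (List.finRange 3).permutations', l = [0, 1, 2] ∨ l = [0, 2, 1] ∨
        l = [1, 0, 2] ∨ l = [1, 2, 0] ∨ l = [2, 0, 1] ∨ l = [2, 1, 0] := by decide
    obtain rfl | rfl | rfl | rfl | rfl | rfl := key l (List.mem_permutations'.2 hl)
    · exact h0
    · change b (x 0) (b (x 2) (x 1)) ∈ S
      rw [h.anti (x 2), map_neg]
      exact neg_mem h0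
    · exact h1
    · change b (x 1) (b (x 2) (x 0)) ∈ S
      rw [h.anti (x 2), map_neg]
      exact neg_mem h1
    · change b (x 2) (b (x 0) (x 1)) ∈ S
      rw [h.bracket_bracket]
      exact sub_mem h1 h0
    · change b (x 2) (b (x 1) (x 0)) ∈ S
      rw [h.bracket_bracket]
      exact sub_mem h0 h1
  · have key (p q r : K) : c 0 * ((q + r - p) * (r - q)) +
        c 1 * ((p + r - q) * (r - p)) = 0 := by
      have := hc ![p, q, r]
      simp [Fin.sum_univ_succ, wordWeight, threeTwoWords] at this
      linear_combination this
    ext i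
    fin_cases i
    · change c 0 = 0
      -- The second word vanishes at `(0, -1, 0)`, and the first at the point `(1, 2, 2)` used
      -- below.
      linear_combination -key 0 (-1) 0
    · change c 1 = 0
      linear_combination key 1 2 2

/-- The nine words kept are the `[i, [j, k t]]` with `i < j` or `j = 0`. The other three, with `0 <
j < i`, are eliminated by the cyclic relation; there the letter `0` sits in the inner product. -/
theorem eq_zero_four_two {x : Fin 4 → A} {ℓ : (Fin 4 → K) → A →ₗ[K] K}
    (hℓ : ∀ (p : Fin 4 → K) (l : List (Fin 4)), l.Perm (List.finRange 4) →
      ℓ p (word m b 2 (l.map x)) = wordWeight 2 (l.map p))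
    {z : A} (hz : z ∈ wordSpan m b x (List.finRange 4) 2) (h0 : ∀ p, ℓ p z = 0) : z = 0 := by
  refine eq_zero_of_mem_span_words (r := 9)
    fourTwoWords
    (fun l hl => ?_) (fun s p => hℓ p _ (by fin_cases s <;> decide)) (fun c hc => ?_) hz h0
  · generalize hS : Submodule.span K (Set.range fun s => word m b 2 ((fourTwoWords s).map x)) = S
    have hS' (s) : word m b 2 ((fourTwoWords s).map x) ∈ S :=
      hS ▸ Submodule.subset_span (Set.mem_range_self s)
    have base (i j k t : Fin 4) (hp : [i, j, k, t].Perm (List.finRange 4)) (hij : i < j ∨ j = 0) :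
        b (x i) (b (x j) (m (x k) (x t))) ∈ S := by
      have key : ∀ i j k t : Fin 4, [i, j, k, t].Perm (List.finRange 4) → (i < j ∨ j = 0) →
          ∃ s, fourTwoWords s = [i, j, k, t] ∨ fourTwoWords s = [i, j, t, k] := by decide
      obtain ⟨s, hs | hs⟩ := key i j k t hp hij
      · have := hS' s
        rw [hs] at this
        exact this
      · have := hS' s
        rw [hs] at this
        rw [h.comm]
        exact this
    have step (i j t : Fin 4) (hp : [i, j, 0, t].Perm (List.finRange 4)) (hj : j < i) :
        b (x i) (b (x j) (m (x 0) (x t))) ∈ S := by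
      have key : ∀ i j t : Fin 4, [i, j, 0, t].Perm (List.finRange 4) → j < i →
          [0, i, j, t].Perm (List.finRange 4) ∧ [0, j, i, t].Perm (List.finRange 4) ∧
          [i, 0, j, t].Perm (List.finRange 4) ∧ [j, 0, i, t].Perm (List.finRange 4) ∧
          [j, i, 0, t].Perm (List.finRange 4) ∧ 0 < i ∧ 0 < j := by decide
      obtain ⟨h1, h2, h3, h4, h5, hi, hj'⟩ := key i j t hp hj
      have e : b (x i) (b (x j) (m (x 0) (x t))) = b (x j) (b (x i) (m (x 0) (x t))) +
          (b (x i) (b (x 0) (m (x j) (x t))) - b (x 0) (b (x i) (m (x j) (x t)))) +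
          (b (x 0) (b (x j) (m (x i) (x t))) - b (x j) (b (x 0) (m (x i) (x t)))) := by
        have := h.bracket_bracket_mul_cyclic (x 0) (x i) (x j) (x t)
        linear_combination (norm := module) this
      rw [e]
      exact add_mem (add_mem (base _ _ _ _ h5 (.inl hj)) (sub_mem (base _ _ _ _ h3 (.inr rfl))
        (base _ _ _ _ h1 (.inl hi)))) (sub_mem (base _ _ _ _ h2 (.inl hj'))
        (base _ _ _ _ h4 (.inr rfl)))
    have key : ∀ l ∈ (List.finRange 4).permutations', ∃ i j k t, l = [i, j, k, t] ∧
        ((i < j ∨ j = 0) ∨ (k = 0 ∧ j < i) ∨ ([i, j, t, k].Perm (List.finRange 4) ∧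
          t = 0 ∧ j < i)) := by decide
    obtain ⟨i, j, k, t, rfl, hij | ⟨rfl, hj⟩ | ⟨hl', rfl, hj⟩⟩ :=
      key l (List.mem_permutations'.2 hl)
    · exact base i j k t hl hij
    · exact step i j t hl hj
    · change b (x i) (b (x j) (m (x k) (x 0))) ∈ S
      rw [h.comm]
      exact step i j k hl' hj
  · have key (p q r t : K) : c 0 * ((q + r + t - p) * (r + t - q)) +
        c 1 * ((r + q + t - p) * (q + t - r)) +
        c 2 * ((t + q + r - p) * (q + r - t)) +
        c 3 * ((r + p + t - q) * (p + t - r)) +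
        c 4 * ((t + p + r - q) * (p + r - t)) +
        c 5 * ((t + p + q - r) * (p + q - t)) +
        c 6 * ((p + r + t - q) * (r + t - p)) +
        c 7 * ((p + q + t - r) * (q + t - p)) +
        c 8 * ((p + q + r - t) * (q + r - p)) = 0 := by
      have := hc ![p, q, r, t]
      simp [Fin.sum_univ_succ, wordWeight, fourTwoWords] at this
      linear_combination this
    ext i
    fin_cases i
    · change c 0 = 0
      -- The coefficients here and below invert the 9 × 9 matrix of the values of the nine words at
      -- nine sample points.
      linear_combination -(1 / 4) * key 0 (-1) 0 (-1) + (1 / 4) * key 1 (-1) (-1) 1 - (1 / 8)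
        * key (-1) (-1) (-1) 1 + (1 / 4) * key 0 1 0 (-1) - (1 / 2) * key (-1) 0 0 (-1) - (1 /
        4) * key 1 1 0 0 + (3 / 4) * key (-1) 0 0 1 + (3 / 8) * key (-1) (-1) 1 (-1) + (1 / 4)
        * key (-1) 0 (-1) 0
    · change c 1 = 0
      linear_combination (1 / 4) * key 0 (-1) 0 (-1) + (1 / 4) * key 1 1 0 0 - (1 / 4) * key
        (-1) (-1) 1 (-1)
    · change c 2 = 0
      linear_combination (1 / 4) * key 1 (-1) (-1) 1 - (3 / 8) * key (-1) (-1) (-1) 1 + (1 /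
        4) * key 0 1 0 (-1) - (1 / 2) * key (-1) 0 0 (-1) + (1 / 4) * key (-1) 0 0 1 + (1 / 8)
        * key (-1) (-1) 1 (-1) + (1 / 4) * key (-1) 0 (-1) 0
    · change c 3 = 0
      linear_combination (1 / 4) * key (-1) 0 0 (-1)
    · change c 4 = 0
      linear_combination (1 / 4) * key (-1) 0 (-1) 0
    · change c 5 = 0
      linear_combination (1 / 4) * key 1 1 0 0
    · change c 6 = 0
      linear_combination -(1 / 4) * key (-1) (-1) (-1) 1 + (1 / 2) * key 0 1 0 (-1) - (1 / 4)
        * key (-1) 0 0 (-1) + (1 / 4) * key (-1) 0 (-1) 0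
    · change c 7 = 0
      linear_combination -(1 / 4) * key 1 1 0 0 + (1 / 4) * key (-1) (-1) 1 (-1)
    · change c 8 = 0
      linear_combination (1 / 4) * key (-1) (-1) (-1) 1

/-- Only the Lie structure matters here: right-normed brackets whose innermost letter is fixed, here
`3`, span, which leaves `3! = 6` words. -/
theorem eq_zero_four_three {x : Fin 4 → A} {ℓ : (Fin 4 → K) → A →ₗ[K] K}
    (hℓ : ∀ (p : Fin 4 → K) (l : List (Fin 4)), l.Perm (List.finRange 4) →
      ℓ p (word m b 3 (l.map x)) = wordWeight 3 (l.map p))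
    {z : A} (hz : z ∈ wordSpan m b x (List.finRange 4) 3) (h0 : ∀ p, ℓ p z = 0) : z = 0 := by
  refine eq_zero_of_mem_span_words (r := 6)
    fourThreeWords
    (fun l hl => ?_) (fun s p => hℓ p _ (by fin_cases s <;> decide)) (fun c hc => ?_) hz h0
  · generalize hS : Submodule.span K (Set.range fun s => word m b 3 ((fourThreeWords s).map x)) = S
    have hS' (s) : word m b 3 ((fourThreeWords s).map x) ∈ S :=
      hS ▸ Submodule.subset_span (Set.mem_range_self s)
    have base (i j k : Fin 4) (hp : [i, j, k].Perm [0, 1, 2]) :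
        b (x i) (b (x j) (b (x k) (x 3))) ∈ S := by
      have key : ∀ i j k : Fin 4, [i, j, k].Perm [0, 1, 2] →
          ∃ s, fourThreeWords s = [i, j, k, 3] := by decide
      obtain ⟨s, hs⟩ := key i j k hp
      have := hS' s
      rw [hs] at this
      exact this
    have swap : ∀ i j k : Fin 4, [i, j, k].Perm [0, 1, 2] → [i, k, j].Perm [0, 1, 2] ∧
        [j, k, i].Perm [0, 1, 2] ∧ [k, j, i].Perm [0, 1, 2] := by decide
    have key : ∀ l ∈ (List.finRange 4).permutations', ∃ i j k : Fin 4,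
        [i, j, k].Perm [0, 1, 2] ∧ (l = [i, j, k, 3] ∨ l = [i, j, 3, k] ∨ l = [i, 3, j, k] ∨
          l = [3, i, j, k]) := by decide
    obtain ⟨i, j, k, hp, hl'⟩ := key l (List.mem_permutations'.2 hl)
    obtain ⟨h1, h2, h3⟩ := swap i j k hp
    obtain rfl | rfl | rfl | rfl := hl'
    · exact base i j k hp
    · change b (x i) (b (x j) (b (x 3) (x k))) ∈ S
      rw [h.anti (x 3), map_neg, map_neg]
      exact neg_mem (base i j k hp)
    · change b (x i) (b (x 3) (b (x j) (x k))) ∈ S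
      rw [h.bracket_bracket (x 3), map_sub]
      exact sub_mem (base _ _ _ h1) (base _ _ _ hp)
    · change b (x 3) (b (x i) (b (x j) (x k))) ∈ S
      rw [h.bracket_bracket_bracket]
      exact add_mem (sub_mem (base _ _ _ h1) (base _ _ _ hp))
        (sub_mem (base _ _ _ h2) (base _ _ _ h3))
  · have key (p q r t : K) : c 0 * ((q + r + t - p) * (r + t - q) * (t - r)) +
        c 1 * ((r + q + t - p) * (q + t - r) * (t - q)) +
        c 2 * ((p + r + t - q) * (r + t - p) * (t - r)) +
        c 3 * ((r + p + t - q) * (p + t - r) * (t - p)) +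
        c 4 * ((p + q + t - r) * (q + t - p) * (t - q)) +
        c 5 * ((q + p + t - r) * (p + t - q) * (t - p)) = 0 := by
      have := hc ![p, q, r, t]
      simp [Fin.sum_univ_succ, wordWeight, fourThreeWords] at this
      linear_combination this
    ext i
    fin_cases i
    · change c 0 = 0
      -- Again the inverse of a matrix of values, now of six words at six sample points.
      linear_combination (1 / 4) * key (-1) 1 0 (-1) - (1 / 2) * key 0 (-1) 0 0 - (1 / 4) *
        key 1 0 0 (-1)
    · change c 1 = 0
      linear_combination -(1 / 4) * key (-1) 1 0 (-1) + (1 / 2) * key 0 (-1) 0 0 - (1 / 4) *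
        key 1 0 0 (-1)
    · change c 2 = 0
      linear_combination (1 / 4) * key (-1) 1 0 (-1) - (1 / 2) * key 0 (-1) 0 0 + (1 / 4) *
        key 1 0 0 (-1) + (1 / 2) * key (-1) 0 1 (-1)
    · change c 3 = 0
      linear_combination -(1 / 4) * key (-1) 1 0 (-1) + (1 / 2) * key 0 (-1) 0 0 + (1 / 4) *
        key 1 0 0 (-1) + (1 / 2) * key 0 (-1) 1 (-1)
    · change c 4 = 0
      linear_combination (1 / 4) * key (-1) 1 0 (-1) + (1 / 2) * key 0 (-1) 0 0 + (1 / 4) *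
        key 1 0 0 (-1)
    · change c 5 = 0
      linear_combination (1 / 4) * key (-1) 1 0 (-1) + (1 / 2) * key 0 1 (-1) (-1) - (1 / 2) *
        key 0 (-1) 0 0 + (1 / 4) * key 1 0 0 (-1)

end IsTransposedPoisson

end Words

end SymOperad

namespace SymOperad

section PolynomialNotation

open Polynomial

/-! ### Detection of zero in all arities up to four. -/

section Words

variable {K : Type u} [Field K] [CharZero K] {A : Type u} [AddCommGroup A] [Module K A]
  {m b : A →ₗ[K] A →ₗ[K] A}

/-- The values are prescribed only for `k < n`: beyond that words vanish while `wordWeight` need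
not, for example `wordWeight 1 [a] = -a`. -/
theorem IsTransposedPoisson.eq_zero_of_mem_wordSpan (h : IsTransposedPoisson m b) {n k : ℕ}
    (hn : n ≤ 4) {x : Fin n → A} {ℓ : (Fin n → K) → A →ₗ[K] K}
    (hℓ : k < n → ∀ (p : Fin n → K) (l : List (Fin n)), l.Perm (List.finRange n) →
      ℓ p (word m b k (l.map x)) = wordWeight k (l.map p))
    {z : A} (hz : z ∈ wordSpan m b x (List.finRange n) k) (h0 : ∀ p, ℓ p z = 0) : z = 0 := by
  rcases le_or_gt n k with hk | hk
  · exact eq_zero_of_le hk hz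
  specialize hℓ hk
  match k, n, hn, hk with
  | 0, n, _, _ => exact h.eq_zero_of_word_zero hℓ rfl hz h0
  | 1, 2, _, _ =>
    -- The exceptional case of `eq_zero_of_word_one`: by antisymmetry a single word spans.
    refine eq_zero_of_mem_span_words (fun _ : Fin 1 => [0, 1]) (fun l hl => ?_)
      (fun s p => hℓ p _ (by decide)) (fun c hc => ?_) hz h0
    · generalize hS : Submodule.span K
        (Set.range fun _ : Fin 1 => word m b 1 (([0, 1] : List (Fin 2)).map x)) = S
      have hS' : b (x 0) (x 1) ∈ S := hS ▸ Submodule.subset_span ⟨0, rfl⟩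
      have key : ∀ l ∈ (List.finRange 2).permutations', l = [0, 1] ∨ l = [1, 0] := by decide
      obtain rfl | rfl := key l (List.mem_permutations'.2 hl)
      · exact hS'
      · change b (x 1) (x 0) ∈ S
        rw [h.anti]
        exact neg_mem hS'
    · ext i
      fin_cases i
      simpa [wordWeight] using hc ![0, 1]
  | 1, 3, _, _ => exact h.eq_zero_of_word_one hℓ (by norm_num) rfl hz h0
  | 1, 4, _, _ => exact h.eq_zero_of_word_one hℓ (by norm_num) rfl hz h0
  | 2, 3, _, _ => exact h.eq_zero_three_two hℓ hz h0
  | 2, 4, _, _ => exact h.eq_zero_four_two hℓ hz h0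
  | 3, 4, _, _ => exact h.eq_zero_four_three hℓ hz h0
  | k + 4, n, h4, hk => omega
  | 3, 0, _, hk | 3, 1, _, hk | 3, 2, _, hk | 3, 3, _, hk | 2, 0, _, hk | 2, 1, _, hk
  | 2, 2, _, hk | 1, 0, _, hk | 1, 1, _, hk => omega
  | 1, n + 5, h4, _ | 2, n + 5, h4, _ | 3, n + 5, h4, _ => omega

end Words

/-! ### The free transposed Poisson algebra and the kernel of the presentation. -/

section FreeAlgebra

variable {K : Type u} [Field K] {κ : Type}

theorem tpoisRelations_subset (n : ℕ) :
    tpoisRelations K n ⊆ (tpoisIdeal K).carrier (Fin n) := Ideal.subset_span _ n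

variable (K κ) in
/-- The product of the free transposed Poisson algebra. -/
noncomputable def tpMul : FreeAlg (tpoisIdeal K) κ →ₗ[K] FreeAlg (tpoisIdeal K) κ →ₗ[K]
    FreeAlg (tpoisIdeal K) κ := FreeAlg.op _ .mul

variable (K κ) in
/-- The bracket of the free transposed Poisson algebra. -/
noncomputable def tpBracket : FreeAlg (tpoisIdeal K) κ →ₗ[K] FreeAlg (tpoisIdeal K) κ →ₗ[K]
    FreeAlg (tpoisIdeal K) κ := FreeAlg.op _ .bracket

theorem tpMul_mk (s t : Term TPOp κ) :
    tpMul K κ (.mk _ s) (.mk _ t) = .mk _ (.op .mul s t) := FreeAlg.op_mk _ _ _ _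

theorem tpBracket_mk (s t : Term TPOp κ) :
    tpBracket K κ (.mk _ s) (.mk _ t) = .mk _ (.op .bracket s t) := FreeAlg.op_mk _ _ _ _

theorem isTransposedPoisson_freeAlg :
    IsTransposedPoisson (tpMul K κ) (tpBracket K κ) where
  comm x y := by
    induction x using FreeAlg.induction with
    | zero => simp
    | add x x' h h' => simp [h, h']
    | smul a x h => simp [h]
    | mk s =>
    induction y using FreeAlg.induction with
    | zero => simp
    | add x x' h h' => simp [h, h']
    | smul a x h => simp [h]
    | mk t =>
    have := FreeAlg.subst_eq_zero ![s, t] (tpoisRelations_subset (K := K) 2 (Or.inl rfl))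
    simp only [monomial_eq_mono, map_sub, FreeAlg.subst_mono, Term.bind, sub_eq_zero] at this
    rw [tpMul_mk, tpMul_mk]
    exact this
  anti x y := by
    induction x using FreeAlg.induction with
    | zero => simp
    | add x x' h h' => simp [h, h', add_comm]
    | smul a x h => simp [h]
    | mk s =>
    induction y using FreeAlg.induction with
    | zero => simp
    | add x x' h h' => simp [h, h', add_comm]
    | smul a x h => simp [h]
    | mk t =>
    have := FreeAlg.subst_eq_zero ![s, t] (tpoisRelations_subset (K := K) 2 (Or.inr rfl))
    simp only [monomial_eq_mono, map_add, FreeAlg.subst_mono, Term.bind,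
      add_eq_zero_iff_eq_neg] at this
    rw [tpBracket_mk, tpBracket_mk]
    exact this
  assoc x y z := by
    induction x using FreeAlg.induction with
    | zero => simp
    | add x x' h h' => simp [h, h']
    | smul a x h => simp [h]
    | mk s =>
    induction y using FreeAlg.induction with
    | zero => simp
    | add x x' h h' => simp [h, h']
    | smul a x h => simp [h]
    | mk t =>
    induction z using FreeAlg.induction with
    | zero => simp
    | add x x' h h' => simp [h, h']
    | smul a x h => simp [h]
    | mk r =>
    have := FreeAlg.subst_eq_zero ![s, t, r] (tpoisRelations_subset (K := K) 3 (Or.inl rfl))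
    simp only [monomial_eq_mono, map_sub, FreeAlg.subst_mono, Term.bind, sub_eq_zero] at this
    simp only [tpMul_mk]
    exact this
  jacobi x y z := by
    induction x using FreeAlg.induction with
    | zero => simp
    | add x x' h h' =>
      simp only [map_add, LinearMap.add_apply]
      linear_combination (norm := module) h + h'
    | smul a x h =>
      simp only [map_smul, LinearMap.smul_apply]
      linear_combination (norm := module) a • h
    | mk s =>
    induction y using FreeAlg.induction with
    | zero => simp
    | add x x' h h' =>
      simp only [map_add, LinearMap.add_apply]
      linear_combination (norm := module) h + h'
    | smul a x h =>
      simp only [map_smul, LinearMap.smul_apply]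
      linear_combination (norm := module) a • h
    | mk t =>
    induction z using FreeAlg.induction with
    | zero => simp
    | add x x' h h' =>
      simp only [map_add, LinearMap.add_apply]
      linear_combination (norm := module) h + h'
    | smul a x h =>
      simp only [map_smul, LinearMap.smul_apply]
      linear_combination (norm := module) a • h
    | mk r =>
    have := FreeAlg.subst_eq_zero ![s, t, r]
      (tpoisRelations_subset (K := K) 3 (Or.inr (Or.inl rfl)))
    simp only [monomial_eq_mono, map_add, FreeAlg.subst_mono, Term.bind] at this
    simp only [tpBracket_mk]
    exact this
  compat x y z := by
    induction x using FreeAlg.induction with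
    | zero => simp
    | add x x' h h' =>
      simp only [map_add, LinearMap.add_apply]
      linear_combination (norm := module) h + h'
    | smul a x h =>
      simp only [map_smul, LinearMap.smul_apply]
      linear_combination (norm := module) a • h
    | mk s =>
    induction y using FreeAlg.induction with
    | zero => simp
    | add x x' h h' =>
      simp only [map_add, LinearMap.add_apply]
      linear_combination (norm := module) h + h'
    | smul a x h =>
      simp only [map_smul, LinearMap.smul_apply]
      linear_combination (norm := module) a • h
    | mk t =>
    induction z using FreeAlg.induction with
    | zero => simp
    | add x x' h h' =>
      simp only [map_add, LinearMap.add_apply]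
      linear_combination (norm := module) h + h'
    | smul a x h =>
      simp only [map_smul, LinearMap.smul_apply]
      linear_combination (norm := module) a • h
    | mk r =>
    have := FreeAlg.subst_eq_zero ![s, t, r]
      (tpoisRelations_subset (K := K) 3 (Or.inr (Or.inr rfl)))
    simp only [monomial_eq_mono, map_sub, map_add, map_smul, FreeAlg.subst_mono, Term.bind,
      sub_eq_zero] at this
    simp only [tpBracket_mk, tpMul_mk]
    exact this

theorem vars_ne_nil (t : Term TPOp κ) : t.vars ≠ [] := by
  induction t with
  | var i => simp [Term.vars]
  | op o s t hs ht => simp [Term.vars, hs]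

/-- Both branches are straightened by induction and then merged by `mem_wordSpan_append`, which is
where the bound 4 is needed. -/
theorem mk_mem_wordSpan [CharZero K] (t : Term TPOp κ) (ht : t.vars.length ≤ 4) :
    FreeAlg.mk (tpoisIdeal K) t ∈
      wordSpan (tpMul K κ) (tpBracket K κ) (fun i => .mk _ (.var i)) t.vars t.degree := by
  induction t with
  | var i => exact word_mem_wordSpan (l' := [i]) 0 rfl
  | op o s t hs ht' =>
    have hl : s.vars.length + t.vars.length ≤ 4 := by
      simpa [Term.vars] using ht
    have key := (isTransposedPoisson_freeAlg (K := K)).mem_wordSpan_append (vars_ne_nil s)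
      (vars_ne_nil t) hl (hs (by omega)) (ht' (by omega))
    cases o with
    | mul =>
      have := key.1
      rw [tpMul_mk] at this
      have hd : (Term.op TPOp.mul s t).degree = s.degree + t.degree := by
        simp [Term.degree, TPOp.degree]
      rw [hd]
      exact this
    | bracket =>
      have := key.2
      rw [tpBracket_mk] at this
      have hd : (Term.op TPOp.bracket s t).degree = s.degree + t.degree + 1 := by
        simp [Term.degree, TPOp.degree]
        ring
      rw [hd]
      exact this

/-! ### Values of the canonical presentation -/

/-- Each bracket contributes exactly one factor `X`, so the power of `X` separates the parts with
different numbers of brackets. -/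
theorem weight_tpWeight (p : κ → K) (t : Term TPOp κ) :
    t.weight (tpWeight K) p = X ^ t.degree * C ((t.weight (tpWeight K) p).coeff t.degree) := by
  suffices h : ∃ a, t.weight (tpWeight K) p = X ^ t.degree * C a by
    obtain ⟨a, ha⟩ := h
    rw [ha, coeff_X_pow_mul', if_pos le_rfl, Nat.sub_self, coeff_C_zero]
  induction t with
  | var i => exact ⟨1, by simp [Term.weight, Term.degree]⟩
  | op o s t hs ht =>
    obtain ⟨c, hc⟩ := hs
    obtain ⟨d, hd⟩ := ht
    cases o with
    | mul =>
      refine ⟨c * d, ?_⟩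
      simp only [Term.weight, tpWeight, hc, hd, Term.degree, TPOp.degree, C_mul]
      ring
    | bracket =>
      refine ⟨(t.varSum p - s.varSum p) * (c * d), ?_⟩
      simp only [Term.weight, tpWeight, hc, hd, Term.degree, TPOp.degree, C_mul, C_sub]
      ring

theorem exists_term_word (p : κ → K) (k : ℕ) (l : List κ) (hk : k < l.length) :
    ∃ t : Term TPOp κ, t.vars = l ∧
      word (tpMul K κ) (tpBracket K κ) k (l.map fun i => .mk _ (.var i)) = .mk _ t ∧
      t.weight (tpWeight K) p = X ^ k * C (wordWeight k (l.map p)) := by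
  induction l generalizing k with
  | nil => simp at hk
  | cons i l ih =>
    rcases eq_or_ne l [] with rfl | hl
    · obtain rfl : k = 0 := by simpa using hk
      exact ⟨.var i, rfl, rfl, by simp [Term.weight, wordWeight]⟩
    cases k with
    | zero =>
      obtain ⟨t, ht, hw, hwt⟩ := ih 0 (List.length_pos_iff.2 hl)
      refine ⟨.op .mul (.var i) t, by simp [Term.vars, ht], ?_, ?_⟩
      · rw [List.map_cons, word_zero_cons _ _ _ (by simpa using hl), hw, tpMul_mk]
      · simp [Term.weight, tpWeight, hwt, wordWeight]
    | succ k =>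
      obtain ⟨t, ht, hw, hwt⟩ := ih k (by simpa using hk)
      refine ⟨.op .bracket (.var i) t, by simp [Term.vars, ht], ?_, ?_⟩
      · rw [List.map_cons, word_succ_cons, hw, tpBracket_mk]
      · simp only [Term.weight, tpWeight, hwt, wordWeight, Term.varSum, Term.vars, ht, C_mul, C_sub,
          List.map_cons, List.map_nil, List.sum_cons, List.sum_nil, add_zero]
        ring

/-- No calculation is needed: the character factors through `grNov`, where the relations are known
to hold. -/
theorem tpoisIdeal_le_ker_weightCharacter [Finite κ] (p : κ → K) :
    (tpoisIdeal K).carrier κ ≤ LinearMap.ker ((weightCharacter (tpWeight K)).ev κ p) := by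
  obtain ⟨Φ, hΦ, -⟩ := existsUnique_isCanonical K
  intro x hx
  have : Φ.app κ x = 0 := tpoisIdeal_le_ker hΦ κ hx
  rw [LinearMap.mem_ker, ← grNovCharacter_app hΦ, this, map_zero]

/-- The coefficient of `X ^ k` in the value of the character at the multilinear part of an element
of the free transposed Poisson algebra. -/
noncomputable def weightCoeff [Finite κ] (k : ℕ) (p : κ → K) :
    FreeAlg (tpoisIdeal K) κ →ₗ[K] K :=
  lcoeff K k ∘ₗ ((tpoisIdeal K).carrier κ).liftQ ((weightCharacter (tpWeight K)).ev κ p)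
    (tpoisIdeal_le_ker_weightCharacter p) ∘ₗ FreeAlg.multilinearPart _

theorem weightCoeff_mk [Finite κ] (k : ℕ) (p : κ → K) {t : Term TPOp κ} (ht : t.IsMultilinear) :
    weightCoeff k p (.mk _ t) = (t.weight (tpWeight K) p).coeff k := by
  rw [weightCoeff, LinearMap.comp_apply, LinearMap.comp_apply,
    FreeAlg.multilinearPart_mk ⟨t, ht⟩, lcoeff_apply]
  exact congrArg (coeff · k) (weightCharacter_mono (tpWeight K) p ⟨t, ht⟩)

theorem weightCoeff_word {n k : ℕ} (hk : k < n) (p : Fin n → K) (l : List (Fin n))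
    (hl : l.Perm (List.finRange n)) :
    weightCoeff k p (word (tpMul K (Fin n)) (tpBracket K (Fin n)) k
      (l.map fun i => .mk _ (.var i))) = wordWeight k (l.map p) := by
  obtain ⟨t, ht, hw, hwt⟩ := exists_term_word p k l (by simpa [hl.length_eq] using hk)
  have hm : t.IsMultilinear := by
    rw [Term.IsMultilinear, ht]
    exact ⟨hl.symm.nodup (List.nodup_finRange n), fun i => hl.mem_iff.2 (List.mem_finRange i)⟩
  rw [hw, weightCoeff_mk k p hm, hwt, coeff_X_pow_mul', if_pos le_rfl, Nat.sub_self, coeff_C_zero]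

theorem degree_lt_length (t : Term TPOp κ) : t.degree < t.vars.length := by
  induction t with
  | var i => simp [Term.degree, Term.vars]
  | op o s t hs ht =>
    have : o.degree ≤ 1 := by cases o <;> simp [TPOp.degree]
    simp only [Term.degree, Term.vars, List.length_append]
    omega

theorem perm_finRange {n : ℕ} (t : MTerm TPOp (Fin n)) : t.1.vars.Perm (List.finRange n) :=
  (List.perm_ext_iff_of_nodup t.2.1 (List.nodup_finRange n)).2 fun i => by simp [t.2.2 i]

variable (K) in
/-- The class in the free transposed Poisson algebra of the part of an operation of the free operad
with a given number of brackets. -/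
noncomputable def degreePart (n k : ℕ) :
    (free K TPOp).obj (Fin n) →ₗ[K] FreeAlg (tpoisIdeal K) (Fin n) :=
  freeLift fun t => if t.1.degree = k then .mk _ t.1 else 0

/-- A binary tree with `n` leaves has `n - 1` vertices, so fewer than `n` brackets occur. -/
theorem sum_degreePart {n : ℕ} (x : (free K TPOp).obj (Fin n)) :
    ∑ k ∈ Finset.range n, degreePart K n k x = FreeAlg.subst _ Term.var x := by
  have : ∑ k ∈ Finset.range n, degreePart K n k = FreeAlg.subst (tpoisIdeal K) Term.var :=
    free_hom_ext fun t => by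
      have h := degree_lt_length t.1
      rw [(perm_finRange t).length_eq, List.length_finRange] at h
      simp [degreePart, freeLift_mono, FreeAlg.subst_mono, Term.bind_var, h]
  rw [← this, LinearMap.sum_apply]

theorem degreePart_mem [CharZero K] {n : ℕ} (hn : n ≤ 4) (k : ℕ) (x : (free K TPOp).obj (Fin n)) :
    degreePart K n k x ∈ wordSpan (tpMul K (Fin n)) (tpBracket K (Fin n))
      (fun i => .mk _ (.var i)) (List.finRange n) k := by
  have hx : x ∈ Submodule.span K (Set.range (mono K)) := by
    rw [span_range_mono]
    exact Submodule.mem_top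
  induction hx using Submodule.span_induction with
  | mem x hx =>
    obtain ⟨t, rfl⟩ := hx
    rw [degreePart, freeLift_mono]
    split_ifs with ht
    · subst ht
      rw [← wordSpan_perm (perm_finRange t)]
      refine mk_mem_wordSpan t.1 ?_
      rwa [(perm_finRange t).length_eq, List.length_finRange]
    · exact zero_mem _
  | zero => simp
  | add x y _ _ hx hy => simpa using add_mem hx hy
  | smul a x _ hx => simpa using Submodule.smul_mem _ a hx

theorem weightCoeff_degreePart {n : ℕ} (k : ℕ) (p : Fin n → K) (x : (free K TPOp).obj (Fin n)) :
    weightCoeff k p (degreePart K n k x) =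
      ((weightCharacter (tpWeight K)).ev (Fin n) p x).coeff k := by
  have : weightCoeff k p ∘ₗ degreePart K n k =
      lcoeff K k ∘ₗ (weightCharacter (tpWeight K)).ev (Fin n) p := free_hom_ext fun t => by
    rw [LinearMap.comp_apply, LinearMap.comp_apply, weightCharacter_mono, lcoeff_apply, degreePart,
      freeLift_mono]
    split_ifs with ht
    · exact weightCoeff_mk k p t.2
    · rw [map_zero, weight_tpWeight, coeff_X_pow_mul', coeff_C]
      split_ifs with h₁ h₂
      · omega
      · rfl
      · rfl
  exact LinearMap.congr_fun this x

theorem ker_le_tpoisIdeal [CharZero K] {Φ : Hom (free K TPOp) (grNov K)} (hΦ : IsCanonical Φ)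
    {n : ℕ} (hn : n ≤ 4) : LinearMap.ker (Φ.app (Fin n)) ≤ (tpoisIdeal K).carrier (Fin n) := by
  intro x hx
  refine FreeAlg.mem_of_subst_var_eq_zero ?_
  rw [← sum_degreePart]
  refine Finset.sum_eq_zero fun k _ => ?_
  -- The part with `k` brackets is a combination of words, and its values are the coefficients of `X
  -- ^ k` in the values of the character of `grNov` at `Φ x = 0`.
  refine isTransposedPoisson_freeAlg.eq_zero_of_mem_wordSpan hn (ℓ := weightCoeff k)
    (fun hk => weightCoeff_word hk) (degreePart_mem hn k x) fun p => ?_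
  rw [weightCoeff_degreePart, ← grNovCharacter_app hΦ, LinearMap.mem_ker.1 hx, map_zero, coeff_zero]

end FreeAlgebra

end PolynomialNotation

end SymOperad

theorem proposition2p7 (K : Type u) [Field K] [CharZero K] :
    (∃! Φ : SymOperad.Hom (SymOperad.free K SymOperad.TPOp) (SymOperad.grNov K),
      SymOperad.IsCanonical Φ) ∧
    ∀ Φ : SymOperad.Hom (SymOperad.free K SymOperad.TPOp) (SymOperad.grNov K),
      SymOperad.IsCanonical Φ →
        (∀ (ι : Type) [Finite ι], Function.Surjective (Φ.app ι)) ∧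
        ∀ n : ℕ, n ≤ 4 →
          LinearMap.ker (Φ.app (Fin n)) = (SymOperad.tpoisIdeal K).carrier (Fin n) :=
  ⟨SymOperad.existsUnique_isCanonical K, fun _ hΦ =>
    ⟨fun ι _ => SymOperad.surjective_of_isCanonical hΦ ι, fun _ hn =>
      le_antisymm (SymOperad.ker_le_tpoisIdeal hΦ hn) (SymOperad.tpoisIdeal_le_ker hΦ _)⟩⟩
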